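/- Write $\widehat f(\xi)=(2\pi)^{-3}\int_{\mathbb{R}^3}f(x)e^{-ix\cdot\xi}\,dx$ for the Fourier transform (so that $f(x)=\int\widehat f(\xi)e^{ix\cdot\xi}\,d\xi$), and for $s\in\{-1,1\}$ let $\mathcal{X}^{s}$ be the space of tempered distributions $f$ on $\mathbb{R}^3$ whose Fourier transform is a function with $\|f\|_{\mathcal{X}^{s}}=\int_{\mathbb{R}^3}|\xi|^{s}|\widehat f(\xi)|\,d\xi<\infty$. Consider the incompressible Navier–Stokes equations in $\mathbb{R}_+\times\mathbb{R}^3$, $$\partial_t v+v\cdot\nabla v+\nabla p=\mu\Delta v,\qquad \nabla\cdot v=0,\qquad v(0)=v_0,$$ with viscosity $\mu$. A global mild solution is a family $(v(t))_{t\ge 0}$ of real, divergence-free vector fields such that, with $\mathbb{P}$ the Leray projection onto divergence-free fields, $$v(t)=e^{\mu t\Delta}v_0-\int_0^t e^{\mu(t-s)\Delta}\,\mathbb{P}\,\nabla\cdot(v\otimes v)(s)\,ds\qquad\text{for all } t\ge 0 .$$ Then the equations are globally well-posed for real, divergence-free initial data $v_0\in\mathcal{X}^{-1}$ with $\|v_0\|_{\mathcal{X}^{-1}}<\mu$,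 in the following sense. (i) For each such $v_0$ there is a unique global mild solution $v\in C([0,\infty);\mathcal{X}^{-1})\cap L^1((0,\infty);\mathcal{X}^{1})$, and it satisfies $$\sup_{0\le t<\infty}\Big(\|v(t)\|_{\mathcal{X}^{-1}}+\big(\mu-\|v_0\|_{\mathcal{X}^{-1}}\big)\int_0^t\|\nabla v(\tau)\|_{L^\infty}\,d\tau\Big)\le\|v_0\|_{\mathcal{X}^{-1}}.$$ (ii) The solution depends continuously on the data: for every such $v_0$, with solution $v$, and every $\varepsilon>0$ there is $\delta>0$ such that for all real, divergence-free $w_0$ with $\|w_0\|_{\mathcal{X}^{-1}}<\mu$ and $\|w_0-v_0\|_{\mathcal{X}^{-1}}<\delta$, the solution $w$ with data $w_0$ satisfies $\sup_{t\ge 0}\|w(t)-v(t)\|_{\mathcal{X}^{-1}}\le\varepsilon$ and $\int_0^\infty\|w(t)-v(t)\|_{\mathcal{X}^{1}}\,dt\le\varepsilon$. -/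

import Mathlib

open MeasureTheory Set Filter Topology
open scoped SchwartzMap FourierTransform LineDeriv ENNReal

namespace NavierStokes

/-- Physical space (and frequency space) `ℝ³`. -/
abbrev R3 := EuclideanSpace ℝ (Fin 3)

/-- The values `ℂ³` of complex vector fields, with the Euclidean norm. -/
abbrev C3 := EuclideanSpace ℂ (Fin 3)

/-- The standard basis vectors of `ℝ³`. -/
noncomputable def e (j : Fin 3) : R3 := EuclideanSpace.single j 1

/-- The tempered distribution `f` is given by the function `u`. -/
def Represents (f : 𝓢'(R3, C3)) (u : R3 → C3) : Prop :=
  (∀ φ : 𝓢(R3, ℂ), Integrable (fun x => φ x • u x)) ∧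
    ∀ φ : 𝓢(R3, ℂ), f φ = ∫ x, φ x • u x

/-- The Fourier transform of `f` is the function `g`, in the normalization
`ĝ(ξ) = (2π)⁻³ ∫ f(x) exp(-i x·ξ) dx`, that is `f(x) = ∫ g(ξ) exp(i x·ξ) dξ`, for which
`∂ⱼ` becomes `i ξⱼ` and products become convolutions without any constant.
(The Fourier transform `𝓕` of Mathlib uses the kernel `exp(-2π i x·ξ)`.) -/
def HasFourier (f : 𝓢'(R3, C3)) (g : R3 → C3) : Prop :=
  Represents (𝓕 f) (fun ξ => (((2 * Real.pi) ^ 3 : ℝ) : ℂ) • g ((2 * Real.pi) • ξ))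

/-- The norm `∫ |ξ|ˢ |f̂(ξ)| dξ` of the space `𝒳ˢ`; it is `∞` if `f̂` is not a function or if the
integral diverges. Thus `f ∈ 𝒳ˢ` means `XNorm s f < ∞`. -/
noncomputable def XNorm (s : ℝ) (f : 𝓢'(R3, C3)) : ℝ≥0∞ :=
  ⨅ (g : R3 → C3) (_ : HasFourier f g), ∫⁻ ξ, ENNReal.ofReal (‖ξ‖ ^ s) * ‖g ξ‖ₑ

/-- The measure `|ξ|ˢ dξ`; the Fourier transform embeds `𝒳ˢ` isometrically in its `L¹` space. -/
noncomputable def weight (s : ℝ) : Measure R3 :=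
  (volume : Measure R3).withDensity (fun ξ => ENNReal.ofReal (‖ξ‖ ^ s))

/-- `v ∈ C([0, ∞); 𝒳ˢ)`. -/
def ContinuousInX (s : ℝ) (v : ℝ → 𝓢'(R3, C3)) : Prop :=
  ∃ V : ℝ → Lp C3 1 (weight s), ContinuousOn V (Ici 0) ∧
    ∀ t, 0 ≤ t → HasFourier (v t) (V t)

/-- `v ∈ L¹((0, ∞); 𝒳ˢ)`, in the sense of Bochner. -/
def IntegrableInX (s : ℝ) (v : ℝ → 𝓢'(R3, C3)) : Prop :=
  ∃ V : ℝ → Lp C3 1 (weight s), IntegrableOn V (Ioi 0) ∧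
    ∀ᵐ t ∂(volume.restrict (Ioi (0 : ℝ))), HasFourier (v t) (V t)

/-- `f` is real-valued. -/
def IsReal (f : 𝓢'(R3, C3)) : Prop :=
  ∀ φ : 𝓢(R3, ℂ), (∀ x, (φ x).im = 0) → ∀ i, (f φ i).im = 0

/-- `∇ · f = 0` in the sense of distributions. -/
def IsDivFree (f : 𝓢'(R3, C3)) : Prop :=
  ∀ φ : 𝓢(R3, ℂ), ∑ j, (∂_{e j} f) φ j = 0

/-- The norm `‖∇f‖_{L^∞}`, where the matrix `∇f(x)` is measured in the Euclidean (Frobenius) norm;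
it is `∞` if the distributional gradient is not a bounded function. -/
noncomputable def gradSupNorm (f : 𝓢'(R3, C3)) : ℝ≥0∞ :=
  ⨅ (G : Fin 3 → R3 → C3) (_ : ∀ j, Represents (∂_{e j} f) (G j)),
    eLpNorm (fun x => √(∑ j, ‖G j x‖ ^ 2)) ∞ volume

/-- The heat operator `exp(τΔ)`, `τ ≥ 0`, on tempered distributions. -/
noncomputable def heat (τ : ℝ) (f : 𝓢'(R3, C3)) : 𝓢'(R3, C3) :=
  TemperedDistribution.fourierMultiplierCLM C3
    (fun ξ : R3 => (Real.exp (-τ * (2 * Real.pi * ‖ξ‖) ^ 2) : ℂ)) f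

/-- `D = ∇ · (f ⊗ f)`, i.e. `D = ∑ⱼ ∂ⱼ (fⱼ f)`, where `f` is given by a function. -/
def IsDivTensor (f D : 𝓢'(R3, C3)) : Prop :=
  ∃ u : R3 → C3, Represents f u ∧
    ∃ T : Fin 3 → 𝓢'(R3, C3), (∀ j, Represents (T j) (fun x => u x j • u x)) ∧
      D = ∑ j, ∂_{e j} (T j)

/-- The symbol `I - ξ ⊗ ξ / |ξ|²` of the Leray projection. -/
noncomputable def leraySymbol (ξ : R3) (w : C3) : C3 :=
  WithLp.toLp 2 (fun k => w k - (ξ k : ℂ) * (∑ j, (ξ j : ℂ) * w j) / ((‖ξ‖ ^ 2 : ℝ) : ℂ))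

/-- `N = ℙ D`, where `ℙ` is the Leray projection onto divergence-free fields. -/
def IsLerayProj (D N : 𝓢'(R3, C3)) : Prop :=
  ∃ d : R3 → C3, HasFourier D d ∧ HasFourier N (fun ξ => leraySymbol ξ (d ξ))

/-- `v` is a global mild solution of the incompressible Navier–Stokes equations with viscosity `μ`
and initial velocity `v₀`: it is real-valued and divergence free, and
`v(t) = exp(μtΔ) v₀ - ∫₀ᵗ exp(μ(t-s)Δ) ℙ ∇·(v ⊗ v)(s) ds` for all `t ≥ 0`, an identity of
tempered distributions. Here `N s = ℙ ∇·(v ⊗ v)(s)`. -/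
structure IsMildSolution (μ : ℝ) (v₀ : 𝓢'(R3, C3)) (v : ℝ → 𝓢'(R3, C3)) : Prop where
  real : ∀ t, 0 ≤ t → IsReal (v t)
  divFree : ∀ t, 0 ≤ t → IsDivFree (v t)
  duhamel : ∃ N : ℝ → 𝓢'(R3, C3),
    (∀ᵐ s ∂(volume.restrict (Ioi (0 : ℝ))), ∃ D, IsDivTensor (v s) D ∧ IsLerayProj D (N s)) ∧
    ∀ t, 0 ≤ t → ∀ φ : 𝓢(R3, ℂ),
      IntervalIntegrable (fun s => heat (μ * (t - s)) (N s) φ) volume 0 t ∧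
      v t φ = heat (μ * t) v₀ φ - ∫ s in (0 : ℝ)..t, heat (μ * (t - s)) (N s) φ

/-- Admissible initial velocities: real-valued, divergence free, and `‖v₀‖_{𝒳⁻¹} < μ`. -/
structure IsSmallData (μ : ℝ) (v₀ : 𝓢'(R3, C3)) : Prop where
  real : IsReal v₀
  divFree : IsDivFree v₀
  small : XNorm (-1) v₀ < ENNReal.ofReal μ

/-- Global mild solutions in `C([0, ∞); 𝒳⁻¹) ∩ L¹((0, ∞); 𝒳¹)`. -/
structure IsGlobalSolution (μ : ℝ) (v₀ : 𝓢'(R3, C3)) (v : ℝ → 𝓢'(R3, C3)) : Prop where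
  mild : IsMildSolution μ v₀ v
  continuous : ContinuousInX (-1) v
  integrable : IntegrableInX 1 v

end NavierStokes

open NavierStokes

/-!
# Global well-posedness of the Navier–Stokes equations in `𝒳⁻¹` below the viscosity

Everything happens on the Fourier side. A field in `𝒳⁻¹` is a function `g` of the frequency, with
norm `∫ |ξ|⁻¹ |g(ξ)| dξ`, and the nonlinear term `ℙ ∇·(v ⊗ v)` has the Fourier transform
`nonlin g (ξ) = ∫ P(ξ) (i ξ · g(η)) g(ξ - η) dη`, where the Leray symbol `P(ξ)` is a contraction.
Two estimates carry the argument. By Tonelli's theorem, the Duhamel formula with data `g` and force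
`F` satisfies the energy inequality `‖v(t)‖₋₁ + μ ∫₀ᵗ ‖v‖₁ ≤ ‖g‖₋₁ + ∫₀ᵗ ‖F‖₋₁`
(`wnorm_duhamelMaj_add_le`). And since `2 ≤ |ξ|/|η| + |η|/|ξ|`, the nonlinear term satisfies
`‖nonlin v‖₋₁ ≤ ‖v‖₀² ≤ ‖v‖₋₁ ‖v‖₁` (`wnorm_nonlinMaj_le`), without any constant. Hence, as long as
`‖v‖₋₁ < μ`, the dissipation dominates the nonlinear term, the `𝒳⁻¹` norm stays below
`A = ‖v₀‖₋₁`, and `‖v(t)‖₋₁ + (μ - A) ∫₀ᵗ ‖v‖₁ ≤ A`; moreover `‖∇v‖_∞ ≤ ‖v‖₁`.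

*Existence.* The Picard iteration `picard` is majorized at every single frequency by the scalar
iteration `picardMaj`, in which `g` is replaced by `|g|` and the nonlinear term by
`|ξ| (G * G)(ξ)`. The majorants are increasing, they even dominate the telescoping sum of the
increments (`enorm_picard_succ_sub_add_le`), and they satisfy the energy estimate
(`picardMaj_energy`). So the iteration converges at almost every frequency, and dominated
convergence shows that the limit `flow` solves the integral equation (`flow_eq_duhamel`). It is continuous in
time by dominated convergence, and it inherits reality and incompressibility from the iterates.

*Uniqueness and stability.* Testing against Schwartz functions is the same as the Duhamel formula at
almost every frequency (`duhamel_pairing`), so that an arbitrary solution is given by a jointly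
measurable function of time and frequency that solves the integral equation
(`IsGlobalSolution.exists_isFourierSolution`). A continuity argument gives it the a priori bound
(`IsFourierSolution.wnorm_lt`). The difference `z` of two solutions with norms at most `M < μ`
satisfies `‖z(t)‖₋₁ + (μ - M) ∫₀ᵗ ‖z‖₁ ≤ ‖z(0)‖₋₁ + ∫₀ᵗ ‖z‖₋₁ κ`, where `κ` is the mean of the
`𝒳¹` norms of the two solutions. The integral of `κ` is at most `M / (μ - M)`, so that Gronwall's
inequality bounds the left-hand side by a multiple of `‖z(0)‖₋₁` that depends only on `M` and `μ`
(`exists_lipschitz_const`).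
-/

namespace NavierStokes

open scoped ComplexConjugate

/-! ### The Fourier transform of tempered distributions in the angular normalization -/

/-- The homothety `ξ ↦ ξ / 2π`, which converts the kernel `exp(2πi x·ξ)` into `exp(i x·ξ)`. -/
noncomputable def scaling : R3 ≃L[ℝ] R3 :=
  ContinuousLinearEquiv.smulLeft (Units.mk0 ((2 * Real.pi)⁻¹) (by positivity))

@[simp] lemma scaling_apply (ξ : R3) : scaling ξ = (2 * Real.pi)⁻¹ • ξ := rfl

/-- `ft φ ξ = ∫ φ(x) exp(i x·ξ) dx`, as a Schwartz function of `ξ`. This is the transform by which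
`f φ = ∫ ft φ ξ • f̂ ξ dξ`, see `hasFourier_iff`. -/
noncomputable def ft : 𝓢(R3, ℂ) →L[ℂ] 𝓢(R3, ℂ) :=
  (SchwartzMap.compCLMOfContinuousLinearEquiv ℂ scaling) ∘L
    FourierTransform.fourierInvCLM ℂ 𝓢(R3, ℂ)

lemma ft_apply (φ : 𝓢(R3, ℂ)) (ξ : R3) : ft φ ξ = (𝓕⁻ φ) ((2 * Real.pi)⁻¹ • ξ) := rfl

lemma ft_surjective (ψ : 𝓢(R3, ℂ)) : ∃ φ, ft φ = ψ := by
  refine ⟨𝓕 (SchwartzMap.compCLMOfContinuousLinearEquiv ℂ scaling.symm ψ), ?_⟩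
  ext ξ
  rw [ft_apply, FourierTransform.fourierInv_fourier_eq, ← scaling_apply]
  exact congrArg ψ (scaling.symm_apply_apply ξ)

lemma ft_eq_integral (φ : 𝓢(R3, ℂ)) (ξ : R3) :
    ft φ ξ = ∫ x, Complex.exp (Complex.I * (inner ℝ x ξ : ℝ)) * φ x := by
  rw [ft_apply, SchwartzMap.fourierInv_coe, Real.fourierInv_eq']
  refine integral_congr_ae (ae_of_all _ fun x => ?_)
  simp only [smul_eq_mul, inner_smul_right]
  congr 2
  have : (Real.pi : ℂ) ≠ 0 := by exact_mod_cast Real.pi_ne_zero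
  push_cast
  field_simp

lemma integral_scaled_eq (h : R3 → C3) :
    ∫ x, (((2 * Real.pi) ^ 3 : ℝ) : ℂ) • h ((2 * Real.pi) • x) = ∫ x, h x := by
  rw [integral_smul, Measure.integral_comp_smul]
  have h1 : |((2 * Real.pi) ^ 3)⁻¹| = ((2 * Real.pi) ^ 3)⁻¹ := abs_of_pos (by positivity)
  rw [finrank_euclideanSpace_fin, h1]
  have h2 : (((2 * Real.pi) ^ 3 : ℝ) : ℂ) ≠ 0 := by exact_mod_cast (by positivity)
  rw [← Complex.coe_smul ((2 * Real.pi) ^ 3)⁻¹, smul_smul, Complex.ofReal_inv,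
    mul_inv_cancel₀ h2, one_smul]

lemma integrable_scaled_iff (h : R3 → C3) :
    Integrable (fun x => (((2 * Real.pi) ^ 3 : ℝ) : ℂ) • h ((2 * Real.pi) • x)) ↔ Integrable h := by
  have h2 : (((2 * Real.pi) ^ 3 : ℝ) : ℂ) ≠ 0 := by exact_mod_cast (by positivity)
  rw [integrable_fun_smul_iff h2]
  exact integrable_comp_smul_iff volume h (by positivity)

/-- The defining property of the Fourier transform in its natural form
`f φ = ∫ ft φ ξ • f̂ ξ dξ`. -/
lemma hasFourier_iff {f : 𝓢'(R3, C3)} {g : R3 → C3} :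
    HasFourier f g ↔ (∀ ψ : 𝓢(R3, ℂ), Integrable (fun ξ => ψ ξ • g ξ)) ∧
      ∀ φ : 𝓢(R3, ℂ), f φ = ∫ ξ, ft φ ξ • g ξ := by
  have key : ∀ φ : 𝓢(R3, ℂ), (fun ξ => (𝓕⁻ φ) ξ • (((2 * Real.pi) ^ 3 : ℝ) : ℂ) •
      g ((2 * Real.pi) • ξ)) = fun ξ => (((2 * Real.pi) ^ 3 : ℝ) : ℂ) •
        (fun ξ => ft φ ξ • g ξ) ((2 * Real.pi) • ξ) := by
    intro φ
    ext1 ξ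
    have : (2 * Real.pi)⁻¹ • (2 * Real.pi) • ξ = ξ := by
      rw [smul_smul, inv_mul_cancel₀ (by positivity), one_smul]
    simp only [ft_apply, this]
    rw [smul_comm]
  unfold HasFourier Represents
  constructor
  · rintro ⟨h1, h2⟩
    refine ⟨fun ψ => ?_, fun φ => ?_⟩
    · obtain ⟨φ, rfl⟩ := ft_surjective ψ
      have := h1 (𝓕⁻ φ)
      rwa [key φ, integrable_scaled_iff fun ξ => ft φ ξ • g ξ] at this
    · have := h2 (𝓕⁻ φ)
      rwa [TemperedDistribution.fourier_apply, FourierTransform.fourier_fourierInv_eq, key φ,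
        integral_scaled_eq fun ξ => ft φ ξ • g ξ] at this
  · rintro ⟨h1, h2⟩
    refine ⟨fun ψ => ?_, fun ψ => ?_⟩
    · have := h1 (ft (𝓕 ψ))
      rw [← integrable_scaled_iff, ← key, FourierTransform.fourierInv_fourier_eq] at this
      exact this
    · have := h2 (𝓕 ψ)
      rw [← integral_scaled_eq, ← key, FourierTransform.fourierInv_fourier_eq] at this
      exact this

lemma hasFourier_apply {f : 𝓢'(R3, C3)} {g : R3 → C3} (h : HasFourier f g) (φ : 𝓢(R3, ℂ)) :
    f φ = ∫ ξ, ft φ ξ • g ξ := (hasFourier_iff.1 h).2 φ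

lemma HasFourier.integrable_smul {f : 𝓢'(R3, C3)} {g : R3 → C3} (h : HasFourier f g)
    (ψ : 𝓢(R3, ℂ)) : Integrable (fun ξ => ψ ξ • g ξ) := (hasFourier_iff.1 h).1 ψ

lemma HasFourier.congr_ae {f : 𝓢'(R3, C3)} {g g' : R3 → C3} (h : HasFourier f g)
    (hg : g =ᵐ[volume] g') : HasFourier f g' := by
  have h0 : ∀ ψ : 𝓢(R3, ℂ), (fun ξ => ψ ξ • g ξ) =ᵐ[volume] fun ξ => ψ ξ • g' ξ := by
    intro ψ
    filter_upwards [hg] with ξ hξ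
    rw [hξ]
  rw [hasFourier_iff] at h ⊢
  refine ⟨fun ψ => (h.1 ψ).congr (h0 ψ), fun φ => ?_⟩
  rw [h.2 φ, integral_congr_ae (h0 _)]

lemma exists_schwartz_eq_one (K : Set R3) (hK : IsCompact K) :
    ∃ ψ : 𝓢(R3, ℂ), ∀ x ∈ K, ψ x = 1 := by
  obtain ⟨r, hr, hKr⟩ := hK.isBounded.subset_closedBall_lt 0 0
  let b : ContDiffBump (0 : R3) := ⟨r, r + 1, hr, by linarith⟩
  have hg₁ : HasCompactSupport (Complex.ofRealCLM ∘ b) := b.hasCompactSupport.comp_left rfl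
  have hg₂ : ContDiff ℝ (⊤ : ℕ∞) (Complex.ofRealCLM ∘ b) := by
    exact Complex.ofRealCLM.contDiff.comp b.contDiff
  refine ⟨hg₁.toSchwartzMap hg₂, fun x hx => ?_⟩
  have : b x = 1 := b.one_of_mem_closedBall (hKr hx)
  simp [this]

section uniqueness

variable {F : Type*} [NormedAddCommGroup F] [NormedSpace ℂ F]

lemma locallyIntegrable_of_forall_schwartz {u : R3 → F}
    (hu : ∀ φ : 𝓢(R3, ℂ), Integrable (fun x => φ x • u x)) : LocallyIntegrable u := by
  rw [locallyIntegrable_iff]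
  intro K hK
  obtain ⟨ψ, hψ⟩ := exists_schwartz_eq_one K hK
  refine ((hu ψ).integrableOn (s := K)).congr_fun (fun x hx => ?_) hK.measurableSet
  simp [hψ x hx]

lemma aestronglyMeasurable_of_forall_schwartz {u : R3 → F}
    (hu : ∀ φ : 𝓢(R3, ℂ), Integrable (fun x => φ x • u x)) : AEStronglyMeasurable u volume :=
  (locallyIntegrable_of_forall_schwartz hu).aestronglyMeasurable

lemma ae_eq_of_forall_schwartz [CompleteSpace F] {u u' : R3 → F}
    (hu : ∀ φ : 𝓢(R3, ℂ), Integrable (fun x => φ x • u x))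
    (hu' : ∀ φ : 𝓢(R3, ℂ), Integrable (fun x => φ x • u' x))
    (h : ∀ φ : 𝓢(R3, ℂ), ∫ x, φ x • u x = ∫ x, φ x • u' x) : u =ᵐ[volume] u' := by
  have h0 : ∀ᵐ x, u x - u' x = 0 := by
    apply ae_eq_zero_of_integral_contDiff_smul_eq_zero
    · exact (locallyIntegrable_of_forall_schwartz hu).sub (locallyIntegrable_of_forall_schwartz hu')
    · intro g g_smooth g_cpt
      have hg₁ : HasCompactSupport (Complex.ofRealCLM ∘ g) := g_cpt.comp_left rfl
      have hg₂ : ContDiff ℝ (⊤ : ℕ∞) (Complex.ofRealCLM ∘ g) :=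
        Complex.ofRealCLM.contDiff.comp g_smooth
      have := h (hg₁.toSchwartzMap hg₂)
      rw [← sub_eq_zero, ← integral_sub (hu _) (hu' _)] at this
      simpa [smul_sub] using this
  filter_upwards [h0] with x hx using sub_eq_zero.1 hx

end uniqueness

lemma Represents.ae_eq {f : 𝓢'(R3, C3)} {u u' : R3 → C3} (h : Represents f u)
    (h' : Represents f u') : u =ᵐ[volume] u' :=
  ae_eq_of_forall_schwartz h.1 h'.1 fun φ => (h.2 φ).symm.trans (h'.2 φ)

lemma HasFourier.ae_eq {f : 𝓢'(R3, C3)} {g g' : R3 → C3} (h : HasFourier f g)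
    (h' : HasFourier f g') : g =ᵐ[volume] g' := by
  refine ae_eq_of_forall_schwartz h.integrable_smul h'.integrable_smul fun ψ => ?_
  obtain ⟨φ, rfl⟩ := ft_surjective ψ
  rw [← hasFourier_apply h, ← hasFourier_apply h']

lemma HasFourier.aestronglyMeasurable {f : 𝓢'(R3, C3)} {g : R3 → C3} (h : HasFourier f g) :
    AEStronglyMeasurable g volume := aestronglyMeasurable_of_forall_schwartz h.integrable_smul

lemma HasFourier.add {f f' : 𝓢'(R3, C3)} {g g' : R3 → C3} (h : HasFourier f g)
    (h' : HasFourier f' g') : HasFourier (f + f') (fun ξ => g ξ + g' ξ) := by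
  rw [hasFourier_iff] at *
  refine ⟨fun ψ => ?_, fun φ => ?_⟩
  · simp only [smul_add]
    exact (h.1 ψ).add (h'.1 ψ)
  · simp only [smul_add]
    rw [integral_add (h.1 _) (h'.1 _), ← h.2, ← h'.2]
    rfl

lemma HasFourier.sub {f f' : 𝓢'(R3, C3)} {g g' : R3 → C3} (h : HasFourier f g)
    (h' : HasFourier f' g') : HasFourier (f - f') (fun ξ => g ξ - g' ξ) := by
  rw [hasFourier_iff] at *
  refine ⟨fun ψ => ?_, fun φ => ?_⟩
  · simp only [smul_sub]
    exact (h.1 ψ).sub (h'.1 ψ)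
  · simp only [smul_sub]
    rw [integral_sub (h.1 _) (h'.1 _), ← h.2, ← h'.2]
    rfl

lemma HasFourier.zero : HasFourier 0 (fun _ => 0) := by
  rw [hasFourier_iff]
  refine ⟨fun ψ => by simp, fun φ => ?_⟩
  simp

lemma HasFourier.sum {ι : Type*} (s : Finset ι) {f : ι → 𝓢'(R3, C3)} {g : ι → R3 → C3}
    (h : ∀ i ∈ s, HasFourier (f i) (g i)) :
    HasFourier (∑ i ∈ s, f i) (fun ξ => ∑ i ∈ s, g i ξ) := by
  classical
  induction s using Finset.induction_on with
  | empty => simpa using HasFourier.zero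
  | insert a s ha ih =>
    simp only [Finset.sum_insert ha]
    exact (h a (by simp)).add (ih fun i hi => h i (by simp [hi]))

lemma HasFourier.eq {f f' : 𝓢'(R3, C3)} {g : R3 → C3} (h : HasFourier f g)
    (h' : HasFourier f' g) : f = f' := by
  ext1 φ
  rw [hasFourier_apply h, hasFourier_apply h']

lemma ft_lineDeriv (j : Fin 3) (φ : 𝓢(R3, ℂ)) (ξ : R3) :
    ft (∂_{e j} φ) ξ = -(Complex.I * (ξ j : ℂ)) * ft φ ξ := by
  rw [ft_apply, SchwartzMap.fourierInv_lineDerivOp_eq, ft_apply]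
  have : (inner ℝ · (e j) : R3 → ℝ).HasTemperateGrowth := by fun_prop
  have h2 : inner ℝ ((2 * Real.pi)⁻¹ • ξ) (e j) = (2 * Real.pi)⁻¹ * ξ j := by
    rw [inner_smul_left]; simp [e, EuclideanSpace.inner_single_right]
  rw [smul_apply, SchwartzMap.smulLeftCLM_apply_apply this, h2]
  have : (Real.pi : ℂ) ≠ 0 := by exact_mod_cast Real.pi_ne_zero
  simp
  field_simp

/-- `∂ⱼ` is multiplication by `i ξⱼ` on the Fourier side. -/
lemma HasFourier.lineDeriv {f : 𝓢'(R3, C3)} {g : R3 → C3} (h : HasFourier f g) (j : Fin 3) :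
    HasFourier (∂_{e j} f) (fun ξ => (Complex.I * (ξ j : ℂ)) • g ξ) := by
  have hg : (fun ξ : R3 => Complex.I * (ξ j : ℂ)).HasTemperateGrowth := by
    have : (fun ξ : R3 => Complex.I * (ξ j : ℂ)) =
      fun ξ => Complex.I * ((inner ℝ ξ (e j) : ℝ) : ℂ) := by
      ext ξ; simp [e, EuclideanSpace.inner_single_right]
    rw [this]
    fun_prop
  rw [hasFourier_iff]
  refine ⟨fun ψ => ?_, fun φ => ?_⟩
  · refine (h.integrable_smul (SchwartzMap.smulLeftCLM ℂ (fun ξ : R3 => Complex.I * (ξ j : ℂ))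
      ψ)).congr (ae_of_all _ fun ξ => ?_)
    simp only [SchwartzMap.smulLeftCLM_apply_apply hg, smul_eq_mul, smul_smul]
    rw [mul_comm]
  · rw [TemperedDistribution.lineDerivOp_apply_apply, hasFourier_apply h]
    refine integral_congr_ae (ae_of_all _ fun ξ => ?_)
    simp only [map_neg, neg_apply, ft_lineDeriv, smul_smul]
    congr 1
    ring

/-- Gaussians `exp(-c|ξ|²)` with `c ≥ 0` are admissible Fourier multipliers. -/
lemma hasTemperateGrowth_gaussian {c : ℝ} (hc : 0 ≤ c) :
    (fun ξ : R3 => (Real.exp (-c * ‖ξ‖ ^ 2) : ℂ)).HasTemperateGrowth := by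
  have h1 : ((fun r : ℝ => Real.exp (-c * r)) ∘ fun ξ : R3 => ‖ξ‖ ^ 2).HasTemperateGrowth := by
    refine Function.HasTemperateGrowth.comp' (t := Ici (0 : ℝ)) ?_ (uniqueDiffOn_Ici 0) ?_ ?_
      (Function.hasTemperateGrowth_norm_sq R3)
    · rintro _ ⟨ξ, rfl⟩
      exact mem_Ici.2 (by positivity)
    · exact (by fun_prop : ContDiff ℝ (⊤ : ℕ∞) fun r : ℝ => Real.exp (-c * r)).contDiffOn
    · intro N
      refine ⟨0, (1 + c) ^ N, by positivity, fun n hn r hr => ?_⟩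
      have hcd : ContDiff ℝ n fun r : ℝ => Real.exp (-c * r) := by fun_prop
      rw [norm_iteratedFDerivWithin_eq_norm_iteratedDerivWithin,
        iteratedDerivWithin_eq_iteratedDeriv (uniqueDiffOn_Ici 0) hcd.contDiffAt hr,
        iteratedDeriv_exp_const_mul]
      simp only [norm_mul, norm_pow, norm_neg, Real.norm_eq_abs, abs_of_nonneg hc, Real.abs_exp,
        pow_zero, mul_one]
      have h2 : Real.exp (-c * r) ≤ 1 := by
        rw [Real.exp_le_one_iff]
        have := mul_nonneg hc (mem_Ici.1 hr)
        linarith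
      calc c ^ n * Real.exp (-c * r) ≤ c ^ n * 1 := by gcongr
        _ ≤ (1 + c) ^ n := by rw [mul_one]; gcongr; linarith
        _ ≤ (1 + c) ^ N := pow_le_pow_right₀ (by linarith) hn
  exact Function.HasTemperateGrowth.comp Function.Complex.hasTemperateGrowth_ofReal h1

/-- The heat flow is multiplication by `exp(-τ|ξ|²)` on the Fourier side. -/
lemma HasFourier.heat {f : 𝓢'(R3, C3)} {g : R3 → C3} (h : HasFourier f g) {τ : ℝ} (hτ : 0 ≤ τ) :
    HasFourier (heat τ f) (fun ξ => (Real.exp (-τ * ‖ξ‖ ^ 2) : ℂ) • g ξ) := by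
  have hg := hasTemperateGrowth_gaussian hτ
  have hg' : (fun ξ : R3 => (Real.exp (-τ * (2 * Real.pi * ‖ξ‖) ^ 2) : ℂ)).HasTemperateGrowth := by
    have := hasTemperateGrowth_gaussian (c := τ * (2 * Real.pi) ^ 2) (by positivity)
    convert this using 4
    ring
  rw [hasFourier_iff]
  refine ⟨fun ψ => ?_, fun φ => ?_⟩
  · refine (h.integrable_smul (SchwartzMap.smulLeftCLM ℂ
      (fun ξ : R3 => (Real.exp (-τ * ‖ξ‖ ^ 2) : ℂ)) ψ)).congr (ae_of_all _ fun ξ => ?_)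
    simp only [SchwartzMap.smulLeftCLM_apply_apply hg, smul_eq_mul, smul_smul]
    rw [mul_comm]
  · rw [NavierStokes.heat, TemperedDistribution.fourierMultiplierCLM_apply_apply,
      hasFourier_apply h]
    refine integral_congr_ae (ae_of_all _ fun ξ => ?_)
    simp only [ft_apply, FourierTransform.fourierInv_fourier_eq,
      SchwartzMap.smulLeftCLM_apply_apply hg', norm_smul, smul_smul]
    congr 1
    rw [smul_eq_mul, mul_comm]
    congr 3
    rw [Real.norm_of_nonneg (by positivity)]
    field_simp

/-! ### Distributions with a prescribed Fourier transform -/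

lemma hasTemperateGrowth_one_add_norm_sq :
    (fun ξ : R3 => (((1 + ‖ξ‖ ^ 2 : ℝ)) : ℂ)).HasTemperateGrowth := by
  have h1 : (fun ξ : R3 => (1 + ‖ξ‖ ^ 2 : ℝ)).HasTemperateGrowth :=
    (Function.HasTemperateGrowth.const 1).add (Function.hasTemperateGrowth_norm_sq R3)
  exact Function.HasTemperateGrowth.comp Function.Complex.hasTemperateGrowth_ofReal h1

lemma integrable_schwartz_smul {F : Type*} [NormedAddCommGroup F] [NormedSpace ℂ F] {h : R3 → F}
    (hh : Integrable h) (ψ : 𝓢(R3, ℂ)) : Integrable (fun ξ => ψ ξ • h ξ) :=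
  hh.bdd_smul ‖ψ.toBoundedContinuousFunction‖ ψ.continuous.aestronglyMeasurable
    (ae_of_all _ fun ξ => ψ.toBoundedContinuousFunction.norm_coe_le_norm ξ)

lemma norm_exp_I_mul (r : ℝ) : ‖Complex.exp (Complex.I * (r : ℂ))‖ = 1 := by
  rw [mul_comm]; exact Complex.norm_exp_ofReal_mul_I r

/-- Every function that is integrable against `(1 + |ξ|²)⁻¹` is the Fourier transform of some
tempered distribution. -/
lemma exists_hasFourier {g : R3 → C3}
    (hg : Integrable (fun ξ => (((1 + ‖ξ‖ ^ 2)⁻¹ : ℝ) : ℂ) • g ξ)) :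
    ∃ f : 𝓢'(R3, C3), HasFourier f g := by
  set h := (memLp_one_iff_integrable.2 hg).toLp with hh
  have hae : h =ᵐ[volume] _ := (memLp_one_iff_integrable.2 hg).coeFn_toLp
  set m := SchwartzMap.smulLeftCLM ℂ (fun ξ : R3 => (((1 + ‖ξ‖ ^ 2 : ℝ)) : ℂ)) with hm
  have hpt : ∀ (ψ : 𝓢(R3, ℂ)), (fun ξ => (m ψ) ξ • h ξ) =ᵐ[volume] fun ξ => ψ ξ • g ξ := by
    intro ψ
    filter_upwards [hae] with ξ hξ
    rw [hξ, hm, SchwartzMap.smulLeftCLM_apply_apply hasTemperateGrowth_one_add_norm_sq]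
    simp only [smul_smul, smul_eq_mul]
    congr 1
    have : ((1 + ‖ξ‖ ^ 2 : ℝ) : ℂ) ≠ 0 := by exact_mod_cast (by positivity)
    rw [Complex.ofReal_inv]
    field_simp
  refine ⟨PointwiseConvergenceCLM.precomp C3 (m ∘L ft)
    (MeasureTheory.Lp.toTemperedDistribution h), hasFourier_iff.2 ⟨fun ψ => ?_, fun φ => ?_⟩⟩
  · refine Integrable.congr ?_ (hpt ψ)
    exact integrable_schwartz_smul (L1.integrable_coeFn h) (m ψ)
  · rw [← integral_congr_ae (hpt _), ← MeasureTheory.Lp.toTemperedDistribution_apply]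
    rfl

/-- The hypothesis of `exists_hasFourier` in terms of the weighted norms that occur for solutions
(`s = -1`) and for products (`s = 0`). -/
lemma integrable_of_weighted {g : R3 → C3} (hm : AEStronglyMeasurable g volume)
    {s : ℝ} (hs : s = -1 ∨ s = 0) (hg : ∫⁻ ξ, ENNReal.ofReal (‖ξ‖ ^ s) * ‖g ξ‖ₑ ≠ ∞) :
    Integrable (fun ξ => (((1 + ‖ξ‖ ^ 2)⁻¹ : ℝ) : ℂ) • g ξ) := by
  refine ⟨?_, ?_⟩
  · have hc : Continuous fun ξ : R3 => (((1 + ‖ξ‖ ^ 2)⁻¹ : ℝ) : ℂ) :=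
      Complex.continuous_ofReal.comp (Continuous.inv₀ (by fun_prop) fun ξ => by positivity)
    exact hc.aestronglyMeasurable.smul hm
  · refine lt_of_le_of_lt (lintegral_mono_ae ?_) (lt_top_iff_ne_top.2 hg)
    have : ∀ᵐ ξ : R3, ξ ≠ 0 := by simp [ae_iff, measure_singleton]
    filter_upwards [this] with ξ hξ
    rw [enorm_smul]
    gcongr
    rw [← ofReal_norm, Complex.norm_real, Real.norm_of_nonneg (by positivity)]
    apply ENNReal.ofReal_le_ofReal
    have h0 : 0 < ‖ξ‖ := norm_pos_iff.2 hξ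
    rcases hs with rfl | rfl
    · rw [Real.rpow_neg_one]
      gcongr
      nlinarith [sq_nonneg (‖ξ‖ - 1)]
    · rw [Real.rpow_zero]
      exact inv_le_one_of_one_le₀ (by nlinarith)

lemma XNorm_eq {f : 𝓢'(R3, C3)} {g : R3 → C3} (h : HasFourier f g) (s : ℝ) :
    XNorm s f = ∫⁻ ξ, ENNReal.ofReal (‖ξ‖ ^ s) * ‖g ξ‖ₑ := by
  refine le_antisymm (iInf₂_le g h) (le_iInf₂ fun g' h' => ?_)
  refine (lintegral_congr_ae ?_).le
  filter_upwards [h.ae_eq h'] with ξ hξ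
  rw [hξ]

lemma exists_hasFourier_of_XNorm_lt {f : 𝓢'(R3, C3)} {s : ℝ} {c : ℝ≥0∞} (h : XNorm s f < c) :
    ∃ g : R3 → C3, HasFourier f g := by
  simp only [XNorm, iInf_lt_iff] at h
  obtain ⟨g, hg, -⟩ := h
  exact ⟨g, hg⟩

/-! ### Fields with integrable Fourier transform -/

/-- The function `x ↦ ∫ g(ξ) exp(i x·ξ) dξ` with Fourier transform `g`. -/
noncomputable def synth {F : Type*} [NormedAddCommGroup F] [NormedSpace ℂ F] (g : R3 → F)
    (x : R3) : F :=
  ∫ ξ, Complex.exp (Complex.I * (inner ℝ x ξ : ℝ)) • g ξ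

section synth

variable {F : Type*} [NormedAddCommGroup F] [NormedSpace ℂ F]

lemma synth_eq_fourier (g : R3 → F) (x : R3) : synth g x = 𝓕 g (-((2 * Real.pi)⁻¹ • x)) := by
  rw [synth, Real.fourier_eq']
  refine integral_congr_ae (ae_of_all _ fun ξ => ?_)
  simp only [inner_neg_right, inner_smul_right, real_inner_comm ξ x]
  congr 2
  have : (Real.pi : ℂ) ≠ 0 := by exact_mod_cast Real.pi_ne_zero
  push_cast
  field_simp

lemma continuous_synth {g : R3 → F} (hg : Integrable g) : Continuous (synth g) := by
  refine continuous_of_dominated (bound := fun ξ => ‖g ξ‖) (fun x => ?_) (fun x => ?_) hg.norm ?_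
  · exact (Continuous.aestronglyMeasurable (by fun_prop)).smul hg.1
  · exact ae_of_all _ fun ξ => by rw [norm_smul, norm_exp_I_mul, one_mul]
  · exact ae_of_all _ fun ξ => by fun_prop

lemma norm_synth_le (g : R3 → F) (x : R3) : ‖synth g x‖ ≤ ∫ ξ, ‖g ξ‖ := by
  refine (norm_integral_le_integral_norm _).trans (le_of_eq ?_)
  refine integral_congr_ae (ae_of_all _ fun ξ => ?_)
  simp only [norm_smul, norm_exp_I_mul, one_mul]

end synth

/-- A distribution with integrable Fourier transform is given by a bounded continuous function. -/
lemma HasFourier.represents_synth {f : 𝓢'(R3, C3)} {g : R3 → C3} (h : HasFourier f g)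
    (hg : Integrable g) : Represents f (synth g) := by
  refine ⟨fun φ => ?_, fun φ => ?_⟩
  · exact φ.integrable.smul_bdd (∫ ξ, ‖g ξ‖) (continuous_synth hg).aestronglyMeasurable
      (ae_of_all _ fun x => norm_synth_le g x)
  · rw [hasFourier_apply h]
    have h1 : Integrable (Function.uncurry fun (ξ x : R3) =>
        Complex.exp (Complex.I * (inner ℝ x ξ : ℝ)) • φ x • g ξ) (volume.prod volume) := by
      have h2 : Integrable (fun p : R3 × R3 => φ p.2 • g p.1) (volume.prod volume) := by
        exact ((φ.integrable (μ := volume)).smul_prod hg).swap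
      have hc : Continuous fun p : R3 × R3 => Complex.exp (Complex.I * (inner ℝ p.2 p.1 : ℝ)) := by
        fun_prop
      exact h2.bdd_smul 1 hc.aestronglyMeasurable (ae_of_all _ fun p => (norm_exp_I_mul _).le)
    calc ∫ ξ, ft φ ξ • g ξ = ∫ ξ, ∫ x, Complex.exp (Complex.I * (inner ℝ x ξ : ℝ)) • φ x • g ξ := by
          refine integral_congr_ae (ae_of_all _ fun ξ => ?_)
          simp only [ft_eq_integral, ← smul_assoc, smul_eq_mul]
          rw [integral_smul_const]
      _ = ∫ x, ∫ ξ, Complex.exp (Complex.I * (inner ℝ x ξ : ℝ)) • φ x • g ξ :=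
          integral_integral_swap h1
      _ = ∫ x, φ x • synth g x := by
          refine integral_congr_ae (ae_of_all _ fun x => ?_)
          simp only [synth]
          rw [← integral_smul]
          refine integral_congr_ae (ae_of_all _ fun ξ => ?_)
          simp only [smul_smul]
          rw [mul_comm]

/-- The convolution `∫ gⱼ(η) g(ξ - η) dη`, the Fourier transform of the product `fⱼ f`. -/
noncomputable def conv (g : R3 → C3) (j : Fin 3) (ξ : R3) : C3 := ∫ η, g η j • g (ξ - η)

lemma integrable_apply {α : Type*} [MeasurableSpace α] {m : Measure α} {g : α → C3}
    (hg : Integrable g m) (j : Fin 3) : Integrable (fun ξ => g ξ j) m :=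
  (EuclideanSpace.proj (𝕜 := ℂ) j : C3 →L[ℂ] ℂ).integrable_comp hg

lemma integral_apply {α : Type*} [MeasurableSpace α] {m : Measure α} {g : α → C3}
    (hg : Integrable g m) (j : Fin 3) : (∫ ξ, g ξ ∂m) j = ∫ ξ, g ξ j ∂m :=
  ((EuclideanSpace.proj (𝕜 := ℂ) j : C3 →L[ℂ] ℂ).integral_comp_comm hg).symm

lemma integrable_exp_smul {F : Type*} [NormedAddCommGroup F] [NormedSpace ℂ F] {g : R3 → F}
    (hg : Integrable g) (x : R3) :
    Integrable fun ξ => Complex.exp (Complex.I * (inner ℝ x ξ : ℝ)) • g ξ := by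
  have hc : Continuous fun ξ : R3 => Complex.exp (Complex.I * (inner ℝ x ξ : ℝ)) := by fun_prop
  exact hg.bdd_smul 1 hc.aestronglyMeasurable (ae_of_all _ fun p => (norm_exp_I_mul _).le)

lemma synth_apply {g : R3 → C3} (hg : Integrable g) (x : R3) (j : Fin 3) :
    synth g x j = synth (fun ξ => g ξ j) x := by
  rw [synth, integral_apply (integrable_exp_smul hg x)]
  rfl

lemma conv_eq_convolution (g : R3 → C3) (j : Fin 3) :
    conv g j = MeasureTheory.convolution (fun ξ => g ξ j) g (ContinuousLinearMap.lsmul ℂ ℂ)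
      volume := rfl

lemma integrable_conv {g : R3 → C3} (hg : Integrable g) (j : Fin 3) : Integrable (conv g j) := by
  rw [conv_eq_convolution]
  exact (integrable_apply hg j).integrable_convolution _ hg

lemma synth_conv {g : R3 → C3} (hg : Integrable g) (j : Fin 3) (x : R3) :
    synth (conv g j) x = synth g x j • synth g x := by
  rw [synth_apply hg, synth_eq_fourier, synth_eq_fourier, synth_eq_fourier, conv_eq_convolution,
    Real.fourier_smul_convolution_eq (integrable_apply hg j) hg]

lemma lintegral_weight_zero (g : R3 → C3) :
    ∫⁻ ξ, ENNReal.ofReal (‖ξ‖ ^ (0 : ℝ)) * ‖g ξ‖ₑ = ∫⁻ ξ, ‖g ξ‖ₑ := by simp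

lemma exists_hasFourier_of_integrable {g : R3 → C3} (hg : Integrable g) :
    ∃ f : 𝓢'(R3, C3), HasFourier f g := by
  refine exists_hasFourier (integrable_of_weighted hg.1 (.inr rfl) ?_)
  rw [lintegral_weight_zero]
  exact hg.2.ne

/-- If `f̂ = g` is integrable then `∇ · (f ⊗ f)` exists and has Fourier transform
`∑ⱼ i ξⱼ (gⱼ * g)(ξ)`. -/
lemma HasFourier.isDivTensor {f : 𝓢'(R3, C3)} {g : R3 → C3} (h : HasFourier f g)
    (hg : Integrable g) : ∃ D, IsDivTensor f D ∧
      HasFourier D (fun ξ => ∑ j, (Complex.I * (ξ j : ℂ)) • conv g j ξ) := by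
  choose T hT using fun j => exists_hasFourier_of_integrable (integrable_conv hg j)
  refine ⟨∑ j, ∂_{e j} (T j), ⟨synth g, h.represents_synth hg, T, fun j => ?_, rfl⟩,
    HasFourier.sum _ fun j _ => (hT j).lineDeriv j⟩
  have := (hT j).represents_synth (integrable_conv hg j)
  rwa [funext (synth_conv hg j)] at this

lemma Represents.congr_ae {f : 𝓢'(R3, C3)} {g g' : R3 → C3} (h : Represents f g)
    (hg : g =ᵐ[volume] g') : Represents f g' := by
  have h0 : ∀ ψ : 𝓢(R3, ℂ), (fun ξ => ψ ξ • g ξ) =ᵐ[volume] fun ξ => ψ ξ • g' ξ := by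
    intro ψ
    filter_upwards [hg] with ξ hξ
    rw [hξ]
  exact ⟨fun ψ => (h.1 ψ).congr (h0 ψ), fun φ => by rw [h.2 φ, integral_congr_ae (h0 _)]⟩

/-- Uniqueness of `∇ · (f ⊗ f)` when `f̂` is integrable. -/
lemma IsDivTensor.hasFourier {f D : 𝓢'(R3, C3)} {g : R3 → C3} (hD : IsDivTensor f D)
    (h : HasFourier f g) (hg : Integrable g) :
    HasFourier D (fun ξ => ∑ j, (Complex.I * (ξ j : ℂ)) • conv g j ξ) := by
  obtain ⟨u, hu, T, hT, rfl⟩ := hD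
  refine HasFourier.sum _ fun j _ => HasFourier.lineDeriv ?_ j
  obtain ⟨T', hT'⟩ := exists_hasFourier_of_integrable (integrable_conv hg j)
  have h1 := hT'.represents_synth (integrable_conv hg j)
  have h2 : Represents (T j) (synth (conv g j)) := by
    refine (hT j).congr_ae ?_
    filter_upwards [hu.ae_eq (h.represents_synth hg)] with x hx
    rw [hx, synth_conv hg]
  have : T j = T' := by
    ext1 φ
    rw [h1.2, h2.2]
  rwa [this]

/-- `‖∇f‖_{L^∞} ≤ ‖f‖_{𝒳¹}`. -/
lemma gradSupNorm_le {f : 𝓢'(R3, C3)} {g : R3 → C3} (h : HasFourier f g) :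
    gradSupNorm f ≤ ∫⁻ ξ, ENNReal.ofReal (‖ξ‖ ^ (1 : ℝ)) * ‖g ξ‖ₑ := by
  simp only [Real.rpow_one]
  by_cases hfin : ∫⁻ ξ, ENNReal.ofReal ‖ξ‖ * ‖g ξ‖ₑ = ∞
  · rw [hfin]; exact le_top
  have hmeas := h.aestronglyMeasurable
  have hnorm : ∀ ξ : R3, ∑ j, ‖(Complex.I * (ξ j : ℂ)) • g ξ‖ ^ 2 = (‖ξ‖ * ‖g ξ‖) ^ 2 := by
    intro ξ
    rw [mul_pow, EuclideanSpace.real_norm_sq_eq, Finset.sum_mul]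
    refine Finset.sum_congr rfl fun j _ => ?_
    rw [norm_smul, mul_pow]
    simp
  -- The gradient is synthesized from a field with values in the Hilbert space of matrices.
  set Φ : R3 → PiLp 2 (fun _ : Fin 3 => C3) :=
    fun ξ => WithLp.toLp 2 fun j => (Complex.I * (ξ j : ℂ)) • g ξ with hΦ
  have hΦn : ∀ ξ, ‖Φ ξ‖ = ‖ξ‖ * ‖g ξ‖ := by
    intro ξ
    rw [PiLp.norm_eq_of_L2, hΦ]
    simp only [hnorm]
    exact Real.sqrt_sq (by positivity)
  have hΦm : AEStronglyMeasurable Φ volume := by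
    refine (PiLp.continuous_toLp 2 (fun _ : Fin 3 => C3)).comp_aestronglyMeasurable ?_
    refine (aemeasurable_pi_lambda _ fun j => ?_).aestronglyMeasurable
    have hc : Continuous fun ξ : R3 => Complex.I * (ξ j : ℂ) := by fun_prop
    exact (hc.aestronglyMeasurable.smul hmeas).aemeasurable
  have hΦi : Integrable Φ := by
    refine ⟨hΦm, lt_top_iff_ne_top.2 ?_⟩
    convert hfin using 3 with ξ
    rw [← ofReal_norm, hΦn, ENNReal.ofReal_mul (norm_nonneg _), ofReal_norm (g ξ)]
  let P : Fin 3 → PiLp 2 (fun _ : Fin 3 => C3) →L[ℂ] C3 := fun j => PiLp.proj 2 (fun _ : Fin 3 => C3) j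
  have hsy : ∀ x j, synth Φ x j = synth (fun ξ => (Complex.I * (ξ j : ℂ)) • g ξ) x := by
    intro x j
    exact ((P j).integral_comp_comm (integrable_exp_smul hΦi x)).symm
  refine (iInf₂_le (fun j => synth (fun ξ => (Complex.I * (ξ j : ℂ)) • g ξ)) fun j =>
    (h.lineDeriv j).represents_synth ((P j).integrable_comp hΦi)).trans ?_
  refine eLpNorm_exponent_top.trans_le ?_
  refine eLpNormEssSup_le_of_ae_enorm_bound (ae_of_all _ fun x => ?_)
  have : √(∑ j, ‖synth (fun ξ => (Complex.I * (ξ j : ℂ)) • g ξ) x‖ ^ 2) = ‖synth Φ x‖ := by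
    rw [PiLp.norm_eq_of_L2]
    simp only [hsy]
  rw [this, enorm_norm]
  refine (enorm_integral_le_lintegral_enorm _).trans (le_of_eq (lintegral_congr fun ξ => ?_))
  rw [← ofReal_norm, norm_smul, norm_exp_I_mul, one_mul, hΦn, ENNReal.ofReal_mul (norm_nonneg _),
    ofReal_norm (g ξ)]

/-! ### Real and divergence-free fields on the Fourier side -/

lemma HasFourier.apply_apply {f : 𝓢'(R3, C3)} {g : R3 → C3} (h : HasFourier f g) (φ : 𝓢(R3, ℂ))
    (k : Fin 3) : f φ k = ∫ ξ, ft φ ξ * g ξ k := by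
  rw [hasFourier_apply h, integral_apply (h.integrable_smul _)]
  rfl

lemma ft_neg {φ : 𝓢(R3, ℂ)} (hφ : ∀ x, (φ x).im = 0) (ξ : R3) :
    ft φ (-ξ) = conj (ft φ ξ) := by
  rw [ft_eq_integral, ft_eq_integral, ← integral_conj]
  refine integral_congr_ae (ae_of_all _ fun x => ?_)
  simp only [map_mul, ← Complex.exp_conj, Complex.conj_I, Complex.conj_ofReal, inner_neg_right,
    Complex.conj_eq_iff_im.2 (hφ x)]
  congr 2
  push_cast
  ring

lemma isReal_of_symm {f : 𝓢'(R3, C3)} {g : R3 → C3} (h : HasFourier f g)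
    (hg : ∀ᵐ ξ, ∀ k, g (-ξ) k = conj (g ξ k)) : IsReal f := by
  intro φ hφ k
  rw [← Complex.conj_eq_iff_im, h.apply_apply, ← integral_conj,
    ← integral_neg_eq_self fun ξ => ft φ ξ * g ξ k]
  refine integral_congr_ae ?_
  filter_upwards [hg] with ξ hξ
  simp only [map_mul, ft_neg hφ, hξ]

lemma exists_re_im (φ : 𝓢(R3, ℂ)) : ∃ φ₁ φ₂ : 𝓢(R3, ℂ), (∀ x, (φ₁ x).im = 0) ∧
    (∀ x, (φ₂ x).im = 0) ∧ φ = φ₁ + Complex.I • φ₂ := by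
  refine ⟨SchwartzMap.postcompCLM (𝕜 := ℝ) (Complex.ofRealCLM ∘L Complex.reCLM) φ,
    SchwartzMap.postcompCLM (𝕜 := ℝ) (Complex.ofRealCLM ∘L Complex.imCLM) φ, fun x => ?_,
    fun x => ?_, ?_⟩
  · simp
  · simp
  · ext x
    simp [mul_comm Complex.I, Complex.re_add_im]

/-- By hypothesis the two sides agree when tested against the transforms of real test functions;
the general test function is split into its real and imaginary parts. -/
lemma IsReal.symm_ae {f : 𝓢'(R3, C3)} {g : R3 → C3} (hf : IsReal f) (h : HasFourier f g)
    (k : Fin 3) : ∀ᵐ ξ, g (-ξ) k = conj (g ξ k) := by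
  have hint : ∀ ψ : 𝓢(R3, ℂ), Integrable (fun ξ => ψ ξ • g ξ k) := fun ψ =>
    integrable_apply (h.integrable_smul ψ) k
  have hint' : ∀ ψ : 𝓢(R3, ℂ), Integrable (fun ξ => ψ ξ • conj (g (-ξ) k)) := by
    intro ψ
    obtain ⟨φ, rfl⟩ := ft_surjective ψ
    obtain ⟨φ₁, φ₂, h1, h2, rfl⟩ := exists_re_im φ
    have : ∀ φ : 𝓢(R3, ℂ), (∀ x, (φ x).im = 0) →
        Integrable (fun ξ => ft φ ξ • conj (g (-ξ) k)) := by
      intro φ hφ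
      refine (Complex.conjCLE.toContinuousLinearMap.integrable_comp
        (hint (ft φ)).comp_neg).congr (ae_of_all _ fun ξ => ?_)
      simp [ft_neg hφ]
    refine ((this φ₁ h1).add ((this φ₂ h2).smul Complex.I)).congr (ae_of_all _ fun ξ => ?_)
    simp [add_mul, mul_assoc]
  have hreal : ∀ φ : 𝓢(R3, ℂ), (∀ x, (φ x).im = 0) →
      ∫ ξ, ft φ ξ • g ξ k = ∫ ξ, ft φ ξ • conj (g (-ξ) k) := by
    intro φ hφ
    have h1 := Complex.conj_eq_iff_im.2 (hf φ hφ k)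
    rw [h.apply_apply, ← integral_conj] at h1
    simp only [smul_eq_mul]
    rw [← h1, ← integral_neg_eq_self]
    refine integral_congr_ae (ae_of_all _ fun ξ => ?_)
    simp [ft_neg hφ]
  have : (fun ξ => g ξ k) =ᵐ[volume] fun ξ => conj (g (-ξ) k) := by
    refine ae_eq_of_forall_schwartz hint hint' fun ψ => ?_
    obtain ⟨φ, rfl⟩ := ft_surjective ψ
    obtain ⟨φ₁, φ₂, h1, h2, rfl⟩ := exists_re_im φ
    have hsplit : ∀ q : R3 → ℂ, (∀ ψ : 𝓢(R3, ℂ), Integrable (fun ξ => ψ ξ • q ξ)) →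
        ∫ ξ, ft (φ₁ + Complex.I • φ₂) ξ • q ξ =
          (∫ ξ, ft φ₁ ξ • q ξ) + Complex.I • ∫ ξ, ft φ₂ ξ • q ξ := by
      intro q hq
      rw [← integral_smul]
      refine (integral_congr_ae (ae_of_all _ fun ξ => ?_)).trans
        (integral_add (hq (ft φ₁)) ((hq (ft φ₂)).smul Complex.I))
      simp [add_mul, mul_assoc]
    rw [hsplit _ hint, hsplit _ hint', hreal φ₁ h1, hreal φ₂ h2]
  filter_upwards [this] with ξ hξ
  rw [hξ, Complex.conj_conj]

lemma HasFourier.sum_lineDeriv_apply {f : 𝓢'(R3, C3)} {g : R3 → C3} (h : HasFourier f g)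
    (φ : 𝓢(R3, ℂ)) : ∑ j, (∂_{e j} f) φ j =
      ∫ ξ, ft φ ξ • (Complex.I * ∑ j, (ξ j : ℂ) * g ξ j) := by
  have hi := fun j => integrable_apply ((h.lineDeriv j).integrable_smul (ft φ)) j
  have : ∀ j, (∂_{e j} f) φ j = ∫ ξ, (ft φ ξ • (Complex.I * (ξ j : ℂ)) • g ξ) j := fun j =>
    (h.lineDeriv j).apply_apply φ j
  simp only [this]
  rw [← integral_finsetSum _ fun j _ => hi j]
  refine integral_congr_ae (ae_of_all _ fun ξ => ?_)
  simp only [PiLp.smul_apply, smul_eq_mul, Finset.mul_sum, mul_assoc]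

lemma isDivFree_of {f : 𝓢'(R3, C3)} {g : R3 → C3} (h : HasFourier f g)
    (hg : ∀ᵐ ξ, ∑ j, (ξ j : ℂ) * g ξ j = 0) : IsDivFree f := by
  intro φ
  rw [h.sum_lineDeriv_apply]
  refine integral_eq_zero_of_ae ?_
  filter_upwards [hg] with ξ hξ
  simp [hξ]

lemma IsDivFree.ae {f : 𝓢'(R3, C3)} {g : R3 → C3} (hf : IsDivFree f) (h : HasFourier f g) :
    ∀ᵐ ξ, ∑ j, (ξ j : ℂ) * g ξ j = 0 := by
  have : (fun ξ : R3 => Complex.I * ∑ j, (ξ j : ℂ) * g ξ j) =ᵐ[volume] fun _ => 0 := by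
    refine ae_eq_of_forall_schwartz (fun ψ => ?_) (fun ψ => by simp) fun ψ => ?_
    · have hi := integrable_finsetSum Finset.univ fun j _ =>
        integrable_apply ((h.lineDeriv j).integrable_smul ψ) j
      refine hi.congr (ae_of_all _ fun ξ => ?_)
      simp only [PiLp.smul_apply, smul_eq_mul, Finset.mul_sum, mul_assoc]
    · obtain ⟨φ, rfl⟩ := ft_surjective ψ
      rw [← h.sum_lineDeriv_apply, hf φ]
      simp
  filter_upwards [this] with ξ hξ
  simpa using hξ

/-! ### The nonlinearity on the Fourier side -/

/-- The Leray symbol as a linear map. -/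
noncomputable def lerayCLM (ξ : R3) : C3 →L[ℂ] C3 :=
  LinearMap.toContinuousLinearMap
    { toFun := leraySymbol ξ
      map_add' := fun w w' => by
        ext k
        simp only [leraySymbol, PiLp.add_apply, mul_add, Finset.sum_add_distrib, add_div]
        ring
      map_smul' := fun c w => by
        ext k
        simp only [leraySymbol, PiLp.smul_apply, smul_eq_mul, RingHom.id_apply, mul_left_comm _ c,
          ← Finset.mul_sum]
        ring }

@[simp] lemma lerayCLM_apply (ξ : R3) (w : C3) : lerayCLM ξ w = leraySymbol ξ w := rfl

/-- The Leray symbol is an orthogonal projection, hence a contraction. -/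
lemma norm_leraySymbol_le (ξ : R3) (w : C3) : ‖leraySymbol ξ w‖ ≤ ‖w‖ := by
  by_cases hξ : ξ = 0
  · have : leraySymbol ξ w = w := by ext k; simp [leraySymbol, hξ]
    rw [this]
  have hpos : 0 < ‖ξ‖ ^ 2 := by have := norm_pos_iff.2 hξ; positivity
  set z : C3 := WithLp.toLp 2 fun k => (ξ k : ℂ) with hz
  have hzz : inner ℂ z z = ((‖ξ‖ ^ 2 : ℝ) : ℂ) := by
    rw [PiLp.inner_apply, EuclideanSpace.real_norm_sq_eq]
    simp only [hz, RCLike.inner_apply, Complex.conj_ofReal, sq, Complex.ofReal_sum,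
      Complex.ofReal_mul]
  have hzw : inner ℂ z w = ∑ j, (ξ j : ℂ) * w j := by
    rw [PiLp.inner_apply]
    simp [hz, mul_comm]
  set c : ℂ := inner ℂ z w / ((‖ξ‖ ^ 2 : ℝ) : ℂ) with hc
  have hl : leraySymbol ξ w = w - c • z := by
    ext k
    simp only [leraySymbol, PiLp.sub_apply, PiLp.smul_apply, hc, hzw, smul_eq_mul]
    simp only [hz]
    ring
  have hne : ((‖ξ‖ ^ 2 : ℝ) : ℂ) ≠ 0 := by exact_mod_cast hpos.ne'
  have horth : inner ℂ (w - c • z) (c • z) = 0 := by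
    rw [← inner_conj_symm, inner_sub_right, inner_smul_left, inner_smul_left, inner_smul_right, hzz,
      hc, div_mul_cancel₀ _ hne]
    simp
  have := norm_add_sq_eq_norm_sq_add_norm_sq_of_inner_eq_zero (w - c • z) (c • z) horth
  rw [sub_add_cancel] at this
  rw [hl]
  nlinarith [norm_nonneg w, norm_nonneg (w - c • z), mul_self_nonneg ‖c • z‖]

/-- The symbol `ℙ(ξ) (i ξ·a) b` of the bilinear operator `ℙ ∇ · (f ⊗ g)`. -/
noncomputable def bilin (ξ : R3) (a b : C3) : C3 :=
  leraySymbol ξ ((Complex.I * ∑ j, (ξ j : ℂ) * a j) • b)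

lemma norm_bilin_le (ξ : R3) (a b : C3) : ‖bilin ξ a b‖ ≤ ‖ξ‖ * (‖a‖ * ‖b‖) := by
  refine (norm_leraySymbol_le _ _).trans ?_
  rw [norm_smul, norm_mul, Complex.norm_I, one_mul, ← mul_assoc]
  gcongr
  set z : C3 := WithLp.toLp 2 fun k => (ξ k : ℂ) with hz
  have h1 : ‖z‖ = ‖ξ‖ := by
    rw [EuclideanSpace.norm_eq, EuclideanSpace.norm_eq]
    simp [hz]
  have h2 : inner ℂ z a = ∑ j, (ξ j : ℂ) * a j := by
    rw [PiLp.inner_apply]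
    simp [hz, mul_comm]
  rw [← h1, ← h2]
  exact norm_inner_le_norm z a

lemma enorm_bilin_le (ξ : R3) (a b : C3) : ‖bilin ξ a b‖ₑ ≤ ‖ξ‖ₑ * (‖a‖ₑ * ‖b‖ₑ) := by
  rw [← ofReal_norm, ← ofReal_norm, ← ofReal_norm, ← ofReal_norm,
    ← ENNReal.ofReal_mul (norm_nonneg _), ← ENNReal.ofReal_mul (norm_nonneg _)]
  exact ENNReal.ofReal_le_ofReal (norm_bilin_le ξ a b)

lemma bilin_sub (ξ : R3) (a a' b b' : C3) :
    bilin ξ a' b' - bilin ξ a b = bilin ξ (a' - a) b' + bilin ξ a (b' - b) := by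
  simp only [bilin, ← lerayCLM_apply, ← map_sub, ← map_add]
  congr 1
  simp only [PiLp.sub_apply, mul_sub, Finset.sum_sub_distrib, sub_smul, smul_sub]
  abel

lemma continuous_bilin (ξ : R3) : Continuous fun p : C3 × C3 => bilin ξ p.1 p.2 := by
  simp only [bilin, ← lerayCLM_apply]
  fun_prop

lemma measurable_bilin : Measurable fun p : R3 × C3 × C3 => bilin p.1 p.2.1 p.2.2 := by
  unfold bilin leraySymbol
  refine (PiLp.continuous_toLp 2 (fun _ : Fin 3 => ℂ)).measurable.comp ?_
  refine measurable_pi_lambda _ fun k => ?_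
  simp only [PiLp.smul_apply]
  fun_prop

/-- The Fourier transform `ℙ(ξ) ∑ⱼ i ξⱼ (gⱼ * g)(ξ)` of `ℙ ∇ · (f ⊗ f)`, where `g = f̂`;
it is `0` at frequencies at which the integral diverges. -/
noncomputable def nonlin (g : R3 → C3) (ξ : R3) : C3 := ∫ η, bilin ξ (g η) (g (ξ - η))

/-- A majorant of `nonlin g` when `|g| ≤ G`. -/
noncomputable def nonlinMaj (G : R3 → ℝ≥0∞) (ξ : R3) : ℝ≥0∞ := ∫⁻ η, ‖ξ‖ₑ * (G η * G (ξ - η))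

/-- The projected divergence of the convolutions is `nonlin`, wherever these converge. -/
lemma leraySymbol_sum_conv {g : R3 → C3} {ξ : R3}
    (h : ∀ j : Fin 3, Integrable fun η => g η j • g (ξ - η)) :
    leraySymbol ξ (∑ j, (Complex.I * (ξ j : ℂ)) • conv g j ξ) = nonlin g ξ := by
  have hi : ∀ j, Integrable fun η => (Complex.I * (ξ j : ℂ)) • (g η j • g (ξ - η)) :=
    fun j => (h j).smul (Complex.I * (ξ j : ℂ))
  have h1 : ∑ j, (Complex.I * (ξ j : ℂ)) • conv g j ξ =
      ∫ η, ∑ j, (Complex.I * (ξ j : ℂ)) • (g η j • g (ξ - η)) := by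
    rw [integral_finsetSum _ fun j _ => hi j]
    simp only [integral_smul, conv]
  rw [h1, ← lerayCLM_apply, ← ContinuousLinearMap.integral_comp_comm _
    (integrable_finsetSum _ fun j _ => hi j)]
  refine integral_congr_ae (ae_of_all _ fun η => ?_)
  simp only [bilin, lerayCLM_apply, smul_smul, ← Finset.sum_smul, Finset.mul_sum, mul_assoc]

/-- If the majorant `A` controls `F`, and `A' - A` controls `F' - F`, then the same holds for the
integrals; the condition is written without subtraction to allow infinite values. -/
lemma enorm_integral_sub_add_le {α E : Type*} [MeasurableSpace α] [NormedAddCommGroup E]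
    [NormedSpace ℝ E] {m : Measure α} {F F' : α → E} {A A' : α → ℝ≥0∞}
    (hF : AEStronglyMeasurable F m) (hF' : AEStronglyMeasurable F' m) (hA : AEMeasurable A m)
    (h1 : ∀ x, ‖F x‖ₑ ≤ A x) (h2 : ∀ x, ‖F' x - F x‖ₑ + A x ≤ A' x) :
    ‖(∫ x, F' x ∂m) - ∫ x, F x ∂m‖ₑ + ∫⁻ x, A x ∂m ≤ ∫⁻ x, A' x ∂m := by
  by_cases hfin : ∫⁻ x, A' x ∂m = ∞
  · rw [hfin]; exact le_top
  have hFi : Integrable F m := by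
    refine ⟨hF, lt_of_le_of_lt (lintegral_mono fun x => ?_) (lt_top_iff_ne_top.2 hfin)⟩
    exact (h1 x).trans (le_add_self.trans (h2 x))
  have hFi' : Integrable F' m := by
    refine ⟨hF', lt_of_le_of_lt (lintegral_mono fun x => ?_) (lt_top_iff_ne_top.2 hfin)⟩
    calc ‖F' x‖ₑ = ‖(F' x - F x) + F x‖ₑ := by rw [sub_add_cancel]
      _ ≤ ‖F' x - F x‖ₑ + ‖F x‖ₑ := enorm_add_le _ _
      _ ≤ A' x := (add_le_add_right (h1 x) _).trans (h2 x)
  rw [← integral_sub hFi' hFi]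
  calc _ ≤ ∫⁻ x, ‖F' x - F x‖ₑ ∂m + ∫⁻ x, A x ∂m := by
        gcongr; exact enorm_integral_le_lintegral_enorm _
    _ = ∫⁻ x, (‖F' x - F x‖ₑ + A x) ∂m := (lintegral_add_right' _ hA).symm
    _ ≤ _ := lintegral_mono h2

section nonlin

variable {g g' : R3 → C3} {G G' : R3 → ℝ≥0∞}

lemma measurable_bilin_slice (hg : Measurable g) (hg' : Measurable g') (ξ : R3) :
    Measurable fun η => bilin ξ (g η) (g' (ξ - η)) := by
  have h1 : Measurable fun η => (ξ, g η, g' (ξ - η)) :=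
    measurable_const.prodMk (hg.prodMk (hg'.comp (measurable_const.sub measurable_id)))
  simpa only [Function.comp_def] using measurable_bilin.comp h1

lemma enorm_nonlin_le (h : ∀ η, ‖g η‖ₑ ≤ G η) (ξ : R3) : ‖nonlin g ξ‖ₑ ≤ nonlinMaj G ξ := by
  refine (enorm_integral_le_lintegral_enorm _).trans (lintegral_mono fun η => ?_)
  refine (enorm_bilin_le _ _ _).trans ?_
  gcongr <;> exact h _

lemma enorm_nonlin_sub_add_le (hg : Measurable g) (hg' : Measurable g') (hG : Measurable G)
    (h1 : ∀ η, ‖g η‖ₑ ≤ G η) (h2 : ∀ η, ‖g' η - g η‖ₑ + G η ≤ G' η) (ξ : R3) :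
    ‖nonlin g' ξ - nonlin g ξ‖ₑ + nonlinMaj G ξ ≤ nonlinMaj G' ξ := by
  refine enorm_integral_sub_add_le (measurable_bilin_slice hg hg ξ).aestronglyMeasurable
    (measurable_bilin_slice hg' hg' ξ).aestronglyMeasurable (by fun_prop) (fun η => ?_) fun η => ?_
  · refine (enorm_bilin_le _ _ _).trans ?_
    gcongr <;> exact h1 _
  · have h3 : ‖g' (ξ - η)‖ₑ ≤ G' (ξ - η) := by
      calc ‖g' (ξ - η)‖ₑ = ‖(g' (ξ - η) - g (ξ - η)) + g (ξ - η)‖ₑ := by rw [sub_add_cancel]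
        _ ≤ ‖g' (ξ - η) - g (ξ - η)‖ₑ + ‖g (ξ - η)‖ₑ := enorm_add_le _ _
        _ ≤ G' (ξ - η) := (add_le_add_right (h1 _) _).trans (h2 _)
    rw [bilin_sub]
    calc _ ≤ (‖ξ‖ₑ * (‖g' η - g η‖ₑ * G' (ξ - η)) +
            ‖ξ‖ₑ * (G η * ‖g' (ξ - η) - g (ξ - η)‖ₑ)) + ‖ξ‖ₑ * (G η * G (ξ - η)) := by
          gcongr
          refine (enorm_add_le _ _).trans (add_le_add ((enorm_bilin_le _ _ _).trans ?_)
            ((enorm_bilin_le _ _ _).trans ?_))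
          · gcongr
          · gcongr; exact h1 _
      _ = ‖ξ‖ₑ * (‖g' η - g η‖ₑ * G' (ξ - η) +
            G η * (‖g' (ξ - η) - g (ξ - η)‖ₑ + G (ξ - η))) := by ring
      _ ≤ ‖ξ‖ₑ * (‖g' η - g η‖ₑ * G' (ξ - η) + G η * G' (ξ - η)) := by gcongr; exact h2 _
      _ = ‖ξ‖ₑ * ((‖g' η - g η‖ₑ + G η) * G' (ξ - η)) := by ring
      _ ≤ ‖ξ‖ₑ * (G' η * G' (ξ - η)) := by gcongr; exact h2 _

end nonlin

/-! ### Weighted norms -/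

/-- The weighted norm `∫ |ξ|ˢ G(ξ) dξ`. -/
noncomputable def wnorm (s : ℝ) (G : R3 → ℝ≥0∞) : ℝ≥0∞ := ∫⁻ ξ, ENNReal.ofReal (‖ξ‖ ^ s) * G ξ

lemma wnorm_mono (s : ℝ) {G G' : R3 → ℝ≥0∞} (h : ∀ ξ, G ξ ≤ G' ξ) : wnorm s G ≤ wnorm s G' :=
  lintegral_mono fun ξ => by gcongr; exact h ξ

@[fun_prop]
lemma measurable_weight (s : ℝ) : Measurable fun ξ : R3 => ENNReal.ofReal (‖ξ‖ ^ s) := by fun_prop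

lemma ae_ne_zero : ∀ᵐ ξ : R3, ξ ≠ 0 := by simp [ae_iff, measure_singleton]

/-- The weight `|ξ|⁻¹` cancels the factor `|ξ|` of the derivative, and Tonelli's theorem gives
`∫ A * B = ∫ A ∫ B`. -/
lemma wnorm_neg_one_conv_le {A B : R3 → ℝ≥0∞} (hA : Measurable A) (hB : Measurable B) :
    wnorm (-1) (fun ξ => ∫⁻ η, ‖ξ‖ₑ * (A η * B (ξ - η))) ≤ (∫⁻ ξ, A ξ) * ∫⁻ ξ, B ξ := by
  have h1 : ∀ ξ : R3, ENNReal.ofReal (‖ξ‖ ^ (-1 : ℝ)) * ∫⁻ η, ‖ξ‖ₑ * (A η * B (ξ - η)) ≤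
      ∫⁻ η, A η * B (ξ - η) := by
    intro ξ
    rw [lintegral_const_mul' _ _ (by simp), ← mul_assoc]
    refine mul_le_of_le_one_left' ?_
    rw [← ofReal_norm, ← ENNReal.ofReal_mul (by positivity), Real.rpow_neg_one]
    exact ENNReal.ofReal_le_one.2 inv_mul_le_one
  calc _ ≤ ∫⁻ ξ, ∫⁻ η, A η * B (ξ - η) := lintegral_mono h1
    _ = ∫⁻ η, ∫⁻ ξ, A η * B (ξ - η) :=
        lintegral_lintegral_swap (by fun_prop)
    _ = ∫⁻ η, A η * ∫⁻ ξ, B ξ := by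
        refine lintegral_congr fun η => ?_
        rw [lintegral_const_mul _ (by fun_prop), lintegral_sub_right_eq_self]
    _ = _ := lintegral_mul_const _ hA

/-- The interpolation inequality `2 ‖a‖_{𝒳⁰} ‖b‖_{𝒳⁰} ≤ ‖a‖_{𝒳⁻¹} ‖b‖_{𝒳¹} + ‖a‖_{𝒳¹} ‖b‖_{𝒳⁻¹}`:
integrate `2 ≤ |η|/|ξ| + |ξ|/|η|`. -/
lemma two_mul_lintegral_mul_le {A B : R3 → ℝ≥0∞} (hA : Measurable A) (hB : Measurable B) :
    2 * ((∫⁻ ξ, A ξ) * ∫⁻ η, B η) ≤ wnorm (-1) A * wnorm 1 B + wnorm 1 A * wnorm (-1) B := by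
  have hpt : ∀ ξ η : R3, ξ ≠ 0 → η ≠ 0 → 2 * (A ξ * B η) ≤
      (ENNReal.ofReal (‖ξ‖ ^ (-1 : ℝ)) * A ξ) * (ENNReal.ofReal (‖η‖ ^ (1 : ℝ)) * B η) +
      (ENNReal.ofReal (‖ξ‖ ^ (1 : ℝ)) * A ξ) * (ENNReal.ofReal (‖η‖ ^ (-1 : ℝ)) * B η) := by
    intro ξ η hξ hη
    have h1 : 0 < ‖ξ‖ := norm_pos_iff.2 hξ
    have h2 : 0 < ‖η‖ := norm_pos_iff.2 hη
    have h3 : (2 : ℝ≥0∞) ≤ ENNReal.ofReal (‖ξ‖⁻¹ * ‖η‖ + ‖ξ‖ * ‖η‖⁻¹) := by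
      refine (ENNReal.ofReal_ofNat 2).ge.trans (ENNReal.ofReal_le_ofReal ?_)
      rw [← sub_nonneg]
      have : ‖ξ‖⁻¹ * ‖η‖ + ‖ξ‖ * ‖η‖⁻¹ - 2 = (‖ξ‖ - ‖η‖) ^ 2 / (‖ξ‖ * ‖η‖) := by
        field_simp
        ring
      rw [this]
      positivity
    calc 2 * (A ξ * B η) ≤ ENNReal.ofReal (‖ξ‖⁻¹ * ‖η‖ + ‖ξ‖ * ‖η‖⁻¹) * (A ξ * B η) := by gcongr
      _ = _ := by
        rw [ENNReal.ofReal_add (by positivity) (by positivity), ENNReal.ofReal_mul (by positivity),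
          ENNReal.ofReal_mul (by positivity), Real.rpow_one, Real.rpow_one, Real.rpow_neg_one,
          Real.rpow_neg_one]
        ring
  have hprod : ∀ A B : R3 → ℝ≥0∞, Measurable A → Measurable B →
      (∫⁻ ξ, A ξ) * ∫⁻ η, B η = ∫⁻ ξ, ∫⁻ η, A ξ * B η := by
    intro A B hA hB
    rw [← lintegral_mul_const _ hA]
    exact lintegral_congr fun ξ => (lintegral_const_mul _ hB).symm
  rw [wnorm, wnorm, wnorm, wnorm, hprod A B hA hB, hprod _ _ (by fun_prop) (by fun_prop),
    hprod _ _ (by fun_prop) (by fun_prop), ← lintegral_add_left (by fun_prop),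
    ← lintegral_const_mul _ (by fun_prop)]
  refine lintegral_mono_ae ?_
  filter_upwards [ae_ne_zero] with ξ hξ
  rw [← lintegral_add_left (by fun_prop), ← lintegral_const_mul _ (by fun_prop)]
  refine lintegral_mono_ae ?_
  filter_upwards [ae_ne_zero] with η hη using hpt ξ η hξ hη

/-- `‖ℙ ∇ · (f ⊗ f)‖_{𝒳⁻¹} ≤ ‖f‖_{𝒳⁻¹} ‖f‖_{𝒳¹}`. -/
lemma wnorm_nonlinMaj_le {G : R3 → ℝ≥0∞} (hG : Measurable G) :
    wnorm (-1) (nonlinMaj G) ≤ wnorm (-1) G * wnorm 1 G := by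
  refine (wnorm_neg_one_conv_le hG hG).trans ?_
  have := two_mul_lintegral_mul_le hG hG
  rw [mul_comm (wnorm 1 G), ← two_mul] at this
  exact (ENNReal.mul_le_mul_iff_right (by simp) (by simp)).1 this

/-! ### Duhamel's formula and the energy inequality -/

/-- The symbol `exp(-μt|ξ|²)` of the heat semigroup. -/
noncomputable def heatSym (μ t : ℝ) (ξ : R3) : ℝ := Real.exp (-(μ * t) * ‖ξ‖ ^ 2)

lemma heatSym_pos (μ t : ℝ) (ξ : R3) : 0 < heatSym μ t ξ := Real.exp_pos _

lemma heatSym_le_one {μ t : ℝ} (hμ : 0 ≤ μ) (ht : 0 ≤ t) (ξ : R3) : heatSym μ t ξ ≤ 1 := by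
  rw [heatSym, Real.exp_le_one_iff]
  have : 0 ≤ μ * t * ‖ξ‖ ^ 2 := by positivity
  linarith

lemma enorm_heatSym (μ t : ℝ) (ξ : R3) :
    ‖(heatSym μ t ξ : ℂ)‖ₑ = ENNReal.ofReal (heatSym μ t ξ) := by
  rw [← ofReal_norm, Complex.norm_real, Real.norm_of_nonneg (heatSym_pos μ t ξ).le]

@[fun_prop]
lemma measurable_heatSym {α : Type*} [MeasurableSpace α] (μ : ℝ) {a : α → ℝ} {b : α → R3}
    (ha : Measurable a) (hb : Measurable b) : Measurable fun x => heatSym μ (a x) (b x) := by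
  unfold heatSym; fun_prop

/-- Duhamel's formula `exp(μtΔ) f - ∫₀ᵗ exp(μ(t-s)Δ) N(s) ds` on the Fourier side. -/
noncomputable def duhamel (μ : ℝ) (g : R3 → C3) (n : ℝ → R3 → C3) (t : ℝ) (ξ : R3) : C3 :=
  (heatSym μ t ξ : ℂ) • g ξ - ∫ s in Ioc 0 t, (heatSym μ (t - s) ξ : ℂ) • n s ξ

/-- A majorant of `duhamel μ g n` when `|g| ≤ G` and `|n| ≤ F`. -/
noncomputable def duhamelMaj (μ : ℝ) (G : R3 → ℝ≥0∞) (F : ℝ → R3 → ℝ≥0∞) (t : ℝ) (ξ : R3) :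
    ℝ≥0∞ :=
  ENNReal.ofReal (heatSym μ t ξ) * G ξ +
    ∫⁻ s in Ioc 0 t, ENNReal.ofReal (heatSym μ (t - s) ξ) * F s ξ

lemma exp_add_mul_lintegral_exp {k : ℝ} (hk : 0 ≤ k) {s t : ℝ} (hst : s ≤ t) :
    ENNReal.ofReal (Real.exp (-k * (t - s))) +
      ENNReal.ofReal k * ∫⁻ τ in Ioc s t, ENNReal.ofReal (Real.exp (-k * (τ - s))) = 1 := by
  have h1 : ∫ τ in s..t, k * Real.exp (-k * (τ - s)) = 1 - Real.exp (-k * (t - s)) := by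
    rw [intervalIntegral.integral_eq_sub_of_hasDerivAt (f := fun τ => -Real.exp (-k * (τ - s)))]
    · simp; ring
    · intro τ _
      have : HasDerivAt (fun τ => -k * (τ - s)) (-k) τ := by
        simpa using ((hasDerivAt_id τ).sub_const s).const_mul (-k)
      exact this.exp.neg.congr_deriv (by ring)
    · exact Continuous.intervalIntegrable (by fun_prop) _ _
  rw [← lintegral_const_mul' _ _ ENNReal.ofReal_ne_top]
  simp only [← ENNReal.ofReal_mul hk]
  rw [← ofReal_integral_eq_lintegral_ofReal, ← intervalIntegral.integral_of_le hst, h1,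
    ← ENNReal.ofReal_add (Real.exp_pos _).le]
  · simp
  · rw [sub_nonneg, Real.exp_le_one_iff]
    nlinarith
  · exact (Continuous.integrableOn_Icc (by fun_prop)).mono_set Ioc_subset_Icc_self
  · exact ae_of_all _ fun τ => by positivity

/-- The solution of `Y' + k Y = f`, integrated in time. -/
lemma scalar_energy {k : ℝ} (hk : 0 ≤ k) (y : ℝ≥0∞) {f : ℝ → ℝ≥0∞} (hf : Measurable f) {t : ℝ}
    (ht : 0 ≤ t) :
    (ENNReal.ofReal (Real.exp (-k * t)) * y +
        ∫⁻ s in Ioc 0 t, ENNReal.ofReal (Real.exp (-k * (t - s))) * f s) +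
      ENNReal.ofReal k * ∫⁻ τ in Ioc 0 t, (ENNReal.ofReal (Real.exp (-k * τ)) * y +
        ∫⁻ s in Ioc 0 τ, ENNReal.ofReal (Real.exp (-k * (τ - s))) * f s) =
      y + ∫⁻ s in Ioc 0 t, f s := by
  have hswap : ∫⁻ τ in Ioc 0 t, ∫⁻ s in Ioc 0 τ, ENNReal.ofReal (Real.exp (-k * (τ - s))) * f s =
      ∫⁻ s in Ioc 0 t, (∫⁻ τ in Ioc s t, ENNReal.ofReal (Real.exp (-k * (τ - s)))) * f s := by
    have h1 : ∀ τ ∈ Ioc 0 t, ∫⁻ s in Ioc 0 τ, ENNReal.ofReal (Real.exp (-k * (τ - s))) * f s =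
        ∫⁻ s in Ioc 0 t, {p : ℝ × ℝ | p.2 ≤ p.1}.indicator
          (fun p => ENNReal.ofReal (Real.exp (-k * (p.1 - p.2))) * f p.2) (τ, s) := by
      intro τ hτ
      have h2 : ∀ s, {p : ℝ × ℝ | p.2 ≤ p.1}.indicator
          (fun p => ENNReal.ofReal (Real.exp (-k * (p.1 - p.2))) * f p.2) (τ, s) =
          (Iic τ).indicator (fun s => ENNReal.ofReal (Real.exp (-k * (τ - s))) * f s) s := by
        intro s
        simp [indicator_apply]
      simp only [h2]
      rw [setLIntegral_indicator measurableSet_Iic]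
      congr 2
      ext s
      simp only [mem_Ioc, mem_inter_iff, mem_Iic] at hτ ⊢
      constructor
      · rintro ⟨a, b⟩; exact ⟨b, a, b.trans hτ.2⟩
      · rintro ⟨a, b, -⟩; exact ⟨b, a⟩
    rw [setLIntegral_congr_fun measurableSet_Ioc h1, lintegral_lintegral_swap]
    · refine setLIntegral_congr_fun measurableSet_Ioc fun s hs => ?_
      have h2 : ∀ τ, {p : ℝ × ℝ | p.2 ≤ p.1}.indicator
          (fun p => ENNReal.ofReal (Real.exp (-k * (p.1 - p.2))) * f p.2) (τ, s) =
          (Ici s).indicator (fun τ => ENNReal.ofReal (Real.exp (-k * (τ - s))) * f s) τ := by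
        intro τ
        simp [indicator_apply]
      simp only [h2]
      rw [setLIntegral_indicator measurableSet_Ici, lintegral_mul_const _ (by fun_prop)]
      have : Ici s ∩ Ioc 0 t = Icc s t := by
        ext τ
        simp only [mem_Ioc, mem_inter_iff, mem_Ici, mem_Icc] at hs ⊢
        constructor
        · rintro ⟨a, b, c⟩; exact ⟨a, c⟩
        · rintro ⟨a, b⟩; exact ⟨a, hs.1.trans_le a, b⟩
      rw [this, setLIntegral_congr Ioc_ae_eq_Icc]
    · refine (Measurable.indicator (by fun_prop) ?_).aemeasurable
      exact measurableSet_le measurable_snd measurable_fst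
  have hmeas : Measurable fun s : ℝ => ∫⁻ τ in Ioc s t, ENNReal.ofReal (Real.exp (-k * (τ - s))) := by
    have h2 : ∀ s, ∫⁻ τ in Ioc s t, ENNReal.ofReal (Real.exp (-k * (τ - s))) =
        ∫⁻ τ, {p : ℝ × ℝ | p.1 < p.2 ∧ p.2 ≤ t}.indicator
          (fun p => ENNReal.ofReal (Real.exp (-k * (p.2 - p.1)))) (s, τ) := by
      intro s
      rw [← lintegral_indicator measurableSet_Ioc]
      rfl
    simp only [h2]
    refine Measurable.lintegral_prod_right' (Measurable.indicator (by fun_prop) ?_)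
    exact (measurableSet_lt measurable_fst measurable_snd).inter
      (measurableSet_le measurable_snd measurable_const)
  rw [lintegral_add_left (by fun_prop), hswap, lintegral_mul_const _ (by fun_prop), mul_add]
  have h0 := exp_add_mul_lintegral_exp hk ht
  simp only [sub_zero] at h0
  have h3 : ∫⁻ s in Ioc 0 t, f s = ∫⁻ s in Ioc 0 t,
      (ENNReal.ofReal (Real.exp (-k * (t - s))) * f s +
        ENNReal.ofReal k * ((∫⁻ τ in Ioc s t, ENNReal.ofReal (Real.exp (-k * (τ - s)))) * f s)) := by
    refine setLIntegral_congr_fun measurableSet_Ioc fun s hs => ?_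
    rw [← mul_assoc, ← add_mul, exp_add_mul_lintegral_exp hk hs.2, one_mul]
  rw [h3, lintegral_add_left (by fun_prop),
    lintegral_const_mul' (ENNReal.ofReal k) _ ENNReal.ofReal_ne_top]
  conv_rhs => rw [← one_mul y, ← h0]
  ring

section measurability

variable {α : Type*} [MeasurableSpace α] {μ : ℝ}

lemma measurable_duhamelMaj (μ : ℝ) {G : R3 → ℝ≥0∞} {F : ℝ → R3 → ℝ≥0∞} (hG : Measurable G)
    (hF : Measurable (Function.uncurry F)) :
    Measurable (Function.uncurry (duhamelMaj μ G F)) := by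
  have h2 : ∀ p : ℝ × R3, ∫⁻ s in Ioc 0 p.1, ENNReal.ofReal (heatSym μ (p.1 - s) p.2) * F s p.2 =
      ∫⁻ s, {q : (ℝ × R3) × ℝ | 0 < q.2 ∧ q.2 ≤ q.1.1}.indicator
        (fun q => ENNReal.ofReal (heatSym μ (q.1.1 - q.2) q.1.2) *
          Function.uncurry F (q.2, q.1.2)) (p, s) := by
    intro p
    rw [← lintegral_indicator measurableSet_Ioc]
    rfl
  have h3 : Function.uncurry (duhamelMaj μ G F) = fun p : ℝ × R3 =>
      ENNReal.ofReal (heatSym μ p.1 p.2) * G p.2 +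
      ∫⁻ s in Ioc 0 p.1, ENNReal.ofReal (heatSym μ (p.1 - s) p.2) * F s p.2 := rfl
  rw [h3]
  simp only [h2]
  refine Measurable.add (by fun_prop) (Measurable.lintegral_prod_right'
    (Measurable.indicator (by fun_prop) ?_))
  exact (measurableSet_lt measurable_const measurable_snd).inter
      (measurableSet_le measurable_snd (by fun_prop))

lemma measurable_duhamel (μ : ℝ) {g : R3 → C3} {n : ℝ → R3 → C3} (hg : Measurable g)
    (hn : Measurable (Function.uncurry n)) :
    Measurable (Function.uncurry (duhamel μ g n)) := by
  have h2 : ∀ p : ℝ × R3, ∫ s in Ioc 0 p.1, (heatSym μ (p.1 - s) p.2 : ℂ) • n s p.2 =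
      ∫ s, {q : (ℝ × R3) × ℝ | 0 < q.2 ∧ q.2 ≤ q.1.1}.indicator
        (fun q => (heatSym μ (q.1.1 - q.2) q.1.2 : ℂ) • Function.uncurry n (q.2, q.1.2)) (p, s) := by
    intro p
    rw [← integral_indicator measurableSet_Ioc]
    rfl
  have h3 : Function.uncurry (duhamel μ g n) = fun p : ℝ × R3 =>
      (heatSym μ p.1 p.2 : ℂ) • g p.2 -
      ∫ s in Ioc 0 p.1, (heatSym μ (p.1 - s) p.2 : ℂ) • n s p.2 := rfl
  rw [h3]
  simp only [h2]
  refine Measurable.sub (by fun_prop) (StronglyMeasurable.integral_prod_right'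
    (Measurable.stronglyMeasurable (Measurable.indicator (by fun_prop) ?_))).measurable
  exact (measurableSet_lt measurable_const measurable_snd).inter
      (measurableSet_le measurable_snd (by fun_prop))

lemma measurable_nonlin {v : ℝ → R3 → C3} (hv : Measurable (Function.uncurry v)) :
    Measurable (Function.uncurry fun s => nonlin (v s)) := by
  have h : Measurable fun q : (ℝ × R3) × R3 => bilin q.1.2 (Function.uncurry v (q.1.1, q.2))
      (Function.uncurry v (q.1.1, q.1.2 - q.2)) := by
    have h1 : Measurable fun q : (ℝ × R3) × R3 => (q.1.2, Function.uncurry v (q.1.1, q.2),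
      Function.uncurry v (q.1.1, q.1.2 - q.2)) := by fun_prop
    simpa only [Function.comp_def] using measurable_bilin.comp h1
  have h3 : (Function.uncurry fun s => nonlin (v s)) = fun p : ℝ × R3 =>
      ∫ η, (fun q : (ℝ × R3) × R3 => bilin q.1.2 (Function.uncurry v (q.1.1, q.2))
        (Function.uncurry v (q.1.1, q.1.2 - q.2))) (p, η) := rfl
  rw [h3]
  exact (StronglyMeasurable.integral_prod_right' h.stronglyMeasurable).measurable

lemma measurable_nonlinMaj {V : ℝ → R3 → ℝ≥0∞} (hV : Measurable (Function.uncurry V)) :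
    Measurable (Function.uncurry fun s => nonlinMaj (V s)) := by
  have h : Measurable fun q : (ℝ × R3) × R3 => ‖q.1.2‖ₑ * (Function.uncurry V (q.1.1, q.2) *
      Function.uncurry V (q.1.1, q.1.2 - q.2)) := by
    fun_prop
  exact Measurable.lintegral_prod_right' h

lemma measurable_wnorm (s : ℝ) {V : ℝ → R3 → ℝ≥0∞} (hV : Measurable (Function.uncurry V)) :
    Measurable fun t => wnorm s (V t) := by
  have h : Measurable fun q : ℝ × R3 => ENNReal.ofReal (‖q.2‖ ^ s) * Function.uncurry V q := by
    fun_prop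
  exact Measurable.lintegral_prod_right' h

end measurability

/-- The energy inequality in `𝒳⁻¹`: the heat flow gains `μ ∫ ‖·‖_{𝒳¹}`. -/
lemma wnorm_duhamelMaj_add_le {μ : ℝ} (hμ : 0 ≤ μ) {G : R3 → ℝ≥0∞} {F : ℝ → R3 → ℝ≥0∞}
    (hG : Measurable G) (hF : Measurable (Function.uncurry F)) {t : ℝ} (ht : 0 ≤ t) :
    wnorm (-1) (duhamelMaj μ G F t) +
      ENNReal.ofReal μ * ∫⁻ τ in Ioc 0 t, wnorm 1 (duhamelMaj μ G F τ) ≤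
      wnorm (-1) G + ∫⁻ s in Ioc 0 t, wnorm (-1) (F s) := by
  have hY := measurable_duhamelMaj μ hG hF
  have hYt : ∀ τ, Measurable (duhamelMaj μ G F τ) := fun _ => hY.of_uncurry_left
  have hYξ : ∀ ξ, Measurable fun τ => duhamelMaj μ G F τ ξ := fun _ => hY.of_uncurry_right
  have hFξ : ∀ ξ, Measurable fun τ => F τ ξ := fun _ => hF.of_uncurry_right
  have h1 : ∫⁻ τ in Ioc 0 t, wnorm 1 (duhamelMaj μ G F τ) =
      ∫⁻ ξ, ENNReal.ofReal (‖ξ‖ ^ (1 : ℝ)) * ∫⁻ τ in Ioc 0 t, duhamelMaj μ G F τ ξ := by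
    unfold wnorm
    rw [lintegral_lintegral_swap]
    · exact lintegral_congr fun ξ => lintegral_const_mul _ (hYξ ξ)
    · refine Measurable.aemeasurable ?_
      exact (by fun_prop : Measurable fun p : ℝ × R3 => ENNReal.ofReal (‖p.2‖ ^ (1 : ℝ)) *
        Function.uncurry (duhamelMaj μ G F) p)
  have h2 : ∫⁻ s in Ioc 0 t, wnorm (-1) (F s) =
      ∫⁻ ξ, ENNReal.ofReal (‖ξ‖ ^ (-1 : ℝ)) * ∫⁻ s in Ioc 0 t, F s ξ := by
    unfold wnorm
    rw [lintegral_lintegral_swap]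
    · exact lintegral_congr fun ξ => lintegral_const_mul _ (hFξ ξ)
    · refine Measurable.aemeasurable ?_
      exact (by fun_prop : Measurable fun p : ℝ × R3 => ENNReal.ofReal (‖p.2‖ ^ (-1 : ℝ)) *
        Function.uncurry F p)
  have hin : Measurable fun ξ => ∫⁻ τ in Ioc 0 t, duhamelMaj μ G F τ ξ :=
    Measurable.lintegral_prod_left' hY
  rw [h1, h2, wnorm, wnorm, ← lintegral_const_mul _ (by fun_prop),
    ← lintegral_add_left (by fun_prop), ← lintegral_add_left (by fun_prop)]
  refine lintegral_mono fun ξ => ?_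
  have hk : 0 ≤ μ * ‖ξ‖ ^ 2 := by positivity
  have hw : ENNReal.ofReal μ * ENNReal.ofReal (‖ξ‖ ^ (1 : ℝ)) =
      ENNReal.ofReal (‖ξ‖ ^ (-1 : ℝ)) * ENNReal.ofReal (μ * ‖ξ‖ ^ 2) := by
    rw [← ENNReal.ofReal_mul hμ, ← ENNReal.ofReal_mul (by positivity), Real.rpow_one,
      Real.rpow_neg_one]
    by_cases h0 : ‖ξ‖ = 0
    · simp [h0]
    · congr 1; field_simp
  have hE := scalar_energy hk (G ξ) (hFξ ξ) ht
  have hexp : ∀ τ, Real.exp (-(μ * ‖ξ‖ ^ 2) * τ) = heatSym μ τ ξ := by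
    intro τ; rw [heatSym]; congr 1; ring
  simp only [hexp] at hE
  change _ + ENNReal.ofReal (μ * ‖ξ‖ ^ 2) * ∫⁻ τ in Ioc 0 t, duhamelMaj μ G F τ ξ = _ at hE
  change ENNReal.ofReal (‖ξ‖ ^ (-1 : ℝ)) * duhamelMaj μ G F t ξ + ENNReal.ofReal μ *
    (ENNReal.ofReal (‖ξ‖ ^ (1 : ℝ)) * ∫⁻ τ in Ioc 0 t, duhamelMaj μ G F τ ξ) ≤ _
  rw [← mul_assoc, hw, mul_assoc, ← mul_add, ← mul_add]
  exact mul_le_mul_right hE.le _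

/-! ### The Picard iteration and its majorant -/

lemma enorm_duhamel_le {μ : ℝ} {g : R3 → C3} {n : ℝ → R3 → C3} {F : ℝ → R3 → ℝ≥0∞}
    {t : ℝ} {ξ : R3} (h : ∀ᵐ s ∂volume.restrict (Ioc 0 t), ‖n s ξ‖ₑ ≤ F s ξ) :
    ‖duhamel μ g n t ξ‖ₑ ≤ duhamelMaj μ (fun ξ => ‖g ξ‖ₑ) F t ξ := by
  refine enorm_sub_le.trans ?_
  rw [enorm_smul, enorm_heatSym]
  refine add_le_add le_rfl ((enorm_integral_le_lintegral_enorm _).trans (lintegral_mono_ae ?_))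
  filter_upwards [h] with s hs
  rw [enorm_smul, enorm_heatSym]
  gcongr

lemma enorm_duhamel_sub_add_le {μ : ℝ} {g : R3 → C3} {n n' : ℝ → R3 → C3} {F F' : ℝ → R3 → ℝ≥0∞}
    (hn : Measurable (Function.uncurry n)) (hn' : Measurable (Function.uncurry n'))
    (hF : Measurable (Function.uncurry F))
    (h1 : ∀ s ξ, ‖n s ξ‖ₑ ≤ F s ξ) (h2 : ∀ s ξ, ‖n' s ξ - n s ξ‖ₑ + F s ξ ≤ F' s ξ)
    (t : ℝ) (ξ : R3) :
    ‖duhamel μ g n' t ξ - duhamel μ g n t ξ‖ₑ + duhamelMaj μ (fun ξ => ‖g ξ‖ₑ) F t ξ ≤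
      duhamelMaj μ (fun ξ => ‖g ξ‖ₑ) F' t ξ := by
  have hnξ : Measurable fun s => n s ξ := hn.of_uncurry_right
  have hnξ' : Measurable fun s => n' s ξ := hn'.of_uncurry_right
  have hFξ : Measurable fun s => F s ξ := hF.of_uncurry_right
  have h3 := enorm_integral_sub_add_le (m := volume.restrict (Ioc 0 t))
    (F := fun s => (heatSym μ (t - s) ξ : ℂ) • n s ξ)
    (F' := fun s => (heatSym μ (t - s) ξ : ℂ) • n' s ξ)
    (A := fun s => ENNReal.ofReal (heatSym μ (t - s) ξ) * F s ξ)
    (A' := fun s => ENNReal.ofReal (heatSym μ (t - s) ξ) * F' s ξ)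
    (Measurable.aestronglyMeasurable (by fun_prop))
    (Measurable.aestronglyMeasurable (by fun_prop)) (by fun_prop)
    (fun s => by rw [enorm_smul, enorm_heatSym]; gcongr; exact h1 s ξ)
    (fun s => by
      rw [← smul_sub, enorm_smul, enorm_heatSym, ← mul_add]
      gcongr
      exact h2 s ξ)
  have h4 : duhamel μ g n' t ξ - duhamel μ g n t ξ =
      -((∫ s in Ioc 0 t, (heatSym μ (t - s) ξ : ℂ) • n' s ξ) -
        ∫ s in Ioc 0 t, (heatSym μ (t - s) ξ : ℂ) • n s ξ) := by
    simp only [duhamel]; abel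
  rw [h4, enorm_neg]
  calc _ = ENNReal.ofReal (heatSym μ t ξ) * ‖g ξ‖ₑ + _ := by
        rw [duhamelMaj, add_left_comm]
    _ ≤ _ := add_le_add le_rfl h3

/-- Picard's iteration for the Navier–Stokes equations, on the Fourier side. -/
noncomputable def picard (μ : ℝ) (g : R3 → C3) : ℕ → ℝ → R3 → C3
  | 0 => fun _ _ => 0
  | n + 1 => duhamel μ g fun s => nonlin (picard μ g n s)

/-- The scalar iteration that majorizes `picard`. -/
noncomputable def picardMaj (μ : ℝ) (g : R3 → C3) : ℕ → ℝ → R3 → ℝ≥0∞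
  | 0 => fun _ _ => 0
  | n + 1 => duhamelMaj μ (fun ξ => ‖g ξ‖ₑ) fun s => nonlinMaj (picardMaj μ g n s)

section picard

variable {μ : ℝ} {g : R3 → C3}

lemma measurable_picard (hg : Measurable g) (n : ℕ) :
    Measurable (Function.uncurry (picard μ g n)) := by
  induction n with
  | zero => exact measurable_const
  | succ n ih => exact measurable_duhamel μ hg (measurable_nonlin ih)

lemma measurable_picardMaj (hg : Measurable g) (n : ℕ) :
    Measurable (Function.uncurry (picardMaj μ g n)) := by
  induction n with
  | zero => exact measurable_const
  | succ n ih => exact measurable_duhamelMaj μ hg.enorm (measurable_nonlinMaj ih)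

lemma enorm_picard_le (n : ℕ) (t : ℝ) (ξ : R3) : ‖picard μ g n t ξ‖ₑ ≤ picardMaj μ g n t ξ := by
  induction n generalizing t ξ with
  | zero => simp [picard]
  | succ n ih => exact enorm_duhamel_le (ae_of_all _ fun s => enorm_nonlin_le (ih s) ξ)

/-- The increments of the majorant control those of the iteration. -/
lemma enorm_picard_succ_sub_add_le (hg : Measurable g) (n : ℕ) (t : ℝ) (ξ : R3) :
    ‖picard μ g (n + 1) t ξ - picard μ g n t ξ‖ₑ + picardMaj μ g n t ξ ≤
      picardMaj μ g (n + 1) t ξ := by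
  induction n generalizing t ξ with
  | zero => simpa [picard, picardMaj] using enorm_picard_le 1 t ξ
  | succ n ih =>
    refine enorm_duhamel_sub_add_le (measurable_nonlin (measurable_picard hg n))
      (measurable_nonlin (measurable_picard hg (n + 1)))
      (measurable_nonlinMaj (measurable_picardMaj hg n))
      (fun s ξ => enorm_nonlin_le (enorm_picard_le n s) ξ) (fun s ξ => ?_) t ξ
    exact enorm_nonlin_sub_add_le (measurable_picard hg n).of_uncurry_left
      (measurable_picard hg (n + 1)).of_uncurry_left (measurable_picardMaj hg n).of_uncurry_left
      (enorm_picard_le n s) (ih s) ξ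

lemma monotone_picardMaj (hg : Measurable g) (t : ℝ) (ξ : R3) :
    Monotone fun n => picardMaj μ g n t ξ :=
  monotone_nat_of_le_succ fun n => le_add_self.trans (enorm_picard_succ_sub_add_le hg n t ξ)

/-- Absorption of the nonlinear term in the energy inequality: `a + μ M ≤ A + A M` gives
`a + (μ - A) M ≤ A` when `A < μ`. -/
lemma absorb {a A m M : ℝ≥0∞} (hA : A ≤ m) (hA' : A ≠ ∞) (hM : M ≠ ∞)
    (h : a + m * M ≤ A + A * M) : a + (m - A) * M ≤ A := by
  have h1 : (a + (m - A) * M) + A * M ≤ A + A * M := by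
    rwa [add_assoc, ← add_mul, tsub_add_cancel_of_le hA]
  exact (ENNReal.add_le_add_iff_right (ENNReal.mul_ne_top hA' hM)).1 h1

/-- The a priori estimate for the iteration, uniform in `n`. -/
lemma picardMaj_energy (hμ : 0 ≤ μ) (hg : Measurable g)
    (hsmall : wnorm (-1) (fun ξ => ‖g ξ‖ₑ) < ENNReal.ofReal μ) (n : ℕ) {t : ℝ} (ht : 0 ≤ t) :
    wnorm (-1) (picardMaj μ g n t) + (ENNReal.ofReal μ - wnorm (-1) (fun ξ => ‖g ξ‖ₑ)) *
      ∫⁻ τ in Ioc 0 t, wnorm 1 (picardMaj μ g n τ) ≤ wnorm (-1) (fun ξ => ‖g ξ‖ₑ) := by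
  set A := wnorm (-1) (fun ξ => ‖g ξ‖ₑ) with hA
  induction n generalizing t with
  | zero => simp [picardMaj, wnorm]
  | succ n ih =>
    have hpos : ENNReal.ofReal μ - A ≠ 0 := (tsub_pos_of_lt hsmall).ne'
    have hAtop : A ≠ ∞ := hsmall.ne_top
    have hfin : ∫⁻ τ in Ioc 0 t, wnorm 1 (picardMaj μ g n τ) ≠ ∞ := by
      intro h
      have := ih ht
      rw [h, ENNReal.mul_top hpos, add_top] at this
      exact hAtop (top_le_iff.1 this)
    have h1 := wnorm_duhamelMaj_add_le hμ hg.enorm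
      (measurable_nonlinMaj (measurable_picardMaj (μ := μ) hg n)) ht
    have h2 : ∫⁻ s in Ioc 0 t, wnorm (-1) (nonlinMaj (picardMaj μ g n s)) ≤
        A * ∫⁻ s in Ioc 0 t, wnorm 1 (picardMaj μ g n s) := by
      rw [← lintegral_const_mul' _ _ hAtop]
      refine setLIntegral_mono' measurableSet_Ioc fun s hs => ?_
      refine (wnorm_nonlinMaj_le (measurable_picardMaj hg n).of_uncurry_left).trans ?_
      gcongr
      exact le_self_add.trans (ih hs.1.le)
    have h3 : wnorm (-1) (picardMaj μ g (n + 1) t) + ENNReal.ofReal μ *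
        ∫⁻ τ in Ioc 0 t, wnorm 1 (picardMaj μ g (n + 1) τ) ≤
        A + A * ∫⁻ s in Ioc 0 t, wnorm 1 (picardMaj μ g n s) := h1.trans (add_le_add le_rfl h2)
    have hfin' : ∫⁻ τ in Ioc 0 t, wnorm 1 (picardMaj μ g (n + 1) τ) ≠ ∞ := by
      intro h
      rw [h, ENNReal.mul_top (ne_bot_of_gt hsmall), add_top, top_le_iff] at h3
      exact ENNReal.add_ne_top.2 ⟨hAtop, ENNReal.mul_ne_top hAtop hfin⟩ h3
    refine absorb hsmall.le hAtop hfin' (h3.trans ?_)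
    gcongr with τ
    exact wnorm_mono _ fun ξ => monotone_picardMaj hg τ ξ n.le_succ

/-- The limit of the majorants. -/
noncomputable def picardSup (μ : ℝ) (g : R3 → C3) (t : ℝ) (ξ : R3) : ℝ≥0∞ :=
  ⨆ n, picardMaj μ g n t ξ

lemma measurable_picardSup (hg : Measurable g) :
    Measurable (Function.uncurry (picardSup μ g)) :=
  Measurable.iSup fun n => measurable_picardMaj hg n

lemma wnorm_picardSup (hg : Measurable g) (s t : ℝ) :
    wnorm s (picardSup μ g t) = ⨆ n, wnorm s (picardMaj μ g n t) := by
  unfold wnorm picardSup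
  simp only [ENNReal.mul_iSup]
  refine lintegral_iSup (fun n => ?_) fun n m hnm ξ => ?_
  · have : Measurable (picardMaj μ g n t) := (measurable_picardMaj hg n).of_uncurry_left
    fun_prop
  · exact mul_le_mul_right (monotone_picardMaj hg t ξ hnm) _

lemma picardSup_energy (hμ : 0 ≤ μ) (hg : Measurable g)
    (hsmall : wnorm (-1) (fun ξ => ‖g ξ‖ₑ) < ENNReal.ofReal μ) {t : ℝ} (ht : 0 ≤ t) :
    wnorm (-1) (picardSup μ g t) + (ENNReal.ofReal μ - wnorm (-1) (fun ξ => ‖g ξ‖ₑ)) *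
      ∫⁻ τ in Ioc 0 t, wnorm 1 (picardSup μ g τ) ≤ wnorm (-1) (fun ξ => ‖g ξ‖ₑ) := by
  have hmono : ∀ s τ, Monotone fun n => wnorm s (picardMaj μ g n τ) := fun s τ n m hnm =>
    wnorm_mono _ fun ξ => monotone_picardMaj hg τ ξ hnm
  have h1 : ∫⁻ τ in Ioc 0 t, wnorm 1 (picardSup μ g τ) =
      ⨆ n, ∫⁻ τ in Ioc 0 t, wnorm 1 (picardMaj μ g n τ) := by
    simp only [wnorm_picardSup hg]
    exact lintegral_iSup (fun n => measurable_wnorm 1 (measurable_picardMaj hg n))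
      fun n m hnm τ => hmono 1 τ hnm
  rw [h1, wnorm_picardSup hg, ENNReal.mul_iSup, ENNReal.iSup_add_iSup_of_monotone (hmono _ _)]
  · exact iSup_le fun n => picardMaj_energy hμ hg hsmall n ht
  · intro n m hnm
    refine mul_le_mul_right (lintegral_mono fun τ => hmono 1 τ hnm) _

end picard

/-! ### The global solution on the Fourier side -/

/-- Dominated convergence with an extended nonnegative majorant. -/
lemma tendsto_integral_of_enorm_le {α E : Type*} [MeasurableSpace α] [NormedAddCommGroup E]
    [NormedSpace ℝ E] {m : Measure α} {F : ℕ → α → E} {f : α → E} {B : α → ℝ≥0∞}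
    (hF : ∀ n, AEStronglyMeasurable (F n) m) (hBm : AEMeasurable B m) (hB : ∫⁻ x, B x ∂m ≠ ∞)
    (hFB : ∀ n x, ‖F n x‖ₑ ≤ B x)
    (hlim : ∀ᵐ x ∂m, Tendsto (fun n => F n x) atTop (𝓝 (f x))) :
    Tendsto (fun n => ∫ x, F n x ∂m) atTop (𝓝 (∫ x, f x ∂m)) := by
  refine tendsto_integral_of_dominated_convergence (fun x => (B x).toReal) hF
    (integrable_toReal_of_lintegral_ne_top hBm hB) (fun n => ?_) hlim
  filter_upwards [ae_lt_top' hBm hB] with x hx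
  rw [← toReal_enorm]
  exact ENNReal.toReal_mono hx.ne (hFB n x)

lemma ae_lt_top_of_wnorm_ne_top {s : ℝ} {G : R3 → ℝ≥0∞} (hG : Measurable G) (h : wnorm s G ≠ ∞) :
    ∀ᵐ ξ, G ξ < ∞ := by
  filter_upwards [ae_lt_top (by fun_prop) h, ae_ne_zero] with ξ hξ h0
  have hpos : ENNReal.ofReal (‖ξ‖ ^ s) ≠ 0 := by
    have := Real.rpow_pos_of_pos (norm_pos_iff.2 h0) s
    simpa using this
  rw [lt_top_iff_ne_top]
  intro htop
  rw [htop, ENNReal.mul_top hpos] at hξ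
  exact lt_irrefl _ hξ

lemma lintegral_Ioi_le_of_forall {f : ℝ → ℝ≥0∞} {K : ℝ≥0∞}
    (h : ∀ t, 0 ≤ t → ∫⁻ τ in Ioc 0 t, f τ ≤ K) : ∫⁻ τ in Ioi 0, f τ ≤ K := by
  have hU : Ioi (0 : ℝ) = ⋃ n : ℕ, Ioc (0 : ℝ) n := by
    ext x
    simp only [mem_Ioi, mem_iUnion, mem_Ioc]
    exact ⟨fun hx => (exists_nat_ge x).imp fun n hn => ⟨hx, hn⟩, fun ⟨n, hn⟩ => hn.1⟩
  rw [hU, setLIntegral_iUnion_of_directed]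
  · exact iSup_le fun n => h n n.cast_nonneg
  · exact (monotone_nat_of_le_succ fun n => Ioc_subset_Ioc_right (by simp)).directed_le

lemma wnorm_lintegral {s : ℝ} {F : ℝ → R3 → ℝ≥0∞} (hF : Measurable (Function.uncurry F))
    (I : Set ℝ) : ∫⁻ τ in I, wnorm s (F τ) = wnorm s fun ξ => ∫⁻ τ in I, F τ ξ := by
  unfold wnorm
  rw [lintegral_lintegral_swap]
  · exact lintegral_congr fun ξ => lintegral_const_mul _ hF.of_uncurry_right
  · refine Measurable.aemeasurable ?_
    exact (by fun_prop : Measurable fun p : ℝ × R3 => ENNReal.ofReal (‖p.2‖ ^ s) *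
      Function.uncurry F p)

section flow

variable {μ : ℝ} {g : R3 → C3}

lemma exists_tendsto_picard (hg : Measurable g) {t : ℝ} {ξ : R3} (h : picardSup μ g t ξ ≠ ∞) :
    ∃ w, Tendsto (fun n => picard μ g n t ξ) atTop (𝓝 w) := by
  refine cauchySeq_tendsto_of_complete (cauchySeq_of_edist_le_of_tsum_ne_top
    (fun n => ‖picard μ g (n + 1) t ξ - picard μ g n t ξ‖ₑ) (fun n => ?_) ?_)
  · rw [edist_comm, edist_eq_enorm_sub]
  · refine ne_top_of_le_ne_top h (ENNReal.tsum_le_of_sum_range_le fun n => ?_)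
    have : ∑ k ∈ Finset.range n, ‖picard μ g (k + 1) t ξ - picard μ g k t ξ‖ₑ ≤
        picardMaj μ g n t ξ := by
      induction n with
      | zero => simp
      | succ n ih =>
        rw [Finset.sum_range_succ, add_comm]
        exact (add_le_add le_rfl ih).trans (enorm_picard_succ_sub_add_le hg n t ξ)
    exact this.trans (le_iSup (fun n => picardMaj μ g n t ξ) n)

open Classical in
/-- The Fourier transform of the solution: the limit of the Picard iteration where the majorants
stay bounded, and `0` elsewhere. -/
noncomputable def flow (μ : ℝ) (g : R3 → C3) (t : ℝ) (ξ : R3) : C3 :=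
  limUnder atTop fun n => if picardSup μ g t ξ = ∞ then 0 else picard μ g n t ξ

lemma tendsto_ite_flow (hg : Measurable g) (t : ℝ) (ξ : R3) :
    Tendsto (fun n => if picardSup μ g t ξ = ∞ then 0 else picard μ g n t ξ) atTop
      (𝓝 (flow μ g t ξ)) := by
  refine tendsto_nhds_limUnder ?_
  by_cases h : picardSup μ g t ξ = ∞
  · simp only [h, if_true]; exact ⟨0, tendsto_const_nhds⟩
  · simpa only [h, if_false] using exists_tendsto_picard hg h

lemma tendsto_flow (hg : Measurable g) {t : ℝ} {ξ : R3} (h : picardSup μ g t ξ ≠ ∞) :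
    Tendsto (fun n => picard μ g n t ξ) atTop (𝓝 (flow μ g t ξ)) := by
  have := tendsto_ite_flow (μ := μ) hg t ξ
  simpa only [if_neg h] using this

lemma measurable_flow (hg : Measurable g) : Measurable (Function.uncurry (flow μ g)) := by
  refine measurable_of_tendsto_metrizable (f := fun n p =>
    if picardSup μ g p.1 p.2 = ∞ then 0 else picard μ g n p.1 p.2) (fun n => ?_)
    (tendsto_pi_nhds.2 fun p => tendsto_ite_flow hg p.1 p.2)
  exact Measurable.ite (measurable_picardSup hg (measurableSet_singleton ∞)) measurable_const
    (measurable_picard hg n)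

lemma enorm_flow_le (hg : Measurable g) (t : ℝ) (ξ : R3) :
    ‖flow μ g t ξ‖ₑ ≤ picardSup μ g t ξ := by
  refine le_of_tendsto (tendsto_ite_flow hg t ξ).enorm (Eventually.of_forall fun n => ?_)
  split_ifs
  · simp
  · exact (enorm_picard_le n t ξ).trans (le_iSup (fun n => picardMaj μ g n t ξ) n)

lemma flow_energy (hμ : 0 ≤ μ) (hg : Measurable g)
    (hsmall : wnorm (-1) (fun ξ => ‖g ξ‖ₑ) < ENNReal.ofReal μ) {t : ℝ} (ht : 0 ≤ t) :
    wnorm (-1) (fun ξ => ‖flow μ g t ξ‖ₑ) +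
      (ENNReal.ofReal μ - wnorm (-1) (fun ξ => ‖g ξ‖ₑ)) *
        ∫⁻ τ in Ioc 0 t, wnorm 1 (fun ξ => ‖flow μ g τ ξ‖ₑ) ≤ wnorm (-1) (fun ξ => ‖g ξ‖ₑ) := by
  refine le_trans ?_ (picardSup_energy hμ hg hsmall ht)
  gcongr with τ
  · exact wnorm_mono _ (enorm_flow_le hg t)
  · exact wnorm_mono _ (enorm_flow_le hg τ)

lemma lintegral_picardSup_ne_top (hμ : 0 ≤ μ) (hg : Measurable g)
    (hsmall : wnorm (-1) (fun ξ => ‖g ξ‖ₑ) < ENNReal.ofReal μ) :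
    ∫⁻ τ in Ioi 0, wnorm 1 (picardSup μ g τ) ≠ ∞ := by
  have hpos : ENNReal.ofReal μ - wnorm (-1) (fun ξ => ‖g ξ‖ₑ) ≠ 0 := (tsub_pos_of_lt hsmall).ne'
  refine ne_top_of_le_ne_top (ENNReal.div_ne_top hsmall.ne_top hpos)
    (lintegral_Ioi_le_of_forall fun t ht => ?_)
  rw [ENNReal.le_div_iff_mul_le (.inl hpos) (.inr hsmall.ne_top), mul_comm]
  exact le_add_self.trans (picardSup_energy hμ hg hsmall ht)

lemma wnorm_picardSup_ne_top (hμ : 0 ≤ μ) (hg : Measurable g)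
    (hsmall : wnorm (-1) (fun ξ => ‖g ξ‖ₑ) < ENNReal.ofReal μ) {t : ℝ} (ht : 0 ≤ t) :
    wnorm (-1) (picardSup μ g t) ≠ ∞ :=
  ne_top_of_le_ne_top hsmall.ne_top (le_self_add.trans (picardSup_energy hμ hg hsmall ht))

/-- The nonlinear term belongs to `L¹((0, ∞); 𝒳⁻¹)`. -/
lemma lintegral_nonlinMaj_picardSup_ne_top (hμ : 0 ≤ μ) (hg : Measurable g)
    (hsmall : wnorm (-1) (fun ξ => ‖g ξ‖ₑ) < ENNReal.ofReal μ) :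
    ∫⁻ τ in Ioi 0, wnorm (-1) (nonlinMaj (picardSup μ g τ)) ≠ ∞ := by
  refine ne_top_of_le_ne_top (ENNReal.mul_ne_top hsmall.ne_top
    (lintegral_picardSup_ne_top hμ hg hsmall)) ?_
  rw [← lintegral_const_mul' _ _ hsmall.ne_top]
  refine setLIntegral_mono' measurableSet_Ioi fun s hs => ?_
  refine (wnorm_nonlinMaj_le (measurable_picardSup hg).of_uncurry_left).trans ?_
  gcongr
  exact le_self_add.trans (picardSup_energy hμ hg hsmall (le_of_lt hs))

lemma ae_lintegral_nonlinMaj_lt_top (hμ : 0 ≤ μ) (hg : Measurable g)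
    (hsmall : wnorm (-1) (fun ξ => ‖g ξ‖ₑ) < ENNReal.ofReal μ) :
    ∀ᵐ ξ, ∫⁻ s in Ioi 0, nonlinMaj (picardSup μ g s) ξ < ∞ := by
  have hm := measurable_nonlinMaj (measurable_picardSup (μ := μ) hg)
  refine ae_lt_top_of_wnorm_ne_top (s := -1) (Measurable.lintegral_prod_left' hm) ?_
  have := lintegral_nonlinMaj_picardSup_ne_top hμ hg hsmall
  rwa [wnorm_lintegral hm] at this

/-- At frequencies where the majorant of the nonlinear term is integrable in time, the majorants
stay bounded at all times. -/
lemma picardSup_ne_top {ξ : R3} (hμ : 0 ≤ μ)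
    (hξ : ∫⁻ s in Ioi 0, nonlinMaj (picardSup μ g s) ξ < ∞) {t : ℝ} (ht : 0 ≤ t) :
    picardSup μ g t ξ ≠ ∞ := by
  refine ne_top_of_le_ne_top (ENNReal.add_ne_top.2 ⟨enorm_ne_top (x := g ξ), hξ.ne⟩)
    (iSup_le fun n => ?_)
  cases n with
  | zero => exact zero_le
  | succ n =>
    refine add_le_add ?_ ?_
    · exact mul_le_of_le_one_left' (ENNReal.ofReal_le_one.2 (heatSym_le_one hμ ht ξ))
    · refine (setLIntegral_mono' measurableSet_Ioc fun s hs => ?_).trans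
        (lintegral_mono_set Ioc_subset_Ioi_self)
      refine (mul_le_of_le_one_left' (ENNReal.ofReal_le_one.2
        (heatSym_le_one hμ (sub_nonneg.2 hs.2) ξ))).trans (lintegral_mono fun η => ?_)
      gcongr
      · exact le_iSup (fun n => picardMaj μ g n s η) n
      · exact le_iSup (fun n => picardMaj μ g n s (ξ - η)) n

lemma tendsto_nonlin_picard (hμ : 0 ≤ μ) (hg : Measurable g)
    (hsmall : wnorm (-1) (fun ξ => ‖g ξ‖ₑ) < ENNReal.ofReal μ) {s : ℝ} (hs : 0 ≤ s) {ξ : R3}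
    (hξ : nonlinMaj (picardSup μ g s) ξ ≠ ∞) :
    Tendsto (fun n => nonlin (picard μ g n s) ξ) atTop (𝓝 (nonlin (flow μ g s) ξ)) := by
  have hVm : Measurable (picardSup μ g s) := (measurable_picardSup hg).of_uncurry_left
  have hae : ∀ᵐ η, picardSup μ g s η < ∞ :=
    ae_lt_top_of_wnorm_ne_top hVm (wnorm_picardSup_ne_top hμ hg hsmall hs)
  have hae' : ∀ᵐ η, picardSup μ g s (ξ - η) < ∞ :=
    (Measure.measurePreserving_sub_left volume ξ).quasiMeasurePreserving.ae hae
  refine tendsto_integral_of_enorm_le (fun n => ?_) (by fun_prop) hξ (fun n η => ?_) ?_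
  · have := (measurable_picard (μ := μ) hg n).of_uncurry_left (x := s)
    exact (measurable_bilin_slice this this ξ).aestronglyMeasurable
  · refine (enorm_bilin_le _ _ _).trans ?_
    gcongr
    · exact (enorm_picard_le n s _).trans (le_iSup (fun n => picardMaj μ g n s η) n)
    · exact (enorm_picard_le n s _).trans (le_iSup (fun n => picardMaj μ g n s (ξ - η)) n)
  · filter_upwards [hae, hae'] with η h1 h2
    have h3 := ((continuous_bilin ξ).tendsto (flow μ g s η, flow μ g s (ξ - η))).comp
      ((tendsto_flow hg h1.ne).prodMk_nhds (tendsto_flow hg h2.ne))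
    simpa only [Function.comp_def] using h3

/-- The limit of the iteration solves the integral equation. -/
lemma flow_eq_duhamel (hμ : 0 ≤ μ) (hg : Measurable g)
    (hsmall : wnorm (-1) (fun ξ => ‖g ξ‖ₑ) < ENNReal.ofReal μ) :
    ∀ᵐ ξ, ∀ t, 0 ≤ t → flow μ g t ξ = duhamel μ g (fun s => nonlin (flow μ g s)) t ξ := by
  filter_upwards [ae_lintegral_nonlinMaj_lt_top hμ hg hsmall] with ξ hξ t ht
  have hVm : Measurable fun s => nonlinMaj (picardSup μ g s) ξ :=
    (measurable_nonlinMaj (measurable_picardSup hg)).of_uncurry_right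
  have hle : ∫⁻ s in Ioc 0 t, nonlinMaj (picardSup μ g s) ξ ≠ ∞ :=
    ((lintegral_mono_set Ioc_subset_Ioi_self).trans_lt hξ).ne
  have h1 := (tendsto_flow hg (picardSup_ne_top hμ hξ ht)).comp (tendsto_add_atTop_nat 1)
  refine tendsto_nhds_unique h1 (Tendsto.sub tendsto_const_nhds ?_)
  have hmeas : ∀ n, Measurable fun s => nonlin (picard μ g n s) ξ := fun n =>
    (measurable_nonlin (measurable_picard hg n)).of_uncurry_right
  -- The heat factor is only bounded by `1` for `s ≤ t`, so the dominating function is cut off.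
  have h2 := tendsto_integral_of_enorm_le (m := volume.restrict (Ioc 0 t))
    (F := fun n s => (Ioc 0 t).indicator
      (fun s => (heatSym μ (t - s) ξ : ℂ) • nonlin (picard μ g n s) ξ) s)
    (f := fun s => (heatSym μ (t - s) ξ : ℂ) • nonlin (flow μ g s) ξ)
    (B := fun s => nonlinMaj (picardSup μ g s) ξ) (fun n => ?_) hVm.aemeasurable hle
    (fun n s => ?_) ?_
  · refine h2.congr fun n => setIntegral_congr_fun measurableSet_Ioc fun s hs => ?_
    simp only [indicator_of_mem hs]
  · have := hmeas n
    exact (Measurable.indicator (by fun_prop) measurableSet_Ioc).aestronglyMeasurable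
  · by_cases hs : s ∈ Ioc 0 t
    · rw [indicator_of_mem hs, enorm_smul, enorm_heatSym]
      refine (mul_le_of_le_one_left' (ENNReal.ofReal_le_one.2
        (heatSym_le_one hμ (sub_nonneg.2 hs.2) ξ))).trans ?_
      exact enorm_nonlin_le (fun η => (enorm_picard_le n s η).trans
        (le_iSup (fun n => picardMaj μ g n s η) n)) ξ
    · rw [indicator_of_notMem hs]; simp
  · filter_upwards [ae_lt_top hVm hle, ae_restrict_mem measurableSet_Ioc] with s hs hst
    simp only [indicator_of_mem hst]
    exact (tendsto_nonlin_picard hμ hg hsmall hst.1.le hs.ne).const_smul _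

end flow

/-! ### Symmetries of the iteration -/

section symmetry

variable {μ : ℝ} {g : R3 → C3}

lemma leraySymbol_neg_conj {ξ : R3} {w w' : C3} (h : ∀ k, w' k = conj (w k)) (k : Fin 3) :
    leraySymbol (-ξ) w' k = conj (leraySymbol ξ w k) := by
  simp [leraySymbol, h]

lemma bilin_neg_conj {ξ : R3} {a a' b b' : C3} (ha : ∀ k, a' k = conj (a k))
    (hb : ∀ k, b' k = conj (b k)) (k : Fin 3) : bilin (-ξ) a' b' k = conj (bilin ξ a b k) := by
  refine leraySymbol_neg_conj (fun k => ?_) k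
  simp [ha, hb]

/-- `∫ F(x) dx` has the complex conjugate components of `∫ G(x) dx`. -/
lemma integral_apply_conj {α : Type*} [MeasurableSpace α] {m : Measure α} {F G : α → C3}
    (hF : AEStronglyMeasurable F m) (h : ∀ x k, F x k = conj (G x k)) (hG : AEStronglyMeasurable G m)
    (k : Fin 3) : (∫ x, F x ∂m) k = conj ((∫ x, G x ∂m) k) := by
  have hn : ∀ x, ‖F x‖ = ‖G x‖ := fun x => by
    rw [EuclideanSpace.norm_eq, EuclideanSpace.norm_eq]; simp [h]
  by_cases hi : Integrable G m
  · have hi' : Integrable F m := hi.congr' hF (ae_of_all _ fun x => (hn x).symm)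
    rw [integral_apply hi', integral_apply hi, ← integral_conj]
    simp only [h]
  · have hi' : ¬ Integrable F m := fun hF' => hi (hF'.congr' hG (ae_of_all _ hn))
    rw [integral_undef hi, integral_undef hi']
    simp

lemma nonlin_neg {v : R3 → C3} (hv : Measurable v) (h : ∀ ξ k, v (-ξ) k = conj (v ξ k)) (ξ : R3)
    (k : Fin 3) : nonlin v (-ξ) k = conj (nonlin v ξ k) := by
  have h1 : nonlin v (-ξ) = ∫ η, bilin (-ξ) (v (-η)) (v (-ξ - -η)) :=
    (integral_neg_eq_self (fun η => bilin (-ξ) (v η) (v (-ξ - η))) volume).symm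
  rw [h1]
  refine integral_apply_conj ?_ (fun η k => bilin_neg_conj (fun k => h η k) (fun k => ?_) k)
    (measurable_bilin_slice hv hv ξ).aestronglyMeasurable k
  · have := (measurable_bilin_slice hv hv (-ξ)).comp measurable_neg
    exact this.aestronglyMeasurable
  · have := h (ξ - η) k
    rwa [show -(ξ - η) = -ξ - -η by abel] at this

lemma picard_neg (hg : Measurable g) (h : ∀ ξ k, g (-ξ) k = conj (g ξ k)) (n : ℕ) (t : ℝ) (ξ : R3)
    (k : Fin 3) : picard μ g n t (-ξ) k = conj (picard μ g n t ξ k) := by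
  induction n generalizing t ξ k with
  | zero => simp [picard]
  | succ n ih =>
    have hN := measurable_nonlin (measurable_picard (μ := μ) hg n)
    have hs : ∀ t ξ, heatSym μ t (-ξ) = heatSym μ t ξ := fun t ξ => by simp [heatSym]
    have hm : ∀ ξ, Measurable fun s => (heatSym μ (t - s) ξ : ℂ) • nonlin (picard μ g n s) ξ := by
      intro ξ
      have : Measurable fun s => nonlin (picard μ g n s) ξ := hN.of_uncurry_right
      fun_prop
    simp only [picard, duhamel, PiLp.sub_apply, map_sub]
    congr 1
    · simp [hs, h]
    · refine integral_apply_conj (hm _).aestronglyMeasurable (fun s k => ?_)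
        (hm _).aestronglyMeasurable k
      simp only [hs, PiLp.smul_apply, smul_eq_mul, map_mul, Complex.conj_ofReal]
      rw [nonlin_neg (measurable_picard hg n).of_uncurry_left (fun ξ k => ih s ξ k)]

/-- The pairing `w ↦ ∑ⱼ ξⱼ wⱼ`; divergence-free means that it annihilates `f̂(ξ)`. -/
noncomputable def freqPairing (ξ : R3) : C3 →L[ℂ] ℂ :=
  ∑ j, (ξ j : ℂ) • (EuclideanSpace.proj (𝕜 := ℂ) j : C3 →L[ℂ] ℂ)

lemma freqPairing_apply (ξ : R3) (w : C3) : freqPairing ξ w = ∑ j, (ξ j : ℂ) * w j := by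
  simp [freqPairing]

lemma freqPairing_leraySymbol (ξ : R3) (w : C3) : freqPairing ξ (leraySymbol ξ w) = 0 := by
  by_cases hξ : ξ = 0
  · simp [freqPairing, hξ]
  have hne : ((‖ξ‖ ^ 2 : ℝ) : ℂ) ≠ 0 := by
    have := norm_pos_iff.2 hξ
    exact_mod_cast (by positivity)
  have hsq : ((‖ξ‖ ^ 2 : ℝ) : ℂ) = ∑ j, (ξ j : ℂ) * (ξ j : ℂ) := by
    rw [EuclideanSpace.real_norm_sq_eq]
    push_cast
    simp only [sq]
  rw [freqPairing_apply]
  simp only [leraySymbol, mul_sub, Finset.sum_sub_distrib]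
  rw [sub_eq_zero]
  set c := ∑ j, (ξ j : ℂ) * w j
  have : ∀ k : Fin 3, (ξ k : ℂ) * ((ξ k : ℂ) * c / ((‖ξ‖ ^ 2 : ℝ) : ℂ)) =
      ((ξ k : ℂ) * (ξ k : ℂ)) * (c / ((‖ξ‖ ^ 2 : ℝ) : ℂ)) := fun k => by ring
  simp only [this]
  rw [← Finset.sum_mul, ← hsq, mul_div_cancel₀ _ hne]

/-- Continuous linear functionals that vanish on the integrand vanish on the integral. -/
lemma clm_integral_eq_zero {α : Type*} [MeasurableSpace α] {m : Measure α} {F : α → C3}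
    (L : C3 →L[ℂ] ℂ) (h : ∀ x, L (F x) = 0) : L (∫ x, F x ∂m) = 0 := by
  by_cases hi : Integrable F m
  · rw [← L.integral_comp_comm hi]; simp [h]
  · rw [integral_undef hi, map_zero]

lemma freqPairing_nonlin (v : R3 → C3) (ξ : R3) : freqPairing ξ (nonlin v ξ) = 0 :=
  clm_integral_eq_zero _ fun _ => freqPairing_leraySymbol _ _

lemma freqPairing_picard (h : ∀ ξ, freqPairing ξ (g ξ) = 0) (n : ℕ) (t : ℝ) (ξ : R3) :
    freqPairing ξ (picard μ g n t ξ) = 0 := by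
  cases n with
  | zero => simp [picard]
  | succ n =>
    simp only [picard, duhamel, map_sub, map_smul, h, smul_zero, zero_sub, neg_eq_zero]
    exact clm_integral_eq_zero _ fun s => by rw [map_smul, freqPairing_nonlin, smul_zero]

end symmetry

/-! ### Curves in `L¹` spaces and functions of two variables -/

section curves

variable {α X E : Type*} [MeasurableSpace α] [MeasurableSpace X] {ν : Measure X}
  [NormedAddCommGroup E]

lemma edist_eq_lintegral_of_ae_eq {u w : Lp E 1 ν} {f h : X → E} (hu : u =ᵐ[ν] f)
    (hw : w =ᵐ[ν] h) : edist u w = ∫⁻ x, ‖f x - h x‖ₑ ∂ν := by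
  rw [Lp.edist_def, eLpNorm_one_eq_lintegral_enorm]
  refine lintegral_congr_ae ?_
  filter_upwards [hu, hw] with x h1 h2
  simp [h1, h2]

variable [MeasurableSpace E] [BorelSpace E] [SecondCountableTopology E]

/-- A strongly measurable curve in `L¹` is given by a jointly measurable function. It is the limit
of countably valued approximations, which are chosen so close that the convergence is pointwise
almost everywhere at every time. -/
lemma exists_measurable_uncurry [CompleteSpace E] [SecondCountableTopology (Lp E 1 ν)]
    {V : α → Lp E 1 ν} (hV : StronglyMeasurable V) :
    ∃ U : α → X → E, Measurable (Function.uncurry U) ∧ ∀ t, U t =ᵐ[ν] V t := by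
  classical
  let d : ℕ → Lp E 1 ν := TopologicalSpace.denseSeq (Lp E 1 ν)
  have hex : ∀ (k : ℕ) (t : α), ∃ j, dist (V t) (d j) < (1 / 2 : ℝ) ^ k := fun k t =>
    (TopologicalSpace.denseRange_denseSeq (Lp E 1 ν)).exists_dist_lt (V t) (by positivity)
  let N : ℕ → α → ℕ := fun k t => Nat.find (hex k t)
  have hN : ∀ k t, dist (V t) (d (N k t)) < (1 / 2 : ℝ) ^ k := fun k t => Nat.find_spec (hex k t)
  have hNm : ∀ k, Measurable (N k) := fun k =>
    measurable_find _ fun j => measurableSet_lt (hV.dist stronglyMeasurable_const).measurable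
      measurable_const
  let W : ℕ → α × X → E := fun k p => d (N k p.1) p.2
  have hWm : ∀ k, StronglyMeasurable (W k) := by
    intro k
    have h1 : Measurable fun q : ℕ × X => d q.1 q.2 :=
      measurable_from_prod_countable_right fun j => (Lp.stronglyMeasurable (d j)).measurable
    exact (h1.comp (((hNm k).comp measurable_fst).prodMk measurable_snd)).stronglyMeasurable
  have hlim : ∀ t, ∀ᵐ x ∂ν, Tendsto (fun k => W k (t, x)) atTop (𝓝 (V t x)) := by
    intro t
    have h1 : ∀ k, ∫⁻ x, ‖W k (t, x) - V t x‖ₑ ∂ν ≤ ENNReal.ofReal ((1 / 2 : ℝ) ^ k) := by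
      intro k
      rw [← edist_eq_lintegral_of_ae_eq (ae_eq_refl (d (N k t))) (ae_eq_refl (V t)), edist_comm,
        edist_dist]
      exact ENNReal.ofReal_le_ofReal (hN k t).le
    have hm : ∀ k, AEMeasurable (fun x => ‖W k (t, x) - V t x‖ₑ) ν := fun k =>
      ((Lp.aestronglyMeasurable (d (N k t))).sub (Lp.aestronglyMeasurable (V t))).enorm
    have h2 : ∫⁻ x, ∑' k, ‖W k (t, x) - V t x‖ₑ ∂ν ≠ ∞ := by
      rw [lintegral_tsum hm]
      refine ne_top_of_le_ne_top ?_ (ENNReal.tsum_le_tsum h1)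
      rw [← ENNReal.ofReal_tsum_of_nonneg (fun k => by positivity) summable_geometric_two]
      exact ENNReal.ofReal_ne_top
    filter_upwards [ae_lt_top' (AEMeasurable.tsum hm) h2] with x hx
    rw [tendsto_iff_edist_tendsto_0]
    simp only [edist_eq_enorm_sub]
    exact ENNReal.tendsto_atTop_zero_of_tsum_ne_top hx.ne
  refine ⟨fun t x => limUnder atTop fun k => W k (t, x),
    (StronglyMeasurable.limUnder (l := atTop) hWm).measurable, fun t => ?_⟩
  filter_upwards [hlim t] with x hx using hx.limUnder_eq

lemma measurable_of_forall_edist {Y : Type*} [MetricSpace Y] [SecondCountableTopology Y]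
    [MeasurableSpace Y] [BorelSpace Y] {f : α → Y} (h : ∀ y, Measurable fun a => edist (f a) y) :
    Measurable f := by
  refine measurable_of_isOpen fun U hU => ?_
  rcases isEmpty_or_nonempty Y with hY | hY
  · have : IsEmpty α := ⟨fun a => hY.false (f a)⟩
    rw [eq_empty_of_isEmpty (f ⁻¹' U)]; exact MeasurableSet.empty
  let d := TopologicalSpace.denseSeq Y
  have hd : ∀ y, Measurable fun a => dist (f a) y := fun y => by
    simpa only [edist_dist, ENNReal.toReal_ofReal dist_nonneg] using (h y).ennreal_toReal
  have hUeq : f ⁻¹' U = ⋃ (n : ℕ) (m : ℕ) (_ : Metric.ball (d n) (1 / ((m : ℝ) + 1)) ⊆ U),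
      {a | dist (f a) (d n) < 1 / ((m : ℝ) + 1)} := by
    ext a
    simp only [mem_preimage, mem_iUnion, mem_ofPred_eq, exists_prop]
    constructor
    · intro ha
      obtain ⟨ε, hε, hball⟩ := Metric.isOpen_iff.1 hU (f a) ha
      obtain ⟨m, hm⟩ := exists_nat_one_div_lt (half_pos hε)
      obtain ⟨n, hn⟩ := (TopologicalSpace.denseRange_denseSeq Y).exists_dist_lt (f a)
        (Nat.one_div_pos_of_nat (α := ℝ) (n := m))
      refine ⟨n, m, fun y hy => hball ?_, hn⟩
      rw [Metric.mem_ball] at hy ⊢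
      have := dist_triangle_right y (f a) (d n)
      linarith
    · rintro ⟨n, m, hsub, ha⟩
      exact hsub ha
  rw [hUeq]
  refine MeasurableSet.iUnion fun n => MeasurableSet.iUnion fun m => MeasurableSet.iUnion fun _ => ?_
  exact measurableSet_lt (hd _) measurable_const

/-- A jointly measurable function, with integrable slices, is a measurable curve in `L¹`. -/
lemma stronglyMeasurable_of_uncurry [SFinite ν] [SecondCountableTopology (Lp E 1 ν)]
    {U : α → X → E} (hU : Measurable (Function.uncurry U)) {V : α → Lp E 1 ν}
    (hV : ∀ t, V t =ᵐ[ν] U t) : StronglyMeasurable V := by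
  let : MeasurableSpace (Lp E 1 ν) := borel _
  have : BorelSpace (Lp E 1 ν) := ⟨rfl⟩
  refine (measurable_of_forall_edist fun y => ?_).stronglyMeasurable
  simp only [edist_eq_lintegral_of_ae_eq (hV _) (ae_eq_refl y)]
  have hy : Measurable y := (Lp.stronglyMeasurable y).measurable
  have : Measurable fun p : α × X => ‖Function.uncurry U p - y p.2‖ₑ := by fun_prop
  exact this.lintegral_prod_right'

end curves

/-! ### The weighted spaces -/

lemma ae_weight_iff {s : ℝ} {p : R3 → Prop} : (∀ᵐ ξ ∂weight s, p ξ) ↔ ∀ᵐ ξ, p ξ := by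
  refine ⟨fun h => ?_, fun h => (withDensity_absolutelyContinuous _ _).ae_le h⟩
  refine (withDensity_absolutelyContinuous' (by fun_prop) ?_).ae_le h
  filter_upwards [ae_ne_zero] with ξ hξ
  have := Real.rpow_pos_of_pos (norm_pos_iff.2 hξ) s
  simpa using this

lemma ae_eq_weight_iff {s : ℝ} {f g : R3 → C3} : f =ᵐ[weight s] g ↔ f =ᵐ[volume] g := ae_weight_iff

instance (s : ℝ) : SigmaFinite (weight s) := SigmaFinite.withDensity_ofReal _

/-- This provides the separability of `L¹` spaces. -/
instance : Fact ((1 : ℝ≥0∞) ≠ ∞) := ⟨ENNReal.one_ne_top⟩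

lemma lintegral_weight (s : ℝ) {G : R3 → ℝ≥0∞} (hG : AEMeasurable G volume) :
    ∫⁻ ξ, G ξ ∂weight s = wnorm s G :=
  lintegral_withDensity_eq_lintegral_mul₀ (by fun_prop) hG

lemma aestronglyMeasurable_of_Lp {s : ℝ} (V : Lp C3 1 (weight s)) :
    AEStronglyMeasurable V volume :=
  (Lp.stronglyMeasurable V).aestronglyMeasurable

lemma enorm_Lp_eq {s : ℝ} (V : Lp C3 1 (weight s)) : ‖V‖ₑ = wnorm s (fun ξ => ‖V ξ‖ₑ) := by
  rw [Lp.enorm_def, eLpNorm_one_eq_lintegral_enorm, lintegral_weight s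
    (aestronglyMeasurable_of_Lp V).enorm]

lemma memLp_weight {s : ℝ} {g : R3 → C3} (hg : Measurable g)
    (h : wnorm s (fun ξ => ‖g ξ‖ₑ) ≠ ∞) : MemLp g 1 (weight s) := by
  refine ⟨hg.aestronglyMeasurable, lt_top_iff_ne_top.2 ?_⟩
  rwa [eLpNorm_one_eq_lintegral_enorm, lintegral_weight s hg.enorm.aemeasurable]

/-! ### Duhamel's formula for distributions -/

lemma enorm_schwartz_le_weight (ψ : 𝓢(R3, ℂ)) : ∃ C : ℝ, ∀ ξ : R3, ξ ≠ 0 →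
    ‖ψ ξ‖ₑ ≤ ENNReal.ofReal C * ENNReal.ofReal (‖ξ‖ ^ (-1 : ℝ)) := by
  obtain ⟨C, hC⟩ := ψ.decay 1 0
  refine ⟨C, fun ξ hξ => ?_⟩
  have h0 : 0 < ‖ξ‖ := norm_pos_iff.2 hξ
  have h1 := hC.2 ξ
  rw [norm_iteratedFDeriv_zero, pow_one] at h1
  rw [← ENNReal.ofReal_mul hC.1.le, ← ofReal_norm, Real.rpow_neg_one]
  apply ENNReal.ofReal_le_ofReal
  rw [← div_eq_mul_inv, le_div_iff₀ h0, mul_comm]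
  exact h1

lemma lintegral_schwartz_mul_lt_top (ψ : 𝓢(R3, ℂ)) {G : R3 → ℝ≥0∞} (h : wnorm (-1) G ≠ ∞) :
    ∫⁻ ξ, ‖ψ ξ‖ₑ * G ξ < ∞ := by
  obtain ⟨C, hC⟩ := enorm_schwartz_le_weight ψ
  have h1 : ENNReal.ofReal C * wnorm (-1) G < ∞ :=
    ENNReal.mul_lt_top ENNReal.ofReal_lt_top (lt_top_iff_ne_top.2 h)
  rw [wnorm, ← lintegral_const_mul' _ _ ENNReal.ofReal_ne_top] at h1
  refine lt_of_le_of_lt (lintegral_mono_ae ?_) h1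
  filter_upwards [ae_ne_zero] with ξ hξ
  rw [← mul_assoc]
  gcongr
  exact hC ξ hξ

section pairing

variable {μ : ℝ} {g : R3 → C3} {n : ℝ → R3 → C3} {t : ℝ}

lemma integrable_duhamel_integrand (hμ : 0 ≤ μ) (hn : Measurable (Function.uncurry n))
    (hfin : ∫⁻ s in Ioc 0 t, wnorm (-1) (fun ξ => ‖n s ξ‖ₑ) ≠ ∞) (ψ : 𝓢(R3, ℂ)) :
    Integrable (Function.uncurry fun s ξ => ψ ξ • (heatSym μ (t - s) ξ : ℂ) • n s ξ)
      ((volume.restrict (Ioc 0 t)).prod volume) := by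
  have hψ : Measurable ψ := ψ.continuous.measurable
  have hm : Measurable (Function.uncurry fun s ξ => ψ ξ • (heatSym μ (t - s) ξ : ℂ) • n s ξ) := by
    have h1 : Measurable fun p : ℝ × R3 =>
        ψ p.2 • (heatSym μ (t - p.1) p.2 : ℂ) • Function.uncurry n p := by fun_prop
    exact h1
  refine ⟨hm.aestronglyMeasurable, ?_⟩
  have hne : Measurable (Function.uncurry fun s ξ => ‖n s ξ‖ₑ) := hn.enorm
  rw [wnorm_lintegral hne] at hfin
  rw [HasFiniteIntegral, lintegral_prod_symm' _ hm.enorm]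
  refine lt_of_le_of_lt (lintegral_mono fun ξ => ?_) (lintegral_schwartz_mul_lt_top ψ hfin)
  rw [← lintegral_const_mul' _ _ enorm_ne_top]
  refine setLIntegral_mono' measurableSet_Ioc fun s hs => ?_
  simp only [Function.uncurry_apply_pair, enorm_smul, enorm_heatSym]
  gcongr
  exact mul_le_of_le_one_left' (ENNReal.ofReal_le_one.2
    (heatSym_le_one hμ (sub_nonneg.2 hs.2) ξ))

/-- For a forcing term in `L¹((0, t); 𝒳⁻¹)`, Duhamel's formula tested against Schwartz functions is
equivalent to Duhamel's formula at almost every frequency. -/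
lemma duhamel_pairing (hμ : 0 ≤ μ) (ht : 0 ≤ t) {f₀ : 𝓢'(R3, C3)} (hf₀ : HasFourier f₀ g)
    {N : ℝ → 𝓢'(R3, C3)} (hN : ∀ᵐ s ∂volume.restrict (Ioc 0 t), HasFourier (N s) (n s))
    (hn : Measurable (Function.uncurry n))
    (hfin : ∫⁻ s in Ioc 0 t, wnorm (-1) (fun ξ => ‖n s ξ‖ₑ) ≠ ∞) :
    (∀ φ : 𝓢(R3, ℂ), IntervalIntegrable (fun s => heat (μ * (t - s)) (N s) φ) volume 0 t) ∧
    ∀ f : 𝓢'(R3, C3), HasFourier f (duhamel μ g n t) ↔ ∀ φ : 𝓢(R3, ℂ),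
      f φ = heat (μ * t) f₀ φ - ∫ s in (0 : ℝ)..t, heat (μ * (t - s)) (N s) φ := by
  have hint := integrable_duhamel_integrand hμ hn hfin
  have hslice : ∀ φ : 𝓢(R3, ℂ), (fun s => heat (μ * (t - s)) (N s) φ)
      =ᵐ[volume.restrict (Ioc 0 t)]
        fun s => ∫ ξ, ft φ ξ • (heatSym μ (t - s) ξ : ℂ) • n s ξ := by
    intro φ
    filter_upwards [hN, ae_restrict_mem measurableSet_Ioc] with s hs hst
    exact hasFourier_apply (hs.heat (mul_nonneg hμ (sub_nonneg.2 hst.2))) φ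
  have h0 := hf₀.heat (mul_nonneg hμ ht)
  have hi1 : ∀ ψ : 𝓢(R3, ℂ), Integrable fun ξ => ψ ξ • (heatSym μ t ξ : ℂ) • g ξ :=
    h0.integrable_smul
  have hi2 : ∀ ψ : 𝓢(R3, ℂ), Integrable fun ξ =>
      ψ ξ • ∫ s in Ioc 0 t, (heatSym μ (t - s) ξ : ℂ) • n s ξ := by
    intro ψ
    refine (hint ψ).integral_prod_right.congr (ae_of_all _ fun ξ => ?_)
    exact integral_smul (ψ ξ) fun s => (heatSym μ (t - s) ξ : ℂ) • n s ξ
  have hval : ∀ φ : 𝓢(R3, ℂ), ∫ ξ, ft φ ξ • duhamel μ g n t ξ =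
      heat (μ * t) f₀ φ - ∫ s in (0 : ℝ)..t, heat (μ * (t - s)) (N s) φ := by
    intro φ
    simp only [duhamel, smul_sub]
    rw [integral_sub (hi1 _) (hi2 _), intervalIntegral.integral_of_le ht,
      integral_congr_ae (hslice φ), integral_integral_swap (hint (ft φ)), hasFourier_apply h0]
    congr 1
    exact integral_congr_ae (ae_of_all _ fun ξ =>
      (integral_smul (ft φ ξ) fun s => (heatSym μ (t - s) ξ : ℂ) • n s ξ).symm)
  refine ⟨fun φ => ?_, fun f => ?_⟩
  · rw [intervalIntegrable_iff_integrableOn_Ioc_of_le ht]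
    exact (hint (ft φ)).integral_prod_left.congr (hslice φ).symm
  · rw [hasFourier_iff]
    refine ⟨fun h φ => by rw [h.2 φ, hval], fun h => ⟨fun ψ => ?_, fun φ => by rw [h φ, hval]⟩⟩
    simp only [duhamel, smul_sub]
    exact (hi1 ψ).sub (hi2 ψ)

/-- Duhamel's formula defines a continuous function of time at each frequency. -/
lemma continuousOn_duhamel {ξ : R3} (hn : Measurable (Function.uncurry n))
    (hfin : ∫⁻ s in Ioi 0, ‖n s ξ‖ₑ < ∞) : ContinuousOn (fun t => duhamel μ g n t ξ) (Ici 0) := by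
  have hnξ : Measurable fun s => n s ξ := hn.of_uncurry_right
  have hexp : ∀ t s, (heatSym μ (t - s) ξ : ℂ) = (heatSym μ t ξ : ℂ) * (heatSym μ (-s) ξ : ℂ) := by
    intro t s
    rw [← Complex.ofReal_mul, heatSym, heatSym, heatSym, ← Real.exp_add]
    congr 2
    ring
  have hcont : ∀ a : ℝ, Continuous fun t => (heatSym μ (a * t) ξ : ℂ) := fun a => by
    unfold heatSym; fun_prop
  have hii : ∀ a b : ℝ, IntervalIntegrable
      (fun s => (heatSym μ (-s) ξ : ℂ) • (Ioi 0).indicator (fun s => n s ξ) s) volume a b := by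
    intro a b
    have h1 : Integrable ((Ioi 0).indicator fun s => n s ξ) := by
      rw [integrable_indicator_iff measurableSet_Ioi]
      exact ⟨hnξ.aestronglyMeasurable, hfin⟩
    have := h1.intervalIntegrable (a := a) (b := b)
    have hc := hcont (-1)
    simp only [neg_mul, one_mul] at hc
    exact this.continuousOn_smul hc.continuousOn
  have hprim := intervalIntegral.continuous_primitive hii 0
  have hc := hcont 1
  simp only [one_mul] at hc
  have hform : ContinuousOn (fun t => (heatSym μ t ξ : ℂ) • g ξ - (heatSym μ t ξ : ℂ) •
      ∫ s in (0 : ℝ)..t, (heatSym μ (-s) ξ : ℂ) • (Ioi 0).indicator (fun s => n s ξ) s) (Ici 0) :=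
    ((hc.smul continuous_const).sub (hc.smul hprim)).continuousOn
  refine hform.congr fun t ht => ?_
  simp only [duhamel]
  congr 1
  rw [intervalIntegral.integral_of_le ht, ← integral_smul]
  refine setIntegral_congr_fun measurableSet_Ioc fun s hs => ?_
  simp only [indicator_of_mem (show s ∈ Ioi (0 : ℝ) from hs.1), hexp, smul_smul]

end pairing

/-! ### The nonlinear term of fields in `𝒳⁻¹ ∩ 𝒳¹` -/

lemma hasFourier_exists_of_wnorm {g : R3 → C3} (hg : Measurable g)
    (h : wnorm (-1) (fun ξ => ‖g ξ‖ₑ) ≠ ∞) : ∃ f : 𝓢'(R3, C3), HasFourier f g :=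
  exists_hasFourier (integrable_of_weighted hg.aestronglyMeasurable (.inl rfl) h)

/-- `𝒳⁻¹ ∩ 𝒳¹ ⊆ 𝒳⁰`. -/
lemma integrable_of_wnorm {g : R3 → C3} (hg : AEStronglyMeasurable g volume)
    (h : wnorm (-1) (fun ξ => ‖g ξ‖ₑ) ≠ ∞) (h' : wnorm 1 (fun ξ => ‖g ξ‖ₑ) ≠ ∞) :
    Integrable g := by
  refine ⟨hg, lt_of_le_of_lt ?_ (ENNReal.add_lt_top.2 ⟨lt_top_iff_ne_top.2 h,
    lt_top_iff_ne_top.2 h'⟩)⟩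
  have hge := hg.enorm
  rw [wnorm, wnorm, ← lintegral_add_left' (by fun_prop)]
  refine lintegral_mono_ae ?_
  filter_upwards [ae_ne_zero] with ξ hξ
  have h0 : 0 < ‖ξ‖ := norm_pos_iff.2 hξ
  rw [← add_mul, ← ENNReal.ofReal_add (by positivity) (by positivity), Real.rpow_neg_one,
    Real.rpow_one]
  refine le_mul_of_one_le_left zero_le (ENNReal.one_le_ofReal.2 ?_)
  rcases le_total 1 ‖ξ‖ with h1 | h1
  · have := inv_pos.2 h0; linarith
  · have := (one_le_inv₀ h0).2 h1; linarith

lemma leraySymbol_sum_conv_ae {g : R3 → C3} (hg : Integrable g) :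
    (fun ξ => leraySymbol ξ (∑ j, (Complex.I * (ξ j : ℂ)) • conv g j ξ)) =ᵐ[volume] nonlin g := by
  have h : ∀ j : Fin 3, ∀ᵐ ξ, Integrable fun η => g η j • g (ξ - η) := fun j =>
    (integrable_apply hg j).ae_convolution_exists (ContinuousLinearMap.lsmul ℂ ℂ) hg
  filter_upwards [ae_all_iff.2 h] with ξ hξ using leraySymbol_sum_conv hξ

/-! ### Existence -/

lemma measurable_wnorm_enorm (s : ℝ) {u : ℝ → R3 → C3} (hu : Measurable (Function.uncurry u)) :
    Measurable fun t => wnorm s (fun ξ => ‖u t ξ‖ₑ) := by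
  have : Measurable (Function.uncurry fun t ξ => ‖u t ξ‖ₑ) := hu.enorm
  exact measurable_wnorm s this

/-- The Fourier transform of a real divergence-free field has a representative with the
corresponding symmetries at every frequency. -/
lemma exists_symmetric_fourier {f : 𝓢'(R3, C3)} {s : ℝ} {c : ℝ≥0∞} (hr : IsReal f)
    (hd : IsDivFree f) (hc : XNorm s f < c) :
    ∃ g : R3 → C3, Measurable g ∧ HasFourier f g ∧ (∀ ξ k, g (-ξ) k = conj (g ξ k)) ∧
      ∀ ξ, freqPairing ξ (g ξ) = 0 := by
  obtain ⟨g₀, h₀⟩ := exists_hasFourier_of_XNorm_lt hc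
  have hmk := h₀.aestronglyMeasurable
  set g₁ := hmk.mk g₀ with hg₁
  have hm : Measurable g₁ := hmk.stronglyMeasurable_mk.measurable
  have h₁ : HasFourier f g₁ := h₀.congr_ae hmk.ae_eq_mk
  have hmk : ∀ k : Fin 3, Measurable fun ξ => g₁ ξ k := fun k => by
    have := (EuclideanSpace.proj (𝕜 := ℂ) k : C3 →L[ℂ] ℂ).continuous.measurable.comp hm
    exact this
  -- `g₁` is set to zero off the symmetric set on which it has the required properties.
  let S : Set R3 := {ξ | (∀ k, g₁ (-ξ) k = conj (g₁ ξ k)) ∧ ∑ j, (ξ j : ℂ) * g₁ ξ j = 0}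
  have hSm : MeasurableSet S := by
    refine MeasurableSet.inter ?_ ?_
    · have : ∀ k : Fin 3, MeasurableSet {ξ | g₁ (-ξ) k = conj (g₁ ξ k)} := fun k =>
        measurableSet_eq_fun ((hmk k).comp measurable_neg)
          (Complex.continuous_conj.measurable.comp (hmk k))
      have h2 := MeasurableSet.iInter this
      rwa [← ofPred_forall] at h2
    · have : Measurable fun ξ : R3 => ∑ j, (ξ j : ℂ) * g₁ ξ j :=
        Finset.measurable_sum _ fun j _ => Measurable.mul (by fun_prop) (hmk j)
      exact this (measurableSet_singleton 0)
  have hneg : ∀ ξ ∈ S, -ξ ∈ S := by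
    rintro ξ ⟨h1, h2⟩
    refine ⟨fun k => by rw [neg_neg, h1 k, Complex.conj_conj], ?_⟩
    have h3 : conj (∑ j, (ξ j : ℂ) * g₁ ξ j) = 0 := by rw [h2, map_zero]
    rw [map_sum] at h3
    simp only [map_mul, Complex.conj_ofReal] at h3
    simp only [h1, PiLp.neg_apply, Complex.ofReal_neg, neg_mul, Finset.sum_neg_distrib, h3, neg_zero]
  have hae : ∀ᵐ ξ, ξ ∈ S := (ae_all_iff.2 fun k => hr.symm_ae h₁ k).and (hd.ae h₁)
  refine ⟨S.indicator g₁, hm.indicator hSm, h₁.congr_ae ?_, fun ξ k => ?_, fun ξ => ?_⟩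
  · filter_upwards [hae] with ξ hξ using (indicator_of_mem hξ _).symm
  · by_cases hξ : ξ ∈ S
    · rw [indicator_of_mem hξ, indicator_of_mem (hneg ξ hξ), hξ.1]
    · have : -ξ ∉ S := fun h => hξ (by simpa using hneg _ h)
      rw [indicator_of_notMem hξ, indicator_of_notMem this]
      simp
  · by_cases hξ : ξ ∈ S
    · rw [indicator_of_mem hξ, freqPairing_apply, hξ.2]
    · rw [indicator_of_notMem hξ, map_zero]

section flow

variable {μ : ℝ} {g : R3 → C3}

lemma wnorm_flow_ne_top (hμ : 0 ≤ μ) (hg : Measurable g)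
    (hsmall : wnorm (-1) (fun ξ => ‖g ξ‖ₑ) < ENNReal.ofReal μ) {t : ℝ} (ht : 0 ≤ t) :
    wnorm (-1) (fun ξ => ‖flow μ g t ξ‖ₑ) ≠ ∞ :=
  ne_top_of_le_ne_top (wnorm_picardSup_ne_top hμ hg hsmall ht) (wnorm_mono _ (enorm_flow_le hg t))

lemma lintegral_wnorm_flow_ne_top (hμ : 0 ≤ μ) (hg : Measurable g)
    (hsmall : wnorm (-1) (fun ξ => ‖g ξ‖ₑ) < ENNReal.ofReal μ) :
    ∫⁻ τ in Ioi 0, wnorm 1 (fun ξ => ‖flow μ g τ ξ‖ₑ) ≠ ∞ :=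
  ne_top_of_le_ne_top (lintegral_picardSup_ne_top hμ hg hsmall)
    (lintegral_mono fun τ => wnorm_mono _ (enorm_flow_le hg τ))

lemma lintegral_nonlin_flow_ne_top (hμ : 0 ≤ μ) (hg : Measurable g)
    (hsmall : wnorm (-1) (fun ξ => ‖g ξ‖ₑ) < ENNReal.ofReal μ) :
    ∫⁻ τ in Ioi 0, wnorm (-1) (fun ξ => ‖nonlin (flow μ g τ) ξ‖ₑ) ≠ ∞ :=
  ne_top_of_le_ne_top (lintegral_nonlinMaj_picardSup_ne_top hμ hg hsmall)
    (lintegral_mono fun τ => wnorm_mono _ (enorm_nonlin_le (enorm_flow_le hg τ)))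

lemma ae_tendsto_flow (hμ : 0 ≤ μ) (hg : Measurable g)
    (hsmall : wnorm (-1) (fun ξ => ‖g ξ‖ₑ) < ENNReal.ofReal μ) {t : ℝ} (ht : 0 ≤ t) :
    ∀ᵐ ξ, Tendsto (fun n => picard μ g n t ξ) atTop (𝓝 (flow μ g t ξ)) := by
  filter_upwards [ae_lintegral_nonlinMaj_lt_top hμ hg hsmall] with ξ hξ
  exact tendsto_flow hg (picardSup_ne_top hμ hξ ht)

lemma flow_neg_ae (hμ : 0 ≤ μ) (hg : Measurable g)
    (hsmall : wnorm (-1) (fun ξ => ‖g ξ‖ₑ) < ENNReal.ofReal μ)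
    (h : ∀ ξ k, g (-ξ) k = conj (g ξ k)) {t : ℝ} (ht : 0 ≤ t) :
    ∀ᵐ ξ, ∀ k, flow μ g t (-ξ) k = conj (flow μ g t ξ k) := by
  have hae := ae_tendsto_flow hμ hg hsmall ht
  filter_upwards [hae, (Measure.measurePreserving_neg volume).quasiMeasurePreserving.ae hae]
    with ξ h1 h2 k
  let p : C3 →L[ℂ] ℂ := EuclideanSpace.proj (𝕜 := ℂ) k
  have h3 := (p.continuous.tendsto _).comp h2
  have h4 := (Complex.continuous_conj.tendsto _).comp ((p.continuous.tendsto _).comp h1)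
  refine tendsto_nhds_unique h3 (h4.congr fun n => ?_)
  exact (picard_neg hg h n t ξ k).symm

lemma freqPairing_flow_ae (hμ : 0 ≤ μ) (hg : Measurable g)
    (hsmall : wnorm (-1) (fun ξ => ‖g ξ‖ₑ) < ENNReal.ofReal μ)
    (h : ∀ ξ, freqPairing ξ (g ξ) = 0) {t : ℝ} (ht : 0 ≤ t) :
    ∀ᵐ ξ, ∑ j, (ξ j : ℂ) * flow μ g t ξ j = 0 := by
  filter_upwards [ae_tendsto_flow hμ hg hsmall ht] with ξ h1
  rw [← freqPairing_apply]
  have h3 := ((freqPairing ξ).continuous.tendsto _).comp h1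
  refine tendsto_nhds_unique h3 (tendsto_const_nhds.congr fun n => ?_)
  exact (freqPairing_picard h n t ξ).symm

lemma continuousInX_flow (hμ : 0 ≤ μ) (hg : Measurable g)
    (hsmall : wnorm (-1) (fun ξ => ‖g ξ‖ₑ) < ENNReal.ofReal μ) {v : ℝ → 𝓢'(R3, C3)}
    (hv : ∀ t, 0 ≤ t → HasFourier (v t) (flow μ g t)) : ContinuousInX (-1) v := by
  classical
  have hfm : ∀ t, Measurable (flow μ g t) := fun t => (measurable_flow hg).of_uncurry_left
  have hmem : ∀ t, 0 ≤ t → MemLp (flow μ g t) 1 (weight (-1)) := fun t ht =>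
    memLp_weight (hfm t) (wnorm_flow_ne_top hμ hg hsmall ht)
  let V : ℝ → Lp C3 1 (weight (-1)) := fun t => if ht : 0 ≤ t then (hmem t ht).toLp else 0
  have hV : ∀ t, 0 ≤ t → V t =ᵐ[weight (-1)] flow μ g t := fun t ht => by
    simp only [V, dif_pos ht]; exact (hmem t ht).coeFn_toLp
  refine ⟨V, fun t ht => ?_, fun t ht => (hv t ht).congr_ae (ae_eq_weight_iff.1 (hV t ht)).symm⟩
  -- A bound for `flow μ g t ξ` that is uniform in time and integrable against `|ξ|⁻¹`.
  let B : R3 → ℝ≥0∞ := fun ξ => ‖g ξ‖ₑ + ∫⁻ s in Ioi 0, nonlinMaj (picardSup μ g s) ξ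
  have hNm := measurable_nonlinMaj (measurable_picardSup (μ := μ) hg)
  have hBm : Measurable B := hg.enorm.add (Measurable.lintegral_prod_left' hNm)
  have hB : wnorm (-1) (fun ξ => 2 * B ξ) ≠ ∞ := by
    have h1 := lintegral_nonlinMaj_picardSup_ne_top hμ hg hsmall
    rw [wnorm_lintegral hNm] at h1
    have : wnorm (-1) (fun ξ => 2 * B ξ) = 2 * (wnorm (-1) (fun ξ => ‖g ξ‖ₑ) +
        wnorm (-1) fun ξ => ∫⁻ s in Ioi 0, nonlinMaj (picardSup μ g s) ξ) := by
      unfold wnorm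
      rw [← lintegral_add_left (by fun_prop), ← lintegral_const_mul' _ _ ENNReal.ofNat_ne_top]
      exact lintegral_congr fun ξ => by simp only [B]; ring
    rw [this]
    exact ENNReal.mul_ne_top ENNReal.ofNat_ne_top (ENNReal.add_ne_top.2 ⟨hsmall.ne_top, h1⟩)
  have hgood := ae_lintegral_nonlinMaj_lt_top hμ hg hsmall
  have hfl := flow_eq_duhamel hμ hg hsmall
  have hbound : ∀ ξ, (∀ t, 0 ≤ t → flow μ g t ξ =
      duhamel μ g (fun s => nonlin (flow μ g s)) t ξ) → ∀ t, 0 ≤ t → ‖flow μ g t ξ‖ₑ ≤ B ξ := by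
    intro ξ h t ht
    rw [h t ht]
    refine (enorm_duhamel_le (ae_of_all _ fun s =>
      enorm_nonlin_le (enorm_flow_le hg s) ξ)).trans ?_
    refine add_le_add (mul_le_of_le_one_left' (ENNReal.ofReal_le_one.2 (heatSym_le_one hμ ht ξ)))
      ((setLIntegral_mono' measurableSet_Ioc fun s hs => ?_).trans
        (lintegral_mono_set Ioc_subset_Ioi_self))
    exact mul_le_of_le_one_left' (ENNReal.ofReal_le_one.2 (heatSym_le_one hμ (sub_nonneg.2 hs.2) ξ))
  rw [ContinuousWithinAt, tendsto_iff_edist_tendsto_0]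
  have hdist : ∀ᶠ r in 𝓝[Ici 0] t, edist (V r) (V t) =
      ∫⁻ ξ, ‖flow μ g r ξ - flow μ g t ξ‖ₑ ∂weight (-1) := by
    filter_upwards [self_mem_nhdsWithin] with r hr
    exact edist_eq_lintegral_of_ae_eq (hV r hr) (hV t ht)
  refine Tendsto.congr' (EventuallyEq.symm hdist) ?_
  have h0 : ∫⁻ _ : R3, 0 ∂weight (-1) = 0 := lintegral_zero
  rw [← h0]
  refine tendsto_lintegral_filter_of_dominated_convergence (fun ξ => 2 * B ξ)
    (Eventually.of_forall fun r => ((hfm r).sub (hfm t)).enorm) ?_ ?_ ?_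
  · filter_upwards [self_mem_nhdsWithin] with r hr
    rw [ae_weight_iff]
    filter_upwards [hfl] with ξ hξ
    rw [two_mul]
    exact enorm_sub_le.trans (add_le_add (hbound ξ hξ r hr) (hbound ξ hξ t ht))
  · rwa [lintegral_weight _ (hBm.const_mul 2).aemeasurable]
  · rw [ae_weight_iff]
    filter_upwards [hfl, hgood] with ξ h1 h2
    have hc : ContinuousOn (fun t => flow μ g t ξ) (Ici 0) := by
      refine (continuousOn_duhamel (μ := μ) (g := g) (n := fun s => nonlin (flow μ g s)) (ξ := ξ)
        (measurable_nonlin (measurable_flow hg)) ?_).congr fun t ht => h1 t ht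
      exact (lintegral_mono fun s => enorm_nonlin_le (enorm_flow_le hg s) ξ).trans_lt h2
    have h3 : Tendsto (fun r => ‖flow μ g r ξ - flow μ g t ξ‖ₑ) (𝓝[Ici 0] t)
        (𝓝 ‖flow μ g t ξ - flow μ g t ξ‖ₑ) :=
      (Tendsto.sub (hc t ht) (tendsto_const_nhds (x := flow μ g t ξ))).enorm
    rwa [sub_self, enorm_zero] at h3

lemma integrableInX_flow (hμ : 0 ≤ μ) (hg : Measurable g)
    (hsmall : wnorm (-1) (fun ξ => ‖g ξ‖ₑ) < ENNReal.ofReal μ) {v : ℝ → 𝓢'(R3, C3)}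
    (hv : ∀ t, 0 ≤ t → HasFourier (v t) (flow μ g t)) : IntegrableInX 1 v := by
  classical
  have hfm : ∀ t, Measurable (flow μ g t) := fun t => (measurable_flow hg).of_uncurry_left
  have hwm : Measurable fun t => wnorm 1 (fun ξ => ‖flow μ g t ξ‖ₑ) :=
    measurable_wnorm_enorm 1 (measurable_flow hg)
  let S : Set ℝ := {t | wnorm 1 (fun ξ => ‖flow μ g t ξ‖ₑ) ≠ ∞}
  have hS : MeasurableSet S := (hwm (measurableSet_singleton ∞)).compl
  -- The null set of times at which the `𝒳¹` norm is infinite is discarded.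
  let U : ℝ → R3 → C3 := fun t => if t ∈ S then flow μ g t else 0
  have hU : Measurable (Function.uncurry U) := by
    have h1 : Measurable fun p : ℝ × R3 => if p.1 ∈ S then Function.uncurry (flow μ g) p else 0 :=
      Measurable.ite (measurable_fst hS) (measurable_flow hg) measurable_const
    convert h1 using 1
    ext1 ⟨t, ξ⟩
    by_cases h : t ∈ S <;> simp [U, h]
  have hmem : ∀ t, MemLp (U t) 1 (weight 1) := fun t => by
    by_cases h : t ∈ S
    · simp only [U, if_pos h]; exact memLp_weight (hfm t) h
    · simp only [U, if_neg h]; exact MemLp.zero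
  have hV : ∀ t, (hmem t).toLp =ᵐ[weight 1] U t := fun t => (hmem t).coeFn_toLp
  have hfin := lintegral_wnorm_flow_ne_top hμ hg hsmall
  have hae : ∀ᵐ t ∂volume.restrict (Ioi (0 : ℝ)), t ∈ S := by
    filter_upwards [ae_lt_top hwm hfin] with t ht using ht.ne
  refine ⟨fun t => (hmem t).toLp, ⟨(stronglyMeasurable_of_uncurry hU hV).aestronglyMeasurable, ?_⟩,
    ?_⟩
  · rw [HasFiniteIntegral]
    refine lt_of_le_of_lt (lintegral_mono fun t => ?_) (lt_top_iff_ne_top.2 hfin)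
    rw [Lp.enorm_toLp, eLpNorm_one_eq_lintegral_enorm,
      lintegral_weight 1 (hU.of_uncurry_left (x := t)).enorm.aemeasurable]
    refine wnorm_mono _ fun ξ => ?_
    by_cases h : t ∈ S <;> simp [U, h]
  · filter_upwards [hae, ae_restrict_mem measurableSet_Ioi] with t ht h0
    refine (hv t (le_of_lt h0)).congr_ae (ae_eq_weight_iff (s := 1).1 ?_).symm
    have := hV t
    simpa only [U, if_pos ht] using this

end flow

/-- Global existence, with the energy estimate. -/
lemma exists_global_solution {μ : ℝ} {v₀ : 𝓢'(R3, C3)} (h : IsSmallData μ v₀) :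
    ∃ v : ℝ → 𝓢'(R3, C3), IsGlobalSolution μ v₀ v ∧ ∀ t, 0 ≤ t → XNorm (-1) (v t) +
      (ENNReal.ofReal μ - XNorm (-1) v₀) * ∫⁻ τ in Ioc 0 t, gradSupNorm (v τ) ≤ XNorm (-1) v₀ := by
  obtain ⟨g, hg, hvg, hsym, hdiv⟩ := exists_symmetric_fourier h.real h.divFree h.small
  have hX : XNorm (-1) v₀ = wnorm (-1) (fun ξ => ‖g ξ‖ₑ) := XNorm_eq hvg _
  have hsmall : wnorm (-1) (fun ξ => ‖g ξ‖ₑ) < ENNReal.ofReal μ := hX ▸ h.small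
  have hμ : 0 ≤ μ := (ENNReal.ofReal_pos.1 (pos_of_gt hsmall)).le
  have hfm : ∀ t, Measurable (flow μ g t) := fun t => (measurable_flow hg).of_uncurry_left
  have hnm := measurable_nonlin (measurable_flow (μ := μ) hg)
  have hfin := lintegral_nonlin_flow_ne_top hμ hg hsmall
  have hex : ∀ t, ∃ f : 𝓢'(R3, C3), 0 ≤ t → HasFourier f (flow μ g t) := fun t => by
    by_cases ht : 0 ≤ t
    · obtain ⟨f, hf⟩ := hasFourier_exists_of_wnorm (hfm t) (wnorm_flow_ne_top hμ hg hsmall ht)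
      exact ⟨f, fun _ => hf⟩
    · exact ⟨0, fun h => absurd h ht⟩
  choose v hv using hex
  have hNex : ∀ s, ∃ f : 𝓢'(R3, C3), wnorm (-1) (fun ξ => ‖nonlin (flow μ g s) ξ‖ₑ) ≠ ∞ →
      HasFourier f (nonlin (flow μ g s)) := fun s => by
    by_cases hs : wnorm (-1) (fun ξ => ‖nonlin (flow μ g s) ξ‖ₑ) ≠ ∞
    · obtain ⟨f, hf⟩ := hasFourier_exists_of_wnorm hnm.of_uncurry_left hs
      exact ⟨f, fun _ => hf⟩
    · exact ⟨0, fun h => absurd h hs⟩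
  choose N hN using hNex
  have hNae : ∀ᵐ s ∂volume.restrict (Ioi (0 : ℝ)), HasFourier (N s) (nonlin (flow μ g s)) := by
    filter_upwards [ae_lt_top (measurable_wnorm_enorm (-1) hnm) hfin] with s hs using hN s hs.ne
  refine ⟨v, ⟨⟨fun t ht => ?_, fun t ht => ?_, N, ?_, fun t ht φ => ?_⟩,
    continuousInX_flow hμ hg hsmall hv, integrableInX_flow hμ hg hsmall hv⟩, fun t ht => ?_⟩
  · exact isReal_of_symm (hv t ht) (flow_neg_ae hμ hg hsmall hsym ht)
  · exact isDivFree_of (hv t ht) (freqPairing_flow_ae hμ hg hsmall hdiv ht)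
  · filter_upwards [ae_lt_top (measurable_wnorm_enorm 1 (measurable_flow hg))
      (lintegral_wnorm_flow_ne_top hμ hg hsmall), hNae, ae_restrict_mem measurableSet_Ioi]
      with s h1 h2 hs
    have hs' : (0 : ℝ) ≤ s := le_of_lt hs
    have hi := integrable_of_wnorm (hfm s).aestronglyMeasurable
      (wnorm_flow_ne_top hμ hg hsmall hs') h1.ne
    obtain ⟨D, hD, hDf⟩ := (hv s hs').isDivTensor hi
    exact ⟨D, hD, _, hDf, h2.congr_ae (leraySymbol_sum_conv_ae hi).symm⟩
  · obtain ⟨h1, h2⟩ := duhamel_pairing hμ ht hvg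
      (ae_restrict_of_ae_restrict_of_subset Ioc_subset_Ioi_self hNae) hnm
      (ne_top_of_le_ne_top hfin (lintegral_mono_set Ioc_subset_Ioi_self))
    refine ⟨h1 φ, (h2 (v t)).1 ((hv t ht).congr_ae ?_) φ⟩
    filter_upwards [flow_eq_duhamel hμ hg hsmall] with ξ hξ using hξ t ht
  · refine le_trans ?_ ((flow_energy hμ hg hsmall ht).trans hX.ge)
    rw [hX, XNorm_eq (hv t ht)]
    gcongr ?_ + _ * ?_
    · exact le_rfl
    · exact setLIntegral_mono' measurableSet_Ioc fun τ hτ => gradSupNorm_le (hv τ hτ.1.le)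

/-! ### The a priori bound for arbitrary solutions -/

/-- `U` is a solution of the Navier–Stokes equations on the Fourier side, in the class
`C([0, ∞); 𝒳⁻¹) ∩ L¹((0, ∞); 𝒳¹)`, where the initial data have the Fourier transform `h`. Of the
continuity in time, only that of the norm is recorded. -/
structure IsFourierSolution (μ : ℝ) (h : R3 → C3) (U : ℝ → R3 → C3) : Prop where
  measurable_data : Measurable h
  measurable : Measurable (Function.uncurry U)
  continuousOn : ContinuousOn (fun t => wnorm (-1) fun ξ => ‖U t ξ‖ₑ) (Ici 0)
  ne_top : ∀ t, 0 ≤ t → wnorm (-1) (fun ξ => ‖U t ξ‖ₑ) ≠ ∞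
  integrable : ∫⁻ t in Ioi 0, wnorm 1 (fun ξ => ‖U t ξ‖ₑ) ≠ ∞
  duhamel : ∀ t, 0 ≤ t → U t =ᵐ[volume] NavierStokes.duhamel μ h (fun s => nonlin (U s)) t

lemma wnorm_congr_ae {s : ℝ} {G G' : R3 → ℝ≥0∞} (h : G =ᵐ[volume] G') : wnorm s G = wnorm s G' :=
  lintegral_congr_ae (by filter_upwards [h] with ξ hξ; rw [hξ])

lemma wnorm_mono_ae {s : ℝ} {G G' : R3 → ℝ≥0∞} (h : ∀ᵐ ξ, G ξ ≤ G' ξ) : wnorm s G ≤ wnorm s G' :=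
  lintegral_mono_ae (by filter_upwards [h] with ξ hξ; gcongr)

lemma wnorm_nonlin_le {u : R3 → C3} (hu : Measurable u) :
    wnorm (-1) (fun ξ => ‖nonlin u ξ‖ₑ) ≤
      wnorm (-1) (fun ξ => ‖u ξ‖ₑ) * wnorm 1 (fun ξ => ‖u ξ‖ₑ) :=
  (wnorm_mono _ (enorm_nonlin_le fun _ => le_rfl)).trans (wnorm_nonlinMaj_le hu.enorm)

/-- The nonlinear term is integrable in time with values in `𝒳⁻¹`. -/
lemma lintegral_wnorm_nonlin_ne_top {U : ℝ → R3 → C3} (hU : Measurable (Function.uncurry U))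
    (hc : ContinuousOn (fun t => wnorm (-1) fun ξ => ‖U t ξ‖ₑ) (Ici 0))
    (hfin : ∀ t, 0 ≤ t → wnorm (-1) (fun ξ => ‖U t ξ‖ₑ) ≠ ∞)
    (hi : ∫⁻ t in Ioi 0, wnorm 1 (fun ξ => ‖U t ξ‖ₑ) ≠ ∞) {t : ℝ} (ht : 0 ≤ t) :
    ∫⁻ s in Ioc 0 t, wnorm (-1) (fun ξ => ‖nonlin (U s) ξ‖ₑ) ≠ ∞ := by
  obtain ⟨r, hr, hmax⟩ := isCompact_Icc.exists_isMaxOn (nonempty_Icc.2 ht)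
    (hc.mono Icc_subset_Ici_self)
  refine ne_top_of_le_ne_top (ENNReal.mul_ne_top (hfin r hr.1) hi) ?_
  rw [← lintegral_const_mul' _ _ (hfin r hr.1)]
  refine (setLIntegral_mono' measurableSet_Ioc fun s hs => ?_).trans
    (lintegral_mono_set Ioc_subset_Ioi_self)
  refine (wnorm_nonlin_le hU.of_uncurry_left).trans ?_
  gcongr
  exact hmax (Ioc_subset_Icc_self hs)

/-- A solution in the sense of distributions is a solution on the Fourier side. -/
lemma IsGlobalSolution.exists_isFourierSolution {μ : ℝ} (hμ : 0 ≤ μ) {w₀ : 𝓢'(R3, C3)}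
    {w : ℝ → 𝓢'(R3, C3)} (hw : IsGlobalSolution μ w₀ w) {h : R3 → C3} (hh : Measurable h)
    (hw₀ : HasFourier w₀ h) :
    ∃ U, IsFourierSolution μ h U ∧ ∀ t, 0 ≤ t → HasFourier (w t) (U t) := by
  obtain ⟨V, hVc, hV⟩ := hw.continuous
  obtain ⟨V₁, hV₁i, hV₁⟩ := hw.integrable
  -- `V` is arbitrary at negative times, and is replaced by its constant extension.
  have hc : Continuous fun t => V (max t 0) :=
    hVc.comp_continuous (by fun_prop) fun t => mem_Ici.2 (le_max_right _ _)
  obtain ⟨U, hUm, hU⟩ := exists_measurable_uncurry hc.stronglyMeasurable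
  have hUV : ∀ t, 0 ≤ t → U t =ᵐ[volume] V t := fun t ht => by
    have := ae_eq_weight_iff.1 (hU t)
    rwa [max_eq_left ht] at this
  have hwU : ∀ t, 0 ≤ t → HasFourier (w t) (U t) := fun t ht =>
    (hV t ht).congr_ae (hUV t ht).symm
  have hnorm : ∀ t, 0 ≤ t → wnorm (-1) (fun ξ => ‖U t ξ‖ₑ) = ‖V t‖ₑ := fun t ht => by
    rw [enorm_Lp_eq]
    exact wnorm_congr_ae (by filter_upwards [hUV t ht] with ξ hξ; rw [hξ])
  have hcont : ContinuousOn (fun t => wnorm (-1) fun ξ => ‖U t ξ‖ₑ) (Ici 0) :=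
    (continuous_enorm.comp_continuousOn hVc).congr fun t ht => hnorm t ht
  have hfin : ∀ t, 0 ≤ t → wnorm (-1) (fun ξ => ‖U t ξ‖ₑ) ≠ ∞ := fun t ht => by
    rw [hnorm t ht]; exact enorm_ne_top
  have hint : ∫⁻ t in Ioi 0, wnorm 1 (fun ξ => ‖U t ξ‖ₑ) ≠ ∞ := by
    have h1 : ∫⁻ t in Ioi 0, wnorm 1 (fun ξ => ‖U t ξ‖ₑ) = ∫⁻ t in Ioi 0, ‖V₁ t‖ₑ := by
      refine lintegral_congr_ae ?_
      filter_upwards [hV₁, ae_restrict_mem measurableSet_Ioi] with t ht h0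
      rw [enorm_Lp_eq]
      refine wnorm_congr_ae ?_
      filter_upwards [(hwU t (le_of_lt h0)).ae_eq ht] with ξ hξ
      rw [hξ]
    rw [h1]
    exact hV₁i.2.ne
  refine ⟨U, ⟨hh, hUm, hcont, hfin, hint, fun t ht => ?_⟩, hwU⟩
  obtain ⟨N, hN, hduh⟩ := hw.mild.duhamel
  have hNf : ∀ᵐ s ∂volume.restrict (Ioi (0 : ℝ)), HasFourier (N s) (nonlin (U s)) := by
    filter_upwards [hN, ae_lt_top (measurable_wnorm_enorm 1 hUm) hint,
      ae_restrict_mem measurableSet_Ioi] with s hs h1 h0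
    obtain ⟨D, hD, d, hDd, hNd⟩ := hs
    have hi := integrable_of_wnorm (hUm.of_uncurry_left (x := s)).aestronglyMeasurable
      (hfin s (le_of_lt h0)) h1.ne
    have hd := hDd.ae_eq (hD.hasFourier (hwU s (le_of_lt h0)) hi)
    refine hNd.congr_ae ?_
    filter_upwards [hd, leraySymbol_sum_conv_ae hi] with ξ h2 h3
    rw [h2, ← h3]
  refine (hwU t ht).ae_eq (((duhamel_pairing hμ ht hw₀
    (ae_restrict_of_ae_restrict_of_subset Ioc_subset_Ioi_self hNf) (measurable_nonlin hUm)
    (lintegral_wnorm_nonlin_ne_top hUm hcont hfin hint ht)).2 (w t)).2 fun φ => (hduh t ht φ).2)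

namespace IsFourierSolution

variable {μ : ℝ} {h : R3 → C3} {U : ℝ → R3 → C3}

lemma lintegral_Ioc_ne_top (hU : IsFourierSolution μ h U) (t : ℝ) :
    ∫⁻ s in Ioc 0 t, wnorm 1 (fun ξ => ‖U s ξ‖ₑ) ≠ ∞ :=
  ne_top_of_le_ne_top hU.integrable (lintegral_mono_set Ioc_subset_Ioi_self)

/-- The energy inequality. -/
lemma energy (hμ : 0 ≤ μ) (hU : IsFourierSolution μ h U) {t : ℝ} (ht : 0 ≤ t) :
    wnorm (-1) (fun ξ => ‖U t ξ‖ₑ) +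
      ENNReal.ofReal μ * ∫⁻ s in Ioc 0 t, wnorm 1 (fun ξ => ‖U s ξ‖ₑ) ≤
    wnorm (-1) (fun ξ => ‖h ξ‖ₑ) + ∫⁻ s in Ioc 0 t,
      wnorm (-1) (fun ξ => ‖U s ξ‖ₑ) * wnorm 1 (fun ξ => ‖U s ξ‖ₑ) := by
  have hF : Measurable (Function.uncurry fun s ξ => ‖nonlin (U s) ξ‖ₑ) :=
    (measurable_nonlin hU.measurable).enorm
  have hle : ∀ r τ, 0 ≤ τ → wnorm r (fun ξ => ‖U τ ξ‖ₑ) ≤ wnorm r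
      (duhamelMaj μ (fun ξ => ‖h ξ‖ₑ) (fun s ξ => ‖nonlin (U s) ξ‖ₑ) τ) := fun r τ hτ => by
    refine wnorm_mono_ae ?_
    filter_upwards [hU.duhamel τ hτ] with ξ hξ
    rw [hξ]
    exact enorm_duhamel_le (ae_of_all _ fun s => le_rfl)
  refine le_trans (add_le_add (hle _ t ht) ?_)
    ((wnorm_duhamelMaj_add_le hμ hU.measurable_data.enorm hF ht).trans (add_le_add le_rfl ?_))
  · gcongr ?_ * ?_
    · exact le_rfl
    · exact setLIntegral_mono' measurableSet_Ioc fun τ hτ => hle _ τ hτ.1.le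
  · exact lintegral_mono fun s => wnorm_nonlin_le hU.measurable.of_uncurry_left

/-- By continuity, the `𝒳⁻¹` norm stays below the viscosity: at the first time at which it reached
`μ`, the dissipation would still dominate the nonlinear term. -/
lemma wnorm_lt (hμ : 0 ≤ μ) (hU : IsFourierSolution μ h U)
    (hsmall : wnorm (-1) (fun ξ => ‖h ξ‖ₑ) < ENNReal.ofReal μ) {t : ℝ} (ht : 0 ≤ t) :
    wnorm (-1) (fun ξ => ‖U t ξ‖ₑ) < ENNReal.ofReal μ := by
  by_contra! hcon
  set A : ℝ → ℝ≥0∞ := fun t => wnorm (-1) fun ξ => ‖U t ξ‖ₑ with hA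
  have hcl : IsClosed (Icc 0 t ∩ A ⁻¹' Ici (ENNReal.ofReal μ)) :=
    (hU.continuousOn.mono Icc_subset_Ici_self).preimage_isClosed_of_isClosed isClosed_Icc
      isClosed_Ici
  obtain ⟨r, ⟨hr, hrA⟩, hleast⟩ :=
    (isCompact_Icc.of_isClosed_subset hcl inter_subset_left).exists_isLeast
      ⟨t, right_mem_Icc.2 ht, hcon⟩
  have hlt : ∀ s ∈ Ioo 0 r, A s ≤ ENNReal.ofReal μ := fun s hs => by
    by_contra! h1
    exact absurd (hleast ⟨⟨hs.1.le, hs.2.le.trans hr.2⟩, h1.le⟩) (not_le.2 hs.2)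
  have hen := hU.energy hμ hr.1
  have h2 : ∫⁻ s in Ioc 0 r, wnorm (-1) (fun ξ => ‖U s ξ‖ₑ) * wnorm 1 (fun ξ => ‖U s ξ‖ₑ) ≤
      ENNReal.ofReal μ * ∫⁻ s in Ioc 0 r, wnorm 1 (fun ξ => ‖U s ξ‖ₑ) := by
    -- The bound `A ≤ μ` is not available at the endpoint `r`, which is a null set.
    rw [← lintegral_const_mul' _ _ ENNReal.ofReal_ne_top, setLIntegral_congr Ioo_ae_eq_Ioc.symm,
      setLIntegral_congr (Ioo_ae_eq_Ioc (a := (0 : ℝ)) (b := r)).symm]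
    refine setLIntegral_mono' measurableSet_Ioo fun s hs => ?_
    gcongr
    exact hlt s hs
  have h3 := (ENNReal.add_le_add_iff_right
    (ENNReal.mul_ne_top ENNReal.ofReal_ne_top (hU.lintegral_Ioc_ne_top r))).1
      (hen.trans (add_le_add le_rfl h2))
  exact absurd ((show ENNReal.ofReal μ ≤ A r from hrA).trans h3) (not_le.2 hsmall)

lemma wnorm_le (hμ : 0 ≤ μ) (hU : IsFourierSolution μ h U)
    (hsmall : wnorm (-1) (fun ξ => ‖h ξ‖ₑ) < ENNReal.ofReal μ) {t : ℝ} (ht : 0 ≤ t) :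
    wnorm (-1) (fun ξ => ‖U t ξ‖ₑ) ≤ wnorm (-1) (fun ξ => ‖h ξ‖ₑ) := by
  have h2 : ∫⁻ s in Ioc 0 t, wnorm (-1) (fun ξ => ‖U s ξ‖ₑ) * wnorm 1 (fun ξ => ‖U s ξ‖ₑ) ≤
      ENNReal.ofReal μ * ∫⁻ s in Ioc 0 t, wnorm 1 (fun ξ => ‖U s ξ‖ₑ) := by
    rw [← lintegral_const_mul' _ _ ENNReal.ofReal_ne_top]
    refine setLIntegral_mono' measurableSet_Ioc fun s hs => ?_
    gcongr
    exact (hU.wnorm_lt hμ hsmall hs.1.le).le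
  exact (ENNReal.add_le_add_iff_right
    (ENNReal.mul_ne_top ENNReal.ofReal_ne_top (hU.lintegral_Ioc_ne_top t))).1
      ((hU.energy hμ ht).trans (add_le_add le_rfl h2))

lemma lintegral_le (hμ : 0 ≤ μ) (hU : IsFourierSolution μ h U)
    (hsmall : wnorm (-1) (fun ξ => ‖h ξ‖ₑ) < ENNReal.ofReal μ) :
    ∫⁻ s in Ioi 0, wnorm 1 (fun ξ => ‖U s ξ‖ₑ) ≤ wnorm (-1) (fun ξ => ‖h ξ‖ₑ) /
      (ENNReal.ofReal μ - wnorm (-1) (fun ξ => ‖h ξ‖ₑ)) := by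
  set A := wnorm (-1) (fun ξ => ‖h ξ‖ₑ) with hA
  refine lintegral_Ioi_le_of_forall fun t ht => ?_
  rw [ENNReal.le_div_iff_mul_le (.inl (tsub_pos_of_lt hsmall).ne') (.inr hsmall.ne_top), mul_comm]
  refine le_add_self.trans (absorb hsmall.le hsmall.ne_top (hU.lintegral_Ioc_ne_top t)
    ((hU.energy hμ ht).trans (add_le_add le_rfl ?_)))
  rw [← lintegral_const_mul' _ _ hsmall.ne_top]
  refine setLIntegral_mono' measurableSet_Ioc fun s hs => ?_
  gcongr
  exact hU.wnorm_le hμ hsmall hs.1.le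

end IsFourierSolution

/-! ### A Gronwall inequality -/

lemma exists_lintegral_Ioc_eq {κ : ℝ → ℝ≥0∞} (hκ : Measurable κ) {t : ℝ} (ht : 0 ≤ t)
    (hfin : ∫⁻ s in Ioc 0 t, κ s ≠ ∞) {c : ℝ≥0∞} (hc : c ≤ ∫⁻ s in Ioc 0 t, κ s) :
    ∃ r ∈ Icc 0 t, ∫⁻ s in Ioc 0 r, κ s = c := by
  have hfin' : ∀ r ∈ Icc 0 t, ∫⁻ s in Ioc 0 r, κ s ≠ ∞ := fun r hr =>
    ne_top_of_le_ne_top hfin (lintegral_mono_set (Ioc_subset_Ioc_right hr.2))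
  have hK : ∀ r ∈ Icc 0 t, ∫ s in Ioc 0 r, (κ s).toReal = (∫⁻ s in Ioc 0 r, κ s).toReal :=
    fun r hr => integral_toReal hκ.aemeasurable (ae_lt_top hκ (hfin' r hr))
  have hint : IntegrableOn (fun s => (κ s).toReal) (Icc 0 t) := by
    rw [integrableOn_Icc_iff_integrableOn_Ioc]
    exact integrable_toReal_of_lintegral_ne_top hκ.aemeasurable hfin
  have hcont := intervalIntegral.continuousOn_primitive hint
  have hmem : c.toReal ∈ Icc (∫ s in Ioc (0 : ℝ) 0, (κ s).toReal) (∫ s in Ioc 0 t, (κ s).toReal) := by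
    refine ⟨by simp, ?_⟩
    rw [hK t (right_mem_Icc.2 ht)]
    exact ENNReal.toReal_mono hfin hc
  obtain ⟨r, hr, hreq⟩ := intermediate_value_Icc ht hcont hmem
  refine ⟨r, hr, ?_⟩
  simp only [hK r hr] at hreq
  exact (ENNReal.toReal_eq_toReal_iff' (hfin' r hr) (ne_top_of_le_ne_top hfin hc)).1 hreq

/-- A Gronwall inequality for functions that are merely integrable: on a time interval on which the
integral of `κ` is at most `1 / 2`, the bound doubles. -/
lemma gronwall {Z κ : ℝ → ℝ≥0∞} {z₀ : ℝ≥0∞} (hκ : Measurable κ) (hz₀ : z₀ ≠ ∞)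
    (hfin : ∀ t, 0 ≤ t → ∫⁻ s in Ioc 0 t, κ s ≠ ∞)
    (hfin' : ∀ t, 0 ≤ t → ∫⁻ s in Ioc 0 t, Z s * κ s ≠ ∞)
    (hZ : ∀ t, 0 ≤ t → Z t ≤ z₀ + ∫⁻ s in Ioc 0 t, Z s * κ s) (n : ℕ) {t : ℝ} (ht : 0 ≤ t)
    (hn : 2 * ∫⁻ s in Ioc 0 t, κ s ≤ n) :
    z₀ + ∫⁻ s in Ioc 0 t, Z s * κ s ≤ 2 ^ n * z₀ := by
  induction n generalizing t with
  | zero =>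
    have h0 : ∫⁻ s in Ioc 0 t, κ s = 0 := by simpa using hn
    rw [lintegral_eq_zero_iff hκ] at h0
    have : ∫⁻ s in Ioc 0 t, Z s * κ s = 0 := by
      rw [← lintegral_zero (μ := volume.restrict (Ioc 0 t))]
      refine lintegral_congr_ae ?_
      filter_upwards [h0] with s hs
      rw [hs, Pi.zero_apply, mul_zero]
    simp [this]
  | succ n ih =>
    have hstep : 2 ^ n * z₀ ≤ 2 ^ (n + 1) * z₀ := by
      gcongr
      · exact one_le_two
      · exact n.le_succ
    by_cases hle : 2 * ∫⁻ s in Ioc 0 t, κ s ≤ n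
    · exact (ih ht hle).trans hstep
    have h2 : (2 : ℝ≥0∞) ≠ 0 := two_ne_zero
    have h2' : (2 : ℝ≥0∞) ≠ ∞ := ENNReal.ofNat_ne_top
    -- The interval is split at the time `r` where the integral of `κ` equals `n / 2`.
    obtain ⟨r, hr, hreq⟩ := exists_lintegral_Ioc_eq hκ ht (hfin t ht) (c := n / 2) (by
      rw [ENNReal.div_le_iff h2 h2', mul_comm]; exact (not_le.1 hle).le)
    have hr' : 2 * ∫⁻ s in Ioc 0 r, κ s = n := by rw [hreq, ENNReal.mul_div_cancel h2 h2']
    have hsplit : ∀ f : ℝ → ℝ≥0∞, ∫⁻ s in Ioc 0 t, f s =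
        (∫⁻ s in Ioc 0 r, f s) + ∫⁻ s in Ioc r t, f s := fun f => by
      rw [← Ioc_union_Ioc_eq_Ioc hr.1 hr.2,
        lintegral_union measurableSet_Ioc (Ioc_disjoint_Ioc_of_le le_rfl)]
    have hlast : 2 * ∫⁻ s in Ioc r t, κ s ≤ 1 := by
      rw [hsplit, mul_add, hr', Nat.cast_add, Nat.cast_one] at hn
      exact (ENNReal.add_le_add_iff_left (ENNReal.natCast_ne_top n)).1 hn
    set H := z₀ + ∫⁻ s in Ioc 0 t, Z s * κ s with hH
    have hHfin : H ≠ ∞ := ENNReal.add_ne_top.2 ⟨hz₀, hfin' t ht⟩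
    have htail : ∫⁻ s in Ioc r t, Z s * κ s ≤ H * ∫⁻ s in Ioc r t, κ s := by
      rw [← lintegral_const_mul' _ _ hHfin]
      refine setLIntegral_mono' measurableSet_Ioc fun s hs => ?_
      gcongr
      refine (hZ s (hr.1.trans hs.1.le)).trans ?_
      rw [hH]
      gcongr
      exact hs.2
    have hdouble : 2 * H ≤ 2 ^ (n + 1) * z₀ + H := by
      calc 2 * H = 2 * (z₀ + ∫⁻ s in Ioc 0 r, Z s * κ s) + 2 * ∫⁻ s in Ioc r t, Z s * κ s := by
            rw [hH, hsplit]; ring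
        _ ≤ 2 * (2 ^ n * z₀) + 2 * (H * ∫⁻ s in Ioc r t, κ s) := by
            gcongr
            exact ih hr.1 hr'.le
        _ = 2 ^ (n + 1) * z₀ + H * (2 * ∫⁻ s in Ioc r t, κ s) := by ring
        _ ≤ 2 ^ (n + 1) * z₀ + H * 1 := by gcongr
        _ = _ := by rw [mul_one]
    rw [two_mul] at hdouble
    exact (ENNReal.add_le_add_iff_right hHfin).1 hdouble

/-! ### Stability -/

lemma enorm_nonlin_sub_le {u w : R3 → C3} (hu : Measurable u) (hw : Measurable w) {ξ : R3}
    (h1 : nonlinMaj (fun η => ‖u η‖ₑ) ξ ≠ ∞) (h2 : nonlinMaj (fun η => ‖w η‖ₑ) ξ ≠ ∞) :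
    ‖nonlin u ξ - nonlin w ξ‖ₑ ≤ (∫⁻ η, ‖ξ‖ₑ * (‖u η - w η‖ₑ * ‖u (ξ - η)‖ₑ)) +
      ∫⁻ η, ‖ξ‖ₑ * (‖w η‖ₑ * ‖u (ξ - η) - w (ξ - η)‖ₑ) := by
  have hi : ∀ {v : R3 → C3}, Measurable v → nonlinMaj (fun η => ‖v η‖ₑ) ξ ≠ ∞ →
      Integrable fun η => bilin ξ (v η) (v (ξ - η)) := fun hv hfin =>
    ⟨(measurable_bilin_slice hv hv ξ).aestronglyMeasurable,
      (lintegral_mono fun η => enorm_bilin_le _ _ _).trans_lt (lt_top_iff_ne_top.2 hfin)⟩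
  rw [nonlin, nonlin, ← integral_sub (hi hu h1) (hi hw h2), ← lintegral_add_left (by fun_prop)]
  refine (enorm_integral_le_lintegral_enorm _).trans (lintegral_mono fun η => ?_)
  rw [bilin_sub]
  exact (enorm_add_le _ _).trans (add_le_add (enorm_bilin_le _ _ _) (enorm_bilin_le _ _ _))

/-- The nonlinear term is locally Lipschitz. The factor `M` in front of the `𝒳¹` norm of the difference
is what the dissipation can absorb when `M < μ`. -/
lemma two_mul_wnorm_nonlin_sub_le {u w : R3 → C3} (hu : Measurable u) (hw : Measurable w)
    {M : ℝ≥0∞} (hM : M ≠ ∞) (huM : wnorm (-1) (fun ξ => ‖u ξ‖ₑ) ≤ M)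
    (hwM : wnorm (-1) (fun ξ => ‖w ξ‖ₑ) ≤ M) (hu1 : wnorm 1 (fun ξ => ‖u ξ‖ₑ) ≠ ∞)
    (hw1 : wnorm 1 (fun ξ => ‖w ξ‖ₑ) ≠ ∞) :
    2 * wnorm (-1) (fun ξ => ‖nonlin u ξ - nonlin w ξ‖ₑ) ≤
      2 * (M * wnorm 1 (fun ξ => ‖u ξ - w ξ‖ₑ)) + wnorm (-1) (fun ξ => ‖u ξ - w ξ‖ₑ) *
        (wnorm 1 (fun ξ => ‖u ξ‖ₑ) + wnorm 1 (fun ξ => ‖w ξ‖ₑ)) := by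
  have hfin : ∀ {v : R3 → C3}, Measurable v → wnorm (-1) (fun ξ => ‖v ξ‖ₑ) ≤ M →
      wnorm 1 (fun ξ => ‖v ξ‖ₑ) ≠ ∞ → ∀ᵐ ξ, nonlinMaj (fun η => ‖v η‖ₑ) ξ < ∞ := by
    intro v hv h1 h2
    have hm : Measurable (Function.uncurry fun (_ : ℝ) ξ => ‖v ξ‖ₑ) := hv.enorm.comp measurable_snd
    exact ae_lt_top_of_wnorm_ne_top ((measurable_nonlinMaj hm).of_uncurry_left (x := 0))
      (ne_top_of_le_ne_top (ENNReal.mul_ne_top (ne_top_of_le_ne_top hM h1) h2)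
        (wnorm_nonlinMaj_le hv.enorm))
  have hz : Measurable fun ξ => ‖u ξ - w ξ‖ₑ := (hu.sub hw).enorm
  have h1 : wnorm (-1) (fun ξ => ‖nonlin u ξ - nonlin w ξ‖ₑ) ≤
      (∫⁻ ξ, ‖u ξ - w ξ‖ₑ) * (∫⁻ ξ, ‖u ξ‖ₑ) + (∫⁻ ξ, ‖w ξ‖ₑ) * ∫⁻ ξ, ‖u ξ - w ξ‖ₑ := by
    refine le_trans ?_ (add_le_add (wnorm_neg_one_conv_le hz hu.enorm)
      (wnorm_neg_one_conv_le hw.enorm hz))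
    have hm : Measurable fun ξ => ∫⁻ η, ‖ξ‖ₑ * (‖u η - w η‖ₑ * ‖u (ξ - η)‖ₑ) := by
      have : Measurable fun p : R3 × R3 => ‖p.1‖ₑ * (‖u p.2 - w p.2‖ₑ * ‖u (p.1 - p.2)‖ₑ) := by
        fun_prop
      exact this.lintegral_prod_right'
    unfold wnorm
    rw [← lintegral_add_left (by fun_prop)]
    refine lintegral_mono_ae ?_
    filter_upwards [hfin hu huM hu1, hfin hw hwM hw1] with ξ h1 h2
    rw [← mul_add]
    gcongr
    exact enorm_nonlin_sub_le hu hw h1.ne h2.ne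
  calc 2 * wnorm (-1) (fun ξ => ‖nonlin u ξ - nonlin w ξ‖ₑ)
      ≤ 2 * ((∫⁻ ξ, ‖u ξ - w ξ‖ₑ) * (∫⁻ ξ, ‖u ξ‖ₑ)) +
          2 * ((∫⁻ ξ, ‖w ξ‖ₑ) * ∫⁻ ξ, ‖u ξ - w ξ‖ₑ) := by rw [← mul_add]; gcongr
    _ ≤ _ := add_le_add (two_mul_lintegral_mul_le hz hu.enorm)
          (two_mul_lintegral_mul_le hw.enorm hz)
    _ ≤ (wnorm (-1) (fun ξ => ‖u ξ - w ξ‖ₑ) * wnorm 1 (fun ξ => ‖u ξ‖ₑ) +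
          wnorm 1 (fun ξ => ‖u ξ - w ξ‖ₑ) * M) +
        (M * wnorm 1 (fun ξ => ‖u ξ - w ξ‖ₑ) +
          wnorm 1 (fun ξ => ‖w ξ‖ₑ) * wnorm (-1) (fun ξ => ‖u ξ - w ξ‖ₑ)) := by gcongr
    _ = _ := by ring

lemma duhamel_sub {μ : ℝ} {h k : R3 → C3} {n m : ℝ → R3 → C3} {t : ℝ} {ξ : R3} (hμ : 0 ≤ μ)
    (hn : Measurable (Function.uncurry n)) (hm : Measurable (Function.uncurry m))
    (hni : ∫⁻ s in Ioc 0 t, ‖n s ξ‖ₑ < ∞) (hmi : ∫⁻ s in Ioc 0 t, ‖m s ξ‖ₑ < ∞) :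
    duhamel μ h n t ξ - duhamel μ k m t ξ =
      duhamel μ (fun ξ => h ξ - k ξ) (fun s ξ => n s ξ - m s ξ) t ξ := by
  have hi : ∀ {p : ℝ → R3 → C3}, Measurable (Function.uncurry p) →
      ∫⁻ s in Ioc 0 t, ‖p s ξ‖ₑ < ∞ →
      IntegrableOn (fun s => (heatSym μ (t - s) ξ : ℂ) • p s ξ) (Ioc 0 t) := by
    intro p hp hfin
    have hpξ : Measurable fun s => p s ξ := hp.of_uncurry_right
    refine ⟨Measurable.aestronglyMeasurable (by fun_prop),
      (setLIntegral_mono' measurableSet_Ioc fun s hs => ?_).trans_lt hfin⟩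
    rw [enorm_smul, enorm_heatSym]
    exact mul_le_of_le_one_left' (ENNReal.ofReal_le_one.2 (heatSym_le_one hμ (sub_nonneg.2 hs.2) ξ))
  simp only [duhamel, smul_sub]
  rw [integral_sub (hi hn hni) (hi hm hmi)]
  abel

namespace IsFourierSolution

variable {μ : ℝ} {h k : R3 → C3} {U W : ℝ → R3 → C3}

lemma ae_lintegral_nonlin_lt_top (hU : IsFourierSolution μ h U) {t : ℝ} (ht : 0 ≤ t) :
    ∀ᵐ ξ, ∫⁻ s in Ioc 0 t, ‖nonlin (U s) ξ‖ₑ < ∞ := by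
  have hm : Measurable (Function.uncurry fun s ξ => ‖nonlin (U s) ξ‖ₑ) :=
    (measurable_nonlin hU.measurable).enorm
  have := lintegral_wnorm_nonlin_ne_top hU.measurable hU.continuousOn hU.ne_top hU.integrable ht
  rw [wnorm_lintegral hm] at this
  exact ae_lt_top_of_wnorm_ne_top (Measurable.lintegral_prod_left' hm) this

/-- The energy inequality for the difference of two solutions. -/
lemma energy_sub (hμ : 0 ≤ μ) (hU : IsFourierSolution μ h U) (hW : IsFourierSolution μ k W)
    {t : ℝ} (ht : 0 ≤ t) :
    wnorm (-1) (fun ξ => ‖U t ξ - W t ξ‖ₑ) +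
      ENNReal.ofReal μ * ∫⁻ s in Ioc 0 t, wnorm 1 (fun ξ => ‖U s ξ - W s ξ‖ₑ) ≤
    wnorm (-1) (fun ξ => ‖h ξ - k ξ‖ₑ) +
      ∫⁻ s in Ioc 0 t, wnorm (-1) (fun ξ => ‖nonlin (U s) ξ - nonlin (W s) ξ‖ₑ) := by
  have hnU := measurable_nonlin hU.measurable
  have hnW := measurable_nonlin hW.measurable
  have hF : Measurable (Function.uncurry fun s ξ => ‖nonlin (U s) ξ - nonlin (W s) ξ‖ₑ) :=
    (hnU.sub hnW).enorm
  have hle : ∀ r τ, 0 ≤ τ → wnorm r (fun ξ => ‖U τ ξ - W τ ξ‖ₑ) ≤ wnorm r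
      (duhamelMaj μ (fun ξ => ‖h ξ - k ξ‖ₑ)
        (fun s ξ => ‖nonlin (U s) ξ - nonlin (W s) ξ‖ₑ) τ) := fun r τ hτ => by
    refine wnorm_mono_ae ?_
    filter_upwards [hU.duhamel τ hτ, hW.duhamel τ hτ, hU.ae_lintegral_nonlin_lt_top hτ,
      hW.ae_lintegral_nonlin_lt_top hτ] with ξ h1 h2 h3 h4
    rw [h1, h2, duhamel_sub hμ hnU hnW h3 h4]
    exact enorm_duhamel_le (ae_of_all _ fun s => le_rfl)
  refine le_trans (add_le_add (hle _ t ht) ?_) (wnorm_duhamelMaj_add_le hμ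
    (hU.measurable_data.sub hW.measurable_data).enorm hF ht)
  gcongr ?_ * ?_
  · exact le_rfl
  · exact setLIntegral_mono' measurableSet_Ioc fun τ hτ => hle _ τ hτ.1.le

end IsFourierSolution

/-- Solutions with data of norm at most `M < μ` depend on the data in a Lipschitz way, with a
constant that depends only on `M` and `μ`. -/
lemma exists_lipschitz_const {μ : ℝ} {M : ℝ≥0∞} (hM : M < ENNReal.ofReal μ) :
    ∃ C : ℝ≥0∞, C ≠ 0 ∧ C ≠ ∞ ∧ ∀ (h k : R3 → C3) (U W : ℝ → R3 → C3), IsFourierSolution μ h U →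
      IsFourierSolution μ k W → wnorm (-1) (fun ξ => ‖h ξ‖ₑ) ≤ M →
      wnorm (-1) (fun ξ => ‖k ξ‖ₑ) ≤ M → ∀ t, 0 ≤ t →
        wnorm (-1) (fun ξ => ‖U t ξ - W t ξ‖ₑ) + (ENNReal.ofReal μ - M) *
          ∫⁻ s in Ioc 0 t, wnorm 1 (fun ξ => ‖U s ξ - W s ξ‖ₑ) ≤
        C * wnorm (-1) (fun ξ => ‖h ξ - k ξ‖ₑ) := by
  have hμ : 0 ≤ μ := (ENNReal.ofReal_pos.1 (pos_of_gt hM)).le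
  have hpos : ENNReal.ofReal μ - M ≠ 0 := (tsub_pos_of_lt hM).ne'
  have hMtop : M ≠ ∞ := hM.ne_top
  -- Twice the integral of `κ` below is at most `2 M / (μ - M)`, by the a priori bounds.
  obtain ⟨n, hn⟩ := ENNReal.exists_nat_gt
    (ENNReal.mul_ne_top ENNReal.ofNat_ne_top (ENNReal.div_ne_top hMtop hpos) :
      2 * (M / (ENNReal.ofReal μ - M)) ≠ ∞)
  refine ⟨2 ^ n, pow_ne_zero _ two_ne_zero, ENNReal.pow_ne_top ENNReal.ofNat_ne_top,
    fun h k U W hU hW hhM hkM => ?_⟩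
  set Z : ℝ → ℝ≥0∞ := fun t => wnorm (-1) (fun ξ => ‖U t ξ - W t ξ‖ₑ) with hZdef
  set Z₁ : ℝ → ℝ≥0∞ := fun t => wnorm 1 (fun ξ => ‖U t ξ - W t ξ‖ₑ) with hZ₁def
  set κ : ℝ → ℝ≥0∞ := fun t =>
    (wnorm 1 (fun ξ => ‖U t ξ‖ₑ) + wnorm 1 (fun ξ => ‖W t ξ‖ₑ)) / 2 with hκdef
  set z₀ := wnorm (-1) (fun ξ => ‖h ξ - k ξ‖ₑ) with hz₀def
  have hUm := measurable_wnorm_enorm 1 hU.measurable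
  have hWm := measurable_wnorm_enorm 1 hW.measurable
  have hκ : Measurable κ := (hUm.add hWm).div_const 2
  have hUM : ∀ t, 0 ≤ t → wnorm (-1) (fun ξ => ‖U t ξ‖ₑ) ≤ M := fun t ht =>
    (hU.wnorm_le hμ (hhM.trans_lt hM) ht).trans hhM
  have hWM : ∀ t, 0 ≤ t → wnorm (-1) (fun ξ => ‖W t ξ‖ₑ) ≤ M := fun t ht =>
    (hW.wnorm_le hμ (hkM.trans_lt hM) ht).trans hkM
  have hU1 : ∫⁻ s in Ioi 0, wnorm 1 (fun ξ => ‖U s ξ‖ₑ) ≤ M / (ENNReal.ofReal μ - M) :=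
    (hU.lintegral_le hμ (hhM.trans_lt hM)).trans (ENNReal.div_le_div hhM (tsub_le_tsub_left hhM _))
  have hW1 : ∫⁻ s in Ioi 0, wnorm 1 (fun ξ => ‖W s ξ‖ₑ) ≤ M / (ENNReal.ofReal μ - M) :=
    (hW.lintegral_le hμ (hkM.trans_lt hM)).trans (ENNReal.div_le_div hkM (tsub_le_tsub_left hkM _))
  have hκn : ∀ t, 2 * ∫⁻ s in Ioc 0 t, κ s ≤ n := by
    intro t
    refine le_trans ?_ hn.le
    rw [← lintegral_const_mul _ hκ]
    have : ∀ s, 2 * κ s = wnorm 1 (fun ξ => ‖U s ξ‖ₑ) + wnorm 1 (fun ξ => ‖W s ξ‖ₑ) := fun s =>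
      ENNReal.mul_div_cancel two_ne_zero ENNReal.ofNat_ne_top
    simp only [this]
    rw [lintegral_add_left hUm, two_mul]
    exact add_le_add ((lintegral_mono_set Ioc_subset_Ioi_self).trans hU1)
      ((lintegral_mono_set Ioc_subset_Ioi_self).trans hW1)
  have hκfin : ∀ t, 0 ≤ t → ∫⁻ s in Ioc 0 t, κ s ≠ ∞ := fun t _ htop => by
    have := hκn t
    rw [htop, ENNReal.mul_top two_ne_zero, top_le_iff] at this
    exact ENNReal.natCast_ne_top n this
  have hsub : ∀ {u w : R3 → C3} (s : ℝ), Measurable u → wnorm s (fun ξ => ‖u ξ - w ξ‖ₑ) ≤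
      wnorm s (fun ξ => ‖u ξ‖ₑ) + wnorm s (fun ξ => ‖w ξ‖ₑ) := by
    intro u w s hu
    refine (wnorm_mono s fun ξ => enorm_sub_le).trans ?_
    unfold wnorm
    rw [← lintegral_add_left (by fun_prop)]
    simp only [mul_add, le_refl]
  have hz₀ : z₀ ≠ ∞ := ne_top_of_le_ne_top (ENNReal.add_ne_top.2
    ⟨ne_top_of_le_ne_top hMtop hhM, ne_top_of_le_ne_top hMtop hkM⟩) (hsub _ hU.measurable_data)
  have hZ2M : ∀ t, 0 ≤ t → Z t ≤ M + M := fun t ht =>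
    (hsub _ hU.measurable.of_uncurry_left).trans (add_le_add (hUM t ht) (hWM t ht))
  have hZκ : ∀ t, 0 ≤ t → ∫⁻ s in Ioc 0 t, Z s * κ s ≠ ∞ := fun t ht => by
    have h2M : M + M ≠ ∞ := ENNReal.add_ne_top.2 ⟨hMtop, hMtop⟩
    refine ne_top_of_le_ne_top (ENNReal.mul_ne_top h2M (hκfin t ht)) ?_
    rw [← lintegral_const_mul' _ _ h2M]
    refine setLIntegral_mono' measurableSet_Ioc fun s hs => ?_
    gcongr
    exact hZ2M s hs.1.le
  have hZ₁fin : ∀ t, ∫⁻ s in Ioc 0 t, Z₁ s ≠ ∞ := fun t => by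
    refine ne_top_of_le_ne_top (ENNReal.add_ne_top.2 ⟨hU.lintegral_Ioc_ne_top t,
      hW.lintegral_Ioc_ne_top t⟩) ?_
    rw [← lintegral_add_left hUm]
    exact lintegral_mono fun s => hsub _ hU.measurable.of_uncurry_left
  have hnl : ∀ t, ∫⁻ s in Ioc 0 t, wnorm (-1) (fun ξ => ‖nonlin (U s) ξ - nonlin (W s) ξ‖ₑ) ≤
      M * (∫⁻ s in Ioc 0 t, Z₁ s) + ∫⁻ s in Ioc 0 t, Z s * κ s := by
    intro t
    have hZ₁m : Measurable Z₁ := by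
      have : Measurable (Function.uncurry fun s ξ => U s ξ - W s ξ) :=
        hU.measurable.sub hW.measurable
      exact measurable_wnorm_enorm 1 this
    rw [← lintegral_const_mul' _ _ hMtop, ← lintegral_add_left (hZ₁m.const_mul M)]
    refine lintegral_mono_ae ?_
    filter_upwards [ae_lt_top hUm (hU.lintegral_Ioc_ne_top t),
      ae_lt_top hWm (hW.lintegral_Ioc_ne_top t), ae_restrict_mem measurableSet_Ioc] with s h1 h2 hs
    have h3 := two_mul_wnorm_nonlin_sub_le (hU.measurable.of_uncurry_left (x := s))
      (hW.measurable.of_uncurry_left (x := s)) hMtop (hUM s hs.1.le) (hWM s hs.1.le) h1.ne h2.ne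
    have h4 : wnorm 1 (fun ξ => ‖U s ξ‖ₑ) + wnorm 1 (fun ξ => ‖W s ξ‖ₑ) = 2 * κ s :=
      (ENNReal.mul_div_cancel two_ne_zero ENNReal.ofNat_ne_top).symm
    rw [h4, mul_left_comm _ 2, ← mul_add] at h3
    exact (ENNReal.mul_le_mul_iff_right two_ne_zero ENNReal.ofNat_ne_top).1 h3
  have hmain : ∀ t, 0 ≤ t → Z t + (ENNReal.ofReal μ - M) * ∫⁻ s in Ioc 0 t, Z₁ s ≤
      z₀ + ∫⁻ s in Ioc 0 t, Z s * κ s := by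
    intro t ht
    have h1 := (hU.energy_sub hμ hW ht).trans (add_le_add le_rfl (hnl t))
    -- The term `M ∫ Z₁` is absorbed by the dissipation.
    have h2 : (Z t + (ENNReal.ofReal μ - M) * ∫⁻ s in Ioc 0 t, Z₁ s) +
        M * (∫⁻ s in Ioc 0 t, Z₁ s) ≤
        (z₀ + ∫⁻ s in Ioc 0 t, Z s * κ s) + M * (∫⁻ s in Ioc 0 t, Z₁ s) := by
      rw [add_assoc, ← add_mul, tsub_add_cancel_of_le hM.le]
      refine h1.trans (le_of_eq ?_)
      ring
    exact (ENNReal.add_le_add_iff_right (ENNReal.mul_ne_top hMtop (hZ₁fin t))).1 h2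
  exact fun t ht => (hmain t ht).trans (gronwall hκ hz₀ hκfin hZκ
    (fun s hs => le_self_add.trans (hmain s hs)) n ht (hκn t))

/-! ### Well-posedness in terms of distributions -/

lemma IsSmallData.nonneg {μ : ℝ} {v₀ : 𝓢'(R3, C3)} (h : IsSmallData μ v₀) : 0 ≤ μ :=
  (ENNReal.ofReal_pos.1 (pos_of_gt h.small)).le

lemma IsSmallData.exists_fourier {μ : ℝ} {v₀ : 𝓢'(R3, C3)} (h : IsSmallData μ v₀) :
    ∃ g : R3 → C3, Measurable g ∧ HasFourier v₀ g := by
  obtain ⟨g, hg, hvg, -⟩ := exists_symmetric_fourier h.real h.divFree h.small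
  exact ⟨g, hg, hvg⟩

/-- The Lipschitz dependence on the data, for solutions in the sense of distributions. -/
lemma exists_lipschitz_const_XNorm {μ : ℝ} {M : ℝ≥0∞} (hM : M < ENNReal.ofReal μ) :
    ∃ C : ℝ≥0∞, C ≠ 0 ∧ C ≠ ∞ ∧ ∀ (v₀ w₀ : 𝓢'(R3, C3)) (v w : ℝ → 𝓢'(R3, C3)),
      IsSmallData μ v₀ → IsSmallData μ w₀ → IsGlobalSolution μ v₀ v → IsGlobalSolution μ w₀ w →
      XNorm (-1) v₀ ≤ M → XNorm (-1) w₀ ≤ M →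
      (∀ t, 0 ≤ t → XNorm (-1) (w t - v t) ≤ C * XNorm (-1) (w₀ - v₀)) ∧
      (ENNReal.ofReal μ - M) * (∫⁻ t in Ioi 0, XNorm 1 (w t - v t)) ≤
        C * XNorm (-1) (w₀ - v₀) := by
  obtain ⟨C, hC0, hCtop, hC⟩ := exists_lipschitz_const hM
  refine ⟨C, hC0, hCtop, fun v₀ w₀ v w hv₀ hw₀ hv hw hvM hwM => ?_⟩
  obtain ⟨h, hh, hvh⟩ := hv₀.exists_fourier
  obtain ⟨k, hk, hwk⟩ := hw₀.exists_fourier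
  obtain ⟨U, hU, hvU⟩ := hv.exists_isFourierSolution hv₀.nonneg hh hvh
  obtain ⟨W, hW, hwW⟩ := hw.exists_isFourierSolution hv₀.nonneg hk hwk
  have hdiff : ∀ s t, 0 ≤ t → XNorm s (w t - v t) = wnorm s (fun ξ => ‖W t ξ - U t ξ‖ₑ) :=
    fun s t ht => XNorm_eq ((hwW t ht).sub (hvU t ht)) s
  have hdata : XNorm (-1) (w₀ - v₀) = wnorm (-1) (fun ξ => ‖k ξ - h ξ‖ₑ) :=
    XNorm_eq (hwk.sub hvh) _
  rw [XNorm_eq hvh] at hvM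
  rw [XNorm_eq hwk] at hwM
  have hest := hC k h W U hW hU hwM hvM
  rw [← hdata] at hest
  refine ⟨fun t ht => ?_, ?_⟩
  · rw [hdiff _ t ht]
    exact le_self_add.trans (hest t ht)
  · have hpos : ENNReal.ofReal μ - M ≠ 0 := (tsub_pos_of_lt hM).ne'
    have htop : ENNReal.ofReal μ - M ≠ ∞ := ENNReal.sub_ne_top ENNReal.ofReal_ne_top
    rw [mul_comm, ← ENNReal.le_div_iff_mul_le (.inl hpos) (.inl htop)]
    refine lintegral_Ioi_le_of_forall fun t ht => ?_
    rw [ENNReal.le_div_iff_mul_le (.inl hpos) (.inl htop), mul_comm]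
    refine le_trans ?_ (le_add_self.trans (hest t ht))
    gcongr ?_ * ?_
    · exact le_rfl
    · exact setLIntegral_mono' measurableSet_Ioc fun s hs => (hdiff 1 s hs.1.le).le

lemma eq_of_XNorm_sub_eq_zero {s : ℝ} {f f' : 𝓢'(R3, C3)} (h : XNorm s (f - f') = 0) : f = f' := by
  obtain ⟨g, hg⟩ := exists_hasFourier_of_XNorm_lt (h ▸ zero_lt_one : XNorm s (f - f') < 1)
  have hge := hg.aestronglyMeasurable.enorm
  rw [XNorm_eq hg, lintegral_eq_zero_iff' (by fun_prop)] at h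
  have h0 : g =ᵐ[volume] 0 := by
    filter_upwards [h, ae_ne_zero] with ξ h1 h2
    have := Real.rpow_pos_of_pos (norm_pos_iff.2 h2) s
    simpa [this.not_ge] using h1
  exact sub_eq_zero.1 ((hg.congr_ae h0).eq HasFourier.zero)

end NavierStokes

open NavierStokes
theorem theorem1 (μ : ℝ) :
    -- existence, uniqueness and the estimate
    (∀ v₀ : 𝓢'(R3, C3), IsSmallData μ v₀ →
      ∃ v : ℝ → 𝓢'(R3, C3), IsGlobalSolution μ v₀ v ∧
        (∀ w : ℝ → 𝓢'(R3, C3), IsGlobalSolution μ v₀ w → ∀ t, 0 ≤ t → w t = v t) ∧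
        (⨆ t ∈ Set.Ici (0 : ℝ), (XNorm (-1) (v t) +
          (ENNReal.ofReal μ - XNorm (-1) v₀) *
            ∫⁻ τ in Set.Ioc 0 t, gradSupNorm (v τ))) ≤ XNorm (-1) v₀) ∧
    -- continuous dependence on the initial data
    (∀ (v₀ : 𝓢'(R3, C3)) (v : ℝ → 𝓢'(R3, C3)), IsSmallData μ v₀ → IsGlobalSolution μ v₀ v →
      ∀ ε : ℝ≥0∞, 0 < ε → ∃ δ : ℝ≥0∞, 0 < δ ∧
        ∀ (w₀ : 𝓢'(R3, C3)) (w : ℝ → 𝓢'(R3, C3)), IsSmallData μ w₀ → IsGlobalSolution μ w₀ w →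
          XNorm (-1) (w₀ - v₀) < δ →
          (∀ t, 0 ≤ t → XNorm (-1) (w t - v t) ≤ ε) ∧
          (∫⁻ t in Set.Ioi (0 : ℝ), XNorm 1 (w t - v t)) ≤ ε) := by
  refine ⟨fun v₀ hv₀ => ?_, fun v₀ v hv₀ hv ε hε => ?_⟩
  · obtain ⟨v, hv, hest⟩ := exists_global_solution hv₀
    refine ⟨v, hv, fun w hw t ht => ?_, iSup₂_le fun t ht => hest t ht⟩
    obtain ⟨C, -, -, hC⟩ := exists_lipschitz_const_XNorm hv₀.small
    have h0 : XNorm (-1) (v₀ - v₀) = 0 := by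
      rw [sub_self, XNorm_eq HasFourier.zero]; simp
    have h1 := (hC v₀ v₀ v w hv₀ hv₀ hv hw le_rfl le_rfl).1 t ht
    rw [h0, mul_zero] at h1
    exact eq_of_XNorm_sub_eq_zero (le_antisymm h1 zero_le)
  · -- Near `v₀`, all data satisfy a common bound `M < μ`.
    obtain ⟨M, hAM, hMμ⟩ := exists_between hv₀.small
    obtain ⟨C, hC0, hCtop, hC⟩ := exists_lipschitz_const_XNorm hMμ
    have hc : 0 < ENNReal.ofReal μ - M := tsub_pos_of_lt hMμ
    have hctop : ENNReal.ofReal μ - M ≠ ∞ := ENNReal.sub_ne_top ENNReal.ofReal_ne_top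
    refine ⟨min (M - XNorm (-1) v₀) (min (ε / C) ((ENNReal.ofReal μ - M) * ε / C)),
      lt_min (tsub_pos_of_lt hAM) (lt_min (ENNReal.div_pos hε.ne' hCtop)
        (ENNReal.div_pos (mul_ne_zero hc.ne' hε.ne') hCtop)), fun w₀ w hw₀ hw hδ => ?_⟩
    rw [lt_min_iff, lt_min_iff] at hδ
    obtain ⟨hδ1, hδ2, hδ3⟩ := hδ
    have hwM : XNorm (-1) w₀ ≤ M := by
      obtain ⟨h, hh, hvh⟩ := hv₀.exists_fourier
      obtain ⟨k, hk, hwk⟩ := hw₀.exists_fourier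
      rw [XNorm_eq (hwk.sub hvh), XNorm_eq hvh] at hδ1
      rw [XNorm_eq hvh] at hAM
      rw [XNorm_eq hwk]
      refine le_trans ?_ (lt_tsub_iff_right.1 hδ1).le
      rw [← lintegral_add_right _ (by fun_prop)]
      refine lintegral_mono fun ξ => ?_
      rw [← mul_add]
      gcongr
      simpa using enorm_add_le (k ξ - h ξ) (h ξ)
    obtain ⟨h1, h2⟩ := hC v₀ w₀ v w hv₀ hw₀ hv hw hAM.le hwM
    rw [ENNReal.lt_div_iff_mul_lt (.inl hC0) (.inl hCtop), mul_comm] at hδ2 hδ3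
    exact ⟨fun t ht => (h1 t ht).trans hδ2.le,
      (ENNReal.mul_le_mul_iff_right hc.ne' hctop).1 (h2.trans hδ3.le)⟩
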